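/- Let $\mathbb{S}^n\subset\mathbb{R}^{n+1}$ be the round unit sphere with geodesic distance functions $\mathbf{d}_q$, $q \in \mathbb{S}^n$, let $0<R\le \pi/2$ and $k\ge 1$, fix $p\in\mathbb{S}^n$, and let $B_R=\{q\in\mathbb{S}^n:\mathbf{d}_p(q)\le R\}$ be the closed geodesic ball about $p$, with boundary $\partial B_R=\{\mathbf{d}_p=R\}$. Let $I(R)=\int_0^R \sin^{k-1}s\,ds$, and let $|B^k_R|$ denote the volume of a geodesic ball of radius $R$ in $\mathbb{S}^k$. A minimal surface $\Sigma^k\subset B_R$ is a smooth immersion of a smooth $k$-manifold, possibly with boundary, into $\mathbb{S}^n$ with image in $B_R$ and with vanishing mean curvature in $\mathbb{S}^n$. It is a free boundary minimal surface if the manifold is compact and nonempty (that is, $\Sigma$ is nonempty and properly immersed in $B_R$), $\partial\Sigma\subset\partial B_R$, and $\Sigma$ meets $\partial B_R$ orthogonally along $\partial\Sigma$. Areas of immersed surfaces are counted with multiplicity. **Proposition 2.3.** Suppose that for each $y\in\partial B_R$ there is a tangent vector field $W$ on $B_R\setminus\{y\}$, continuously differentiable up to the boundary, such that 1. as $\mathbf{d}_y\searrow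 0$, $W=-2I(R)\,\mathbf{d}_y^{1-k}\,\nabla\mathbf{d}_y+o(\mathbf{d}_y^{1-k})$; 2. $W$ is tangent to $\partial B_R$ along $\partial B_R\setminus\{y\}$; 3. for every minimal surface $\Sigma^k\subset B_R$ one has $\operatorname{div}_\Sigma W\le 1$ on $\Sigma\setminus\{y\}$, and equality holds at all points of $\Sigma \setminus\{y\}$ only if $\nabla^\Sigma\mathbf{d}_p=\nabla\mathbf{d}_p$ on $\Sigma\setminus\{y,p\}$, where $\nabla^\Sigma \mathbf{d}_p$ is the orthogonal projection of $\nabla\mathbf{d}_p$ to the tangent spaces of $\Sigma$. Then every free boundary minimal surface $\Sigma^k\subset B_R$ satisfies $|\Sigma|\ge|B^k_R|$. If equality holds, then $\Sigma$ is a $k$-dimensional geodesic ball of radius $R$ centred at $p$: the immersion is injective and its image is $L\cap B_R$ for some $(k+1)$-dimensional linear subspace $L\subset\mathbb{R}^{n+1}$ that contains $p$. -/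

import Mathlib

open scoped Manifold ContDiff Topology RealInnerProductSpace

universe u

noncomputable section

namespace SphereBall

/-- The ambient Euclidean space `ℝⁿ⁺¹`, whose unit sphere is the round sphere `𝕊ⁿ`. -/
abbrev Amb (n : ℕ) : Type := EuclideanSpace ℝ (Fin (n + 1))

/-- The function `I_k(r) = ∫₀ʳ (sin s)^(k-1) ds` (used for `k ≥ 1`). -/
def radialInt (k : ℕ) (r : ℝ) : ℝ := ∫ s in (0 : ℝ)..r, Real.sin s ^ (k - 1)

/-- Geodesic distance on the unit sphere: the angle between two unit vectors. -/
def geodDist {n : ℕ} (p q : Amb n) : ℝ := InnerProductGeometry.angle p q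

/-- The gradient `∇ d_p` at a point of the unit sphere. The function `geodDist p` is defined on the
ambient space and is constant along rays from the origin, so at a point `q ≠ ± p` of the unit
sphere its Euclidean gradient is tangent to the sphere and is the gradient for the round metric. -/
def gradDist {n : ℕ} (p q : Amb n) : Amb n := gradient (fun z => geodDist p z) q

/-- The closed geodesic ball `B_R(p)` of the unit sphere. -/
def geodBall {n : ℕ} (p : Amb n) (R : ℝ) : Set (Amb n) := {q | ‖q‖ = 1 ∧ geodDist p q ≤ R}

/-- The boundary `∂B_R(p)` of the geodesic ball, a geodesic sphere. -/
def geodSphere {n : ℕ} (p : Amb n) (R : ℝ) : Set (Amb n) := {q | ‖q‖ = 1 ∧ geodDist p q = R}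

/-- The volume `|B^k_R|` of a geodesic ball of radius `R` in the round sphere `𝕊ᵏ ⊂ ℝᵏ⁺¹`, with
respect to the surface measure of the unit sphere. (The centre is the first basis vector.) -/
def ballVolume (k : ℕ) (R : ℝ) : ENNReal :=
  (MeasureTheory.volume : MeasureTheory.Measure (Amb k)).toSphere
    {q | geodDist (EuclideanSpace.single 0 1 : Amb k) (q : Amb k) ≤ R}

section Immersions

variable {n k : ℕ} [NeZero k] {M : Type*} [TopologicalSpace M]
  [ChartedSpace (EuclideanHalfSpace k) M]

/-- The differential `dX_x : T_x M → ℝⁿ⁺¹` of a map `X : M → ℝⁿ⁺¹` applied to the `i`-th coordinate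
vector of the preferred chart at `x`. -/
def coordDeriv (X : M → Amb n) (x : M) (i : Fin k) : Amb n :=
  (mfderiv (𝓡∂ k) 𝓘(ℝ, Amb n) X x : EuclideanSpace ℝ (Fin k) →L[ℝ] Amb n)
    (EuclideanSpace.single i 1)

/-- The tangent space `T_x Σ` of the immersed submanifold, as a subspace of `ℝⁿ⁺¹`. -/
def tangentPlane (F : M → Amb n) (x : M) : Submodule ℝ (Amb n) :=
  Submodule.span ℝ (Set.range (coordDeriv (k := k) F x))

/-- The inverse `g^{ij}` of the induced metric `g_{ij} = ⟨∂_i F, ∂_j F⟩` at `x`. -/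
def invMetric (F : M → Amb n) (x : M) : Matrix (Fin k) (Fin k) ℝ :=
  (Matrix.of fun i j => ⟪coordDeriv F x i, coordDeriv F x j⟫)⁻¹

/-- The divergence `div_Σ X = ∑ g^{ij} ⟨∇_i X, ∂_j F⟩` of a field `X` along `F`, tangent to the
sphere. As `∂_j F` is tangent to the sphere, the covariant derivative `∇_i X` of the sphere may be
replaced with the Euclidean derivative `∂_i X` in the inner product. -/
def surfDiv (F X : M → Amb n) (x : M) : ℝ :=
  ∑ i : Fin k, ∑ j : Fin k, invMetric F x i j * ⟪coordDeriv X x i, coordDeriv F x j⟫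

/-- The tangential gradient `∇^Σ d_p`: the orthogonal projection of `∇ d_p` to `T_x Σ`. -/
def surfGradDist (p : Amb n) (F : M → Amb n) (x : M) : Amb n :=
  (tangentPlane (k := k) F x).starProjection (gradDist p (F x))

/-- The second derivative `∂_i ∂_j F` at `x` in the preferred chart at `x`. -/
def coordDeriv₂ (F : M → Amb n) (x : M) (i j : Fin k) : Amb n :=
  iteratedFDerivWithin ℝ 2 (F ∘ (extChartAt (𝓡∂ k) x).symm) (Set.range (𝓡∂ k))
    (extChartAt (𝓡∂ k) x x) ![EuclideanSpace.single i 1, EuclideanSpace.single j 1]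

/-- The mean curvature vector in the sphere `∑ g^{ij} (∂_i ∂_j F)^⊥` of an immersion `F` with values
in the unit sphere; `⊥` is the projection to the orthogonal complement of `T_x Σ` in the tangent
space of the sphere, that is, to the orthogonal complement of `T_x Σ ⊕ ℝ F(x)` in `ℝⁿ⁺¹`. -/
def meanCurvature (F : M → Amb n) (x : M) : Amb n :=
  ((tangentPlane (k := k) F x ⊔ Submodule.span ℝ {F x})ᗮ).starProjection
    (∑ i : Fin k, ∑ j : Fin k, invMetric F x i j • coordDeriv₂ F x i j)

variable (k) in
/-- `F` is a minimal immersion, smooth up to the boundary of `M`, of the `k`-manifold `M` (with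
possibly empty boundary) into the sphere, with image in `B_R(p)`: a minimal surface
`Σᵏ ⊂ B_R(p)`. -/
structure IsMinimalSurfaceIn (p : Amb n) (R : ℝ) (F : M → Amb n) : Prop where
  smooth : ContMDiff (𝓡∂ k) 𝓘(ℝ, Amb n) ∞ F
  immersion : ∀ x, Function.Injective (mfderiv (𝓡∂ k) 𝓘(ℝ, Amb n) F x)
  mem_ball : ∀ x, F x ∈ geodBall p R
  minimal : ∀ x, meanCurvature (k := k) F x = 0

variable (k) in
/-- `F` is a free boundary minimal surface in `B_R(p)`: a minimal surface that maps `∂M` to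
`∂B_R(p)` and meets `∂B_R(p)` orthogonally there, i.e. the unit normal `∇ d_p` of `∂B_R(p)` is
tangent to the surface at every boundary point. -/
structure IsFreeBoundaryMinimal (p : Amb n) (R : ℝ) (F : M → Amb n) : Prop
    extends IsMinimalSurfaceIn k p R F where
  boundary_mem : ∀ x ∈ (𝓡∂ k).boundary M, F x ∈ geodSphere p R
  orthogonal : ∀ x ∈ (𝓡∂ k).boundary M, gradDist p (F x) ∈ tangentPlane (k := k) F x

/-- The area density `√det(⟨∂_i u, ∂_j u⟩)` of `F` in the chart `e`, where `u = F ∘ e⁻¹`. -/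
def areaDensity (F : M → Amb n) (e : OpenPartialHomeomorph M (EuclideanHalfSpace k))
    (a : EuclideanSpace ℝ (Fin k)) : ℝ :=
  Real.sqrt (Matrix.det (Matrix.of fun i j : Fin k =>
    ⟪fderivWithin ℝ (F ∘ (e.extend (𝓡∂ k)).symm) (Set.range (𝓡∂ k)) a (EuclideanSpace.single i 1),
      fderivWithin ℝ (F ∘ (e.extend (𝓡∂ k)).symm) (Set.range (𝓡∂ k)) a
        (EuclideanSpace.single j 1)⟫))

/-- The area measure of the immersion `F` on the domain of the chart `e`, as a measure on `M`. -/
def chartArea [MeasurableSpace M] (F : M → Amb n)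
    (e : OpenPartialHomeomorph M (EuclideanHalfSpace k)) : MeasureTheory.Measure M :=
  (((MeasureTheory.volume : MeasureTheory.Measure (EuclideanSpace ℝ (Fin k))).restrict
      (e.extend (𝓡∂ k)).target).withDensity
    (fun a => ENNReal.ofReal (areaDensity F e a))).map (e.extend (𝓡∂ k)).symm

variable (k) in
/-- The area measure of the immersion `F` on `M`. On overlaps of chart domains the measures
`chartArea F e` agree, and the measure on `M` that they define together is their supremum in the
lattice of measures. -/
def areaMeasure [MeasurableSpace M] (F : M → Amb n) : MeasureTheory.Measure M :=
  ⨆ e ∈ atlas (EuclideanHalfSpace k) M, chartArea F e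

variable (k) in
/-- The area `|Σ|` of the immersed submanifold, counted with multiplicity. -/
def area [MeasurableSpace M] (F : M → Amb n) : ENNReal := areaMeasure k F Set.univ

end Immersions

end SphereBall

end

/-! The image of the surface meets `∂B_R`. Otherwise the surface has no boundary, and the field `p -
⟪p, F⟫ F`, whose divergence is `-k ⟪p, F⟫ < 0`, contradicts the divergence theorem
(`exists_inner_eq`). Let `y` be a point of the image on `∂B_R`, and let `W` be the field that
belongs to `y`.

The divergence theorem holds on a minimal surface for fields that are tangent to the sphere but not
to the surface, because the normal part of the field is paired with the mean curvature only
(`divergence_in_coordinates`, `integral_surfDiv_eq_zero`). By the free boundary condition the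
conormal is proportional to `∇ d_p`, to which `W` is orthogonal, so the boundary contributes nothing
and the integral of `div W` is the flux into the singularity at `y`. Let `σ` be the area of the unit
sphere of `ℝᵏ`. The surface near a boundary point over `y` looks like a half-space, near an interior
point like a whole space; the fluxes are `σ I(R)` and `2 σ I(R)`. Hence `σ I(R) ≤ lim ∫ div W ≤
|Σ|`, and `σ I(R) = |B^k_R|` (`ballVolume_eq`). The singularity is removed with a smooth cutoff of
`‖F - y‖² / ε²`, so that the flux is a volume integral whose limit follows by rescaling and
dominated convergence (`tendsto_local_flux`, `tendsto_integral_radialCutoff_mul_surfDiv`,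
`le_area_of_surfDiv_le_one`).

In the case of equality `div W = 1` away from `y`, so `∇ d_p` is tangent to the surface, everywhere
by continuity (`mem_tangentPlane_of_ne`). Then an explicit radial field has divergence `1`, vanishes
on the boundary and is singular only over `p`. Its flux shows that `|Σ|` is `|B^k_R|` times the
number of points over `p`, so there is exactly one such point `x₀` (`area_eq_card_mul`). For `a`
orthogonal to `p` and to the tangent plane at `x₀`, the function `⟪a, F⟫² / (1 - ⟪p, F⟫²)` is
constant in the radial direction. The radial field multiplied by it has this function as its
divergence and no flux at `x₀`, so the function vanishes and the surface lies in the
`(k+1)`-dimensional space spanned by `p` and the tangent plane (`inner_eq_zero_of_orthogonal`). The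
projection to the tangent plane is then a local homeomorphism over the open ball with a one-point
fiber, and compactness and connectedness give injectivity and the image (`injective_and_range_eq`).
-/

set_option linter.unusedSectionVars false

noncomputable section

namespace SphereBall

/-! ### Gram matrices and traces with respect to an induced metric -/

section LinearAlgebra

variable {k : ℕ} {G : Type*} [NormedAddCommGroup G] [InnerProductSpace ℝ G]

/-- The Euclidean space in which the charts take their values. -/
abbrev Dom (k : ℕ) : Type := EuclideanSpace ℝ (Fin k)

/-- The `i`-th standard basis vector. -/
abbrev bv {k : ℕ} (i : Fin k) : Dom k := EuclideanSpace.single i 1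

/-- The Gram matrix of the images of the basis vectors under a linear map. -/
def gramMat (A : Dom k →L[ℝ] G) : Matrix (Fin k) (Fin k) ℝ :=
  Matrix.of fun i j => ⟪A (bv i), A (bv j)⟫

/-- The trace of a matrix of a bilinear form with respect to the metric induced by `A`. -/
def gramTrace (A : Dom k →L[ℝ] G) (Q : Fin k → Fin k → ℝ) : ℝ :=
  ∑ i, ∑ j, (gramMat A)⁻¹ i j * Q i j

/-- The coordinates of the orthogonal projection of `b` to the range of `A`. -/
def tanCoord (A : Dom k →L[ℝ] G) (b : G) : Dom k :=
  WithLp.toLp 2 fun i => ∑ j, (gramMat A)⁻¹ i j * ⟪b, A (bv j)⟫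

lemma tanCoord_apply (A : Dom k →L[ℝ] G) (b : G) (i : Fin k) :
    tanCoord A b i = ∑ j, (gramMat A)⁻¹ i j * ⟪b, A (bv j)⟫ := rfl

lemma dom_eq_sum (v : Dom k) : v = ∑ i, v i • (bv i : Dom k) := by
  ext j
  simp [Pi.single_apply]

lemma map_eq_sum {G' : Type*} [AddCommGroup G'] [Module ℝ G'] (A : Dom k →ₗ[ℝ] G') (v : Dom k) :
    A v = ∑ i, v i • A (bv i) := by
  conv_lhs => rw [dom_eq_sum v]
  simp only [map_sum, map_smul]

lemma clm_eq_sum (A : Dom k →L[ℝ] G) (v : Dom k) : A v = ∑ i, v i • A (bv i) :=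
  map_eq_sum A.toLinearMap v

lemma inner_clm_eq_sum (A : Dom k →L[ℝ] G) (v : Dom k) (b : G) :
    ⟪b, A v⟫ = ∑ i, v i * ⟪b, A (bv i)⟫ := by
  rw [clm_eq_sum A v, inner_sum]
  simp only [inner_smul_right]

lemma gramMat_isSymm (A : Dom k →L[ℝ] G) (i j : Fin k) : gramMat A i j = gramMat A j i :=
  real_inner_comm _ _

lemma linearIndependent_map_bv (A : Dom k →L[ℝ] G) (hA : Function.Injective A) :
    LinearIndependent ℝ fun i => A (bv i) := by
  rw [Fintype.linearIndependent_iff]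
  intro g hg i
  have h1 : A (WithLp.toLp 2 g) = 0 := by rw [clm_eq_sum]; exact hg
  have h2 := hA (h1.trans (map_zero A).symm)
  have := congrArg (fun v : Dom k => v i) h2
  simpa using this

lemma posDef_gramMat (A : Dom k →L[ℝ] G) (hA : Function.Injective A) : (gramMat A).PosDef :=
  Matrix.posDef_gram_of_linearIndependent (linearIndependent_map_bv A hA)

lemma det_gramMat_pos (A : Dom k →L[ℝ] G) (hA : Function.Injective A) : 0 < (gramMat A).det :=
  (posDef_gramMat A hA).det_pos

lemma gramMat_inv_symm (A : Dom k →L[ℝ] G) (i j : Fin k) :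
    (gramMat A)⁻¹ i j = (gramMat A)⁻¹ j i := by
  have h : (gramMat A).transpose = gramMat A := by
    ext i j; exact gramMat_isSymm A j i
  have h2 : ((gramMat A)⁻¹).transpose = (gramMat A)⁻¹ := by
    rw [Matrix.transpose_nonsing_inv, h]
  exact congrFun (congrFun h2 j) i

lemma inv_mul_gramMat (A : Dom k →L[ℝ] G) (hA : Function.Injective A) :
    (gramMat A)⁻¹ * gramMat A = 1 :=
  Matrix.nonsing_inv_mul _ (isUnit_iff_ne_zero.mpr (det_gramMat_pos A hA).ne')

lemma gramMat_mul_inv (A : Dom k →L[ℝ] G) (hA : Function.Injective A) :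
    gramMat A * (gramMat A)⁻¹ = 1 :=
  Matrix.mul_nonsing_inv _ (isUnit_iff_ne_zero.mpr (det_gramMat_pos A hA).ne')

/-- `A (tanCoord A b)` is the orthogonal projection of `b` to the range of `A`. -/
lemma inner_map_tanCoord (A : Dom k →L[ℝ] G) (hA : Function.Injective A) (b : G) (v : Dom k) :
    ⟪A (tanCoord A b), A v⟫ = ⟪b, A v⟫ := by
  have key : ∀ l, ⟪A (tanCoord A b), A (bv l)⟫ = ⟪b, A (bv l)⟫ := by
    intro l
    rw [real_inner_comm, inner_clm_eq_sum]
    simp only [tanCoord_apply, Finset.sum_mul]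
    rw [Finset.sum_comm]
    have : ∀ j, ∑ i, (gramMat A)⁻¹ i j * ⟪b, A (bv j)⟫ * ⟪A (bv l), A (bv i)⟫
        = ⟪b, A (bv j)⟫ * (gramMat A * (gramMat A)⁻¹) l j := by
      intro j
      rw [Matrix.mul_apply, Finset.mul_sum]
      refine Finset.sum_congr rfl fun i _ => ?_
      simp only [gramMat, Matrix.of_apply]; ring
    simp only [this, gramMat_mul_inv A hA, Matrix.one_apply]
    simp
  rw [inner_clm_eq_sum, inner_clm_eq_sum]
  simp only [key]

lemma tanCoord_map (A : Dom k →L[ℝ] G) (hA : Function.Injective A) (v : Dom k) :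
    tanCoord A (A v) = v := by
  have h : A (tanCoord A (A v) - v) = 0 := by
    rw [← inner_self_eq_zero (𝕜 := ℝ), map_sub, inner_sub_left, ← map_sub,
      inner_map_tanCoord A hA, sub_self]
  exact sub_eq_zero.mp (hA (h.trans (map_zero A).symm))

/-- Contraction with `g⁻¹` turns the covector `⟪b, ∂_j⟫` into the coordinates of the tangential part
of `b`. Traces of forms of rank one are evaluated in this way throughout. -/
lemma gramTrace_mul_inner (A : Dom k →L[ℝ] G) (α : Fin k → ℝ) (b : G) :
    gramTrace A (fun i j => α i * ⟪b, A (bv j)⟫) = ∑ i, α i * tanCoord A b i := by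
  simp only [gramTrace, tanCoord_apply, Finset.mul_sum]
  refine Finset.sum_congr rfl fun i _ => Finset.sum_congr rfl fun j _ => by ring

lemma gramTrace_add (A : Dom k →L[ℝ] G) (P Q : Fin k → Fin k → ℝ) :
    gramTrace A (fun i j => P i j + Q i j) = gramTrace A P + gramTrace A Q := by
  simp only [gramTrace, mul_add, Finset.sum_add_distrib]

lemma gramTrace_sub (A : Dom k →L[ℝ] G) (P Q : Fin k → Fin k → ℝ) :
    gramTrace A (fun i j => P i j - Q i j) = gramTrace A P - gramTrace A Q := by
  simp only [gramTrace, mul_sub, Finset.sum_sub_distrib]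

lemma gramTrace_smul (A : Dom k →L[ℝ] G) (c : ℝ) (Q : Fin k → Fin k → ℝ) :
    gramTrace A (fun i j => c * Q i j) = c * gramTrace A Q := by
  simp only [gramTrace, Finset.mul_sum]
  refine Finset.sum_congr rfl fun i _ => Finset.sum_congr rfl fun j _ => by ring

lemma gramTrace_sum {ι : Type*} (s : Finset ι) (A : Dom k →L[ℝ] G)
    (Q : ι → Fin k → Fin k → ℝ) :
    gramTrace A (fun i j => ∑ m ∈ s, Q m i j) = ∑ m ∈ s, gramTrace A (Q m) := by
  unfold gramTrace
  symm
  rw [Finset.sum_comm]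
  refine Finset.sum_congr rfl fun i _ => ?_
  rw [Finset.sum_comm]
  refine Finset.sum_congr rfl fun j _ => ?_
  rw [Finset.mul_sum]

lemma gramTrace_swap (A : Dom k →L[ℝ] G) (Q : Fin k → Fin k → ℝ) :
    gramTrace A (fun i j => Q j i) = gramTrace A Q := by
  unfold gramTrace
  rw [Finset.sum_comm]
  refine Finset.sum_congr rfl fun i _ => Finset.sum_congr rfl fun j _ => by
    rw [gramMat_inv_symm]

lemma gramTrace_mul_gramMat (A : Dom k →L[ℝ] G) (hA : Function.Injective A)
    (α : Fin k → Fin k → ℝ) :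
    gramTrace A (fun i j => ∑ m, α i m * ⟪A (bv m), A (bv j)⟫) = ∑ i, α i i := by
  have h : ∀ i, ∑ j, (gramMat A)⁻¹ i j * ∑ m, α i m * ⟪A (bv m), A (bv j)⟫ = α i i := by
    intro i
    have : ∀ j, (gramMat A)⁻¹ i j * ∑ m, α i m * ⟪A (bv m), A (bv j)⟫
        = ∑ m, α i m * ((gramMat A)⁻¹ i j * gramMat A j m) := by
      intro j
      rw [Finset.mul_sum]
      refine Finset.sum_congr rfl fun m _ => ?_
      rw [gramMat_isSymm A j m]
      simp only [gramMat, Matrix.of_apply]; ring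
    simp only [this]
    rw [Finset.sum_comm]
    simp only [← Finset.mul_sum, ← Matrix.mul_apply, inv_mul_gramMat A hA, Matrix.one_apply]
    simp
  simp only [gramTrace, h]

lemma gramTrace_gramMat (A : Dom k →L[ℝ] G) (hA : Function.Injective A) :
    gramTrace A (fun i j => ⟪A (bv i), A (bv j)⟫) = k := by
  have := gramTrace_mul_gramMat A hA (fun i m => if i = m then 1 else 0)
  simpa using this

/-- The matrix of a linear map in the standard basis. -/
def matOf (B : Dom k →L[ℝ] Dom k) : Matrix (Fin k) (Fin k) ℝ := Matrix.of fun l i => (B (bv i)) l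

lemma det_matOf (B : Dom k →L[ℝ] Dom k) : (matOf B).det = B.det := by
  have h : matOf B = LinearMap.toMatrix (EuclideanSpace.basisFun (Fin k) ℝ).toBasis
      (EuclideanSpace.basisFun (Fin k) ℝ).toBasis B.toLinearMap := by
    ext i j
    simp [matOf, LinearMap.toMatrix_apply]
  rw [h, LinearMap.det_toMatrix]

lemma of_bilin_comp (B : Dom k →L[ℝ] Dom k) (q : Dom k →ₗ[ℝ] Dom k →ₗ[ℝ] ℝ) :
    (Matrix.of fun i j => q (B (bv i)) (B (bv j))) =
      (matOf B).transpose * (Matrix.of fun i j => q (bv i) (bv j)) * matOf B := by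
  ext i j
  simp only [Matrix.of_apply, Matrix.mul_apply, Matrix.transpose_apply]
  rw [map_eq_sum q (B (bv i))]
  simp only [LinearMap.sum_apply, LinearMap.smul_apply, smul_eq_mul]
  have : ∀ l, (q (bv l)) (B (bv j)) = ∑ m, B (bv j) m * q (bv l) (bv m) := fun l => by
    rw [map_eq_sum (q (bv l)) (B (bv j))]; rfl
  simp only [this, Finset.mul_sum, Finset.sum_mul]
  rw [Finset.sum_comm]
  refine Finset.sum_congr rfl fun m _ => Finset.sum_congr rfl fun l _ => ?_
  simp only [matOf, Matrix.of_apply]; ring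

/-- The bilinear form `(v, w) ↦ ⟨Y v, A w⟩`. -/
def pairForm (Y A : Dom k →L[ℝ] G) : Dom k →ₗ[ℝ] Dom k →ₗ[ℝ] ℝ :=
  LinearMap.mk₂ ℝ (fun v w => ⟪Y v, A w⟫)
    (fun _ _ _ => by simp [inner_add_left]) (fun _ _ _ => by simp [inner_smul_left])
    (fun _ _ _ => by simp [inner_add_right]) (fun _ _ _ => by simp [inner_smul_right])

lemma gramMat_comp (A : Dom k →L[ℝ] G) (B : Dom k →L[ℝ] Dom k) :
    gramMat (A.comp B) = (matOf B).transpose * gramMat A * matOf B :=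
  of_bilin_comp B (pairForm A A)

lemma det_gramMat_comp (A : Dom k →L[ℝ] G) (B : Dom k →L[ℝ] Dom k) :
    (gramMat (A.comp B)).det = (gramMat A).det * B.det ^ 2 := by
  rw [gramMat_comp, Matrix.det_mul, Matrix.det_mul, Matrix.det_transpose, det_matOf]; ring

lemma gramTrace_eq_trace (A : Dom k →L[ℝ] G) (Q : Fin k → Fin k → ℝ) :
    gramTrace A Q = ((gramMat A)⁻¹ * (Matrix.of Q).transpose).trace := by
  simp [gramTrace, Matrix.trace, Matrix.mul_apply]

/-- Both the Gram matrix and the matrix of `q` change by congruence with the matrix of `B`, so the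
product under the trace is conjugated. This makes divergence, mean curvature and flux independent of
the chart. -/
lemma gramTrace_comp (A : Dom k →L[ℝ] G) (B : Dom k →L[ℝ] Dom k)
    (hB : B.det ≠ 0) (q : Dom k →ₗ[ℝ] Dom k →ₗ[ℝ] ℝ) :
    gramTrace (A.comp B) (fun i j => q (B (bv i)) (B (bv j))) =
      gramTrace A (fun i j => q (bv i) (bv j)) := by
  have hu : IsUnit (matOf B).det := by rw [det_matOf]; exact isUnit_iff_ne_zero.mpr hB
  have hu' : IsUnit (matOf B).transpose.det := by rwa [Matrix.det_transpose]
  rw [gramTrace_eq_trace, gramTrace_eq_trace, of_bilin_comp, gramMat_comp]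
  set b := matOf B
  set Q : Matrix (Fin k) (Fin k) ℝ := Matrix.of fun i j => q (bv i) (bv j)
  rw [Matrix.mul_inv_rev, Matrix.mul_inv_rev, Matrix.transpose_mul, Matrix.transpose_mul,
    Matrix.transpose_transpose]
  have h1 : b⁻¹ * ((gramMat A)⁻¹ * b.transpose⁻¹) * (b.transpose * (Q.transpose * b))
      = b⁻¹ * ((gramMat A)⁻¹ * Q.transpose * b) := by
    simp only [Matrix.mul_assoc]
    rw [Matrix.nonsing_inv_mul_cancel_left _ _ hu']
  rw [h1, Matrix.trace_mul_comm, Matrix.mul_assoc, Matrix.mul_nonsing_inv _ hu, Matrix.mul_one]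

lemma gramTrace_pair_comp (Y A : Dom k →L[ℝ] G) (B : Dom k →L[ℝ] Dom k) (hB : B.det ≠ 0) :
    gramTrace (A.comp B) (fun i j => ⟪Y.comp B (bv i), A.comp B (bv j)⟫) =
      gramTrace A (fun i j => ⟪Y (bv i), A (bv j)⟫) :=
  gramTrace_comp A B hB (pairForm Y A)

lemma gramTrace_inner_mul_inner_self (A : Dom k →L[ℝ] G) (hA : Function.Injective A)
    (v : Dom k) (b : G) :
    gramTrace A (fun i j => ⟪b, A (bv i)⟫ * ⟪A v, A (bv j)⟫) = ⟪b, A v⟫ := by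
  rw [gramTrace_mul_inner, tanCoord_map A hA, inner_clm_eq_sum]
  exact Finset.sum_congr rfl fun i _ => mul_comm _ _

end LinearAlgebra

/-! ### Smoothness of determinants and inverse matrices -/

section Matrices

variable {k : ℕ} {V : Type*} [NormedAddCommGroup V] [NormedSpace ℝ V]

lemma ContDiffWithinAt.matrix_det {m : ℕ∞ω} {M : V → Matrix (Fin k) (Fin k) ℝ} {s : Set V} {a : V}
    (h : ∀ i j, ContDiffWithinAt ℝ m (fun x => M x i j) s a) :
    ContDiffWithinAt ℝ m (fun x => (M x).det) s a := by
  simp only [Matrix.det_apply]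
  refine ContDiffWithinAt.sum fun σ _ => ?_
  refine ContDiffWithinAt.const_smul _ ?_
  exact contDiffWithinAt_prod fun i _ => h _ _

/-- By Cramer's rule an entry of the inverse is a quotient of two determinants, both polynomial in
the entries. -/
lemma ContDiffWithinAt.matrix_inv {m : ℕ∞ω} {M : V → Matrix (Fin k) (Fin k) ℝ} {s : Set V} {a : V}
    (h : ∀ i j, ContDiffWithinAt ℝ m (fun x => M x i j) s a) (ha : (M a).det ≠ 0) (i j : Fin k) :
    ContDiffWithinAt ℝ m (fun x => (M x)⁻¹ i j) s a := by
  have : ∀ x, (M x)⁻¹ i j = ((M x).det)⁻¹ * ((M x).updateRow j (Pi.single i 1)).det := by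
    intro x
    rw [Matrix.inv_def, Matrix.smul_apply, Matrix.adjugate_apply, Ring.inverse_eq_inv']
    rfl
  simp only [this]
  refine ((ContDiffWithinAt.matrix_det h).inv ha).mul (ContDiffWithinAt.matrix_det fun p q => ?_)
  by_cases hp : p = j
  · subst hp; simp only [Matrix.updateRow_self]; exact contDiffWithinAt_const
  · simp only [Matrix.updateRow_ne hp]; exact h p q

/-- **Jacobi's formula** for the derivative of a determinant. -/
lemma hasFDerivAt_det {M : V → Matrix (Fin k) (Fin k) ℝ} {M' : Fin k → Fin k → V →L[ℝ] ℝ} {a : V}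
    (h : ∀ i j, HasFDerivAt (fun x => M x i j) (M' i j) a) :
    HasFDerivAt (fun x => (M x).det) (∑ i, ∑ j, (M a).adjugate j i • M' i j) a := by
  have h1 : HasFDerivAt (fun x => (M x).det)
      (∑ σ : Equiv.Perm (Fin k), (Equiv.Perm.sign σ : ℤ) •
        ∑ j, (∏ i ∈ Finset.univ.erase j, M a (σ i) i) • M' (σ j) j) a := by
    simp only [Matrix.det_apply]
    refine HasFDerivAt.fun_sum fun σ _ => ?_
    have := HasFDerivAt.finsetProd (u := Finset.univ) (fun i (_ : i ∈ Finset.univ) => h (σ i) i)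
    exact (this.const_smul ((Equiv.Perm.sign σ : ℤ) : ℤ))
  convert h1 using 1
  ext v
  simp only [sum_apply, smul_apply, smul_eq_mul,
    Finset.smul_sum]
  rw [Finset.sum_comm]
  rw [Finset.sum_comm (s := (Finset.univ : Finset (Equiv.Perm (Fin k))))]
  refine Finset.sum_congr rfl fun j _ => ?_
  -- The cofactor sum is the determinant with column `j` replaced by its derivative; its Leibniz
  -- expansion is the `j`-th part of the product rule.
  have h2 : ∑ i, (M a).adjugate j i * (M' i j) v
      = ((M a).updateCol j (fun i => M' i j v)).det := by
    rw [← Matrix.cramer_apply, Matrix.cramer_eq_adjugate_mulVec]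
    rfl
  rw [h2, Matrix.det_apply]
  refine Finset.sum_congr rfl fun σ _ => ?_
  rw [← Finset.mul_prod_erase _ _ (Finset.mem_univ j)]
  rw [Matrix.updateCol_self]
  rw [Finset.prod_congr rfl (g := fun i => M a (σ i) i) fun i hi =>
    Matrix.updateCol_ne (Finset.ne_of_mem_erase hi)]
  rw [Units.smul_def, mul_comm]

end Matrices

end SphereBall

end

noncomputable section

namespace SphereBall

/-! ### First and second derivatives in arbitrary charts -/

section Charts

variable {n k : ℕ} [NeZero k] {M : Type*} [TopologicalSpace M]
  [ChartedSpace (EuclideanHalfSpace k) M]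
  {G : Type*} [NormedAddCommGroup G] [NormedSpace ℝ G]

/-- The half-space in which the charts take their values. -/
abbrev halfSp (k : ℕ) [NeZero k] : Set (Dom k) := Set.range (𝓡∂ k)

/-- The differential of a map, in the preferred chart at the point. -/
def surfDer (X : M → G) (x : M) : Dom k →L[ℝ] G := mfderiv (𝓡∂ k) 𝓘(ℝ, G) X x

/-- The differential of a map, in the chart `e`. -/
def locDer (e : OpenPartialHomeomorph M (EuclideanHalfSpace k)) (X : M → G) (a : Dom k) :
    Dom k →L[ℝ] G :=
  fderivWithin ℝ (X ∘ (e.extend (𝓡∂ k)).symm) (halfSp k) a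

/-- The second derivative of a map, in the chart `e`. -/
def locDer₂ (e : OpenPartialHomeomorph M (EuclideanHalfSpace k)) (X : M → G) (a : Dom k) :
    Dom k →L[ℝ] Dom k →L[ℝ] G :=
  fderivWithin ℝ (locDer e X) (halfSp k) a

lemma two_le_infty : (2 : ℕ∞ω) ≤ ∞ := by
  change ((2 : ℕ∞) : ℕ∞ω) ≤ ((⊤ : ℕ∞) : ℕ∞ω)
  exact_mod_cast le_top

lemma mem_halfSp {a : Dom k} : a ∈ halfSp k ↔ 0 ≤ a 0 := by
  rw [halfSp, range_modelWithCornersEuclideanHalfSpace]; rfl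

lemma uniqueDiffOn_halfSp : UniqueDiffOn ℝ (halfSp k) := (𝓡∂ k).uniqueDiffOn

variable {e : OpenPartialHomeomorph M (EuclideanHalfSpace k)}

lemma extend_target_mem_nhdsWithin {a : Dom k} (ha : a ∈ (e.extend (𝓡∂ k)).target) :
    (e.extend (𝓡∂ k)).target ∈ 𝓝[halfSp k] a := by
  have h := e.extend_target_mem_nhdsWithin (I := 𝓡∂ k) (y := (e.extend (𝓡∂ k)).symm a)
    (by rw [← e.extend_source (I := 𝓡∂ k)]; exact (e.extend (𝓡∂ k)).map_target ha)
  rwa [(e.extend (𝓡∂ k)).right_inv ha] at h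

lemma extend_target_subset : (e.extend (𝓡∂ k)).target ⊆ halfSp k :=
  e.extend_target_subset_range

lemma extend_symm_mem_source {a : Dom k} (ha : a ∈ (e.extend (𝓡∂ k)).target) :
    (e.extend (𝓡∂ k)).symm a ∈ e.source := by
  rw [← e.extend_source (I := 𝓡∂ k)]; exact (e.extend (𝓡∂ k)).map_target ha

lemma continuousWithinAt_extend_symm {a : Dom k} (ha : a ∈ (e.extend (𝓡∂ k)).target) :
    ContinuousWithinAt (e.extend (𝓡∂ k)).symm (halfSp k) a :=
  (e.continuousAt_extend_symm' ha).continuousWithinAt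

variable [IsManifold (𝓡∂ k) ∞ M]

lemma contDiffWithinAt_comp_extend_symm {m : ℕ∞ω} (hm : m ≤ ∞)
    (he : e ∈ atlas (EuclideanHalfSpace k) M)
    {X : M → G} {a : Dom k} (ha : a ∈ (e.extend (𝓡∂ k)).target)
    (hX : ContMDiffAt (𝓡∂ k) 𝓘(ℝ, G) m X ((e.extend (𝓡∂ k)).symm a)) :
    ContDiffWithinAt ℝ m (X ∘ (e.extend (𝓡∂ k)).symm) (halfSp k) a := by
  have h1 : ContMDiffOn 𝓘(ℝ, Dom k) (𝓡∂ k) ∞ (e.extend (𝓡∂ k)).symm ((𝓡∂ k) '' e.target) :=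
    contMDiffOn_extend_symm (I := 𝓡∂ k) (IsManifold.subset_maximalAtlas he)
  rw [← e.extend_target'] at h1
  have h2 : ContMDiffWithinAt 𝓘(ℝ, Dom k) (𝓡∂ k) m (e.extend (𝓡∂ k)).symm (halfSp k) a :=
    ((h1 a ha).mono_of_mem_nhdsWithin (extend_target_mem_nhdsWithin ha)).of_le hm
  exact (hX.comp_contMDiffWithinAt a h2).contDiffWithinAt

/-- The change of coordinates from the chart `e` to the preferred chart at `x`. -/
def toChart (e : OpenPartialHomeomorph M (EuclideanHalfSpace k)) (x : M) : Dom k → Dom k :=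
  (𝓡∂ k).extendCoordChange e (chartAt (EuclideanHalfSpace k) x)

lemma toChart_source {x : M} (hx : x ∈ e.source) :
    e.extend (𝓡∂ k) x ∈ ((𝓡∂ k).extendCoordChange e (chartAt (EuclideanHalfSpace k) x)).source := by
  rw [← OpenPartialHomeomorph.extend_image_source_inter]
  exact Set.mem_image_of_mem _ ⟨hx, mem_chart_source _ x⟩

lemma toChart_apply {x : M} (hx : x ∈ e.source) :
    toChart e x (e.extend (𝓡∂ k) x) = extChartAt (𝓡∂ k) x x := by
  simp only [toChart, ModelWithCorners.extendCoordChange, PartialEquiv.coe_trans,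
    Function.comp_apply, extChartAt]
  rw [e.extend_left_inv hx]

lemma contDiffWithinAt_toChart (he : e ∈ atlas (EuclideanHalfSpace k) M) {x : M}
    (hx : x ∈ e.source) :
    ContDiffWithinAt ℝ ∞ (toChart e x) (halfSp k) (e.extend (𝓡∂ k) x) :=
  (𝓡∂ k).contDiffWithinAt_extendCoordChange (IsManifold.subset_maximalAtlas he)
    (IsManifold.chart_mem_maximalAtlas x) (toChart_source hx)

lemma fderivWithin_toChart_det_ne_zero (he : e ∈ atlas (EuclideanHalfSpace k) M) {x : M}
    (hx : x ∈ e.source) :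
    (fderivWithin ℝ (toChart e x) (halfSp k) (e.extend (𝓡∂ k) x)).det ≠ 0 := by
  have h := (𝓡∂ k).isInvertible_fderivWithin_extendCoordChange (n := ∞) (by simp)
    (IsManifold.subset_maximalAtlas he) (IsManifold.chart_mem_maximalAtlas x) (toChart_source hx)
  have h2 : fderivWithin ℝ (toChart e x)
      ((𝓡∂ k).extendCoordChange e (chartAt (EuclideanHalfSpace k) x)).source
        (e.extend (𝓡∂ k) x) = fderivWithin ℝ (toChart e x) (halfSp k) (e.extend (𝓡∂ k) x) := by
    symm
    refine fderivWithin_of_mem_nhdsWithin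
      ((𝓡∂ k).extendCoordChange_source_mem_nhdsWithin (toChart_source hx))
      (uniqueDiffOn_halfSp _ ⟨e x, rfl⟩) ?_
    exact ((𝓡∂ k).contDiffOn_extendCoordChange (n := ∞) (IsManifold.subset_maximalAtlas he)
      (IsManifold.chart_mem_maximalAtlas x) _ (toChart_source hx)).differentiableWithinAt (by simp)
  rw [toChart] at h2 ⊢
  rw [← h2]
  obtain ⟨L, hL⟩ := h
  rw [← hL]
  exact (LinearEquiv.isUnit_det' L.toLinearEquiv).ne_zero

lemma toChart_eventually {x : M} (hx : x ∈ e.source) :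
    ∀ᶠ z in 𝓝[halfSp k] (e.extend (𝓡∂ k) x),
      z ∈ ((𝓡∂ k).extendCoordChange e (chartAt (EuclideanHalfSpace k) x)).source :=
  (𝓡∂ k).extendCoordChange_source_mem_nhdsWithin (toChart_source hx)

lemma comp_toChart_eventuallyEq (X : M → G) {x : M} (hx : x ∈ e.source) :
    (X ∘ (e.extend (𝓡∂ k)).symm) =ᶠ[𝓝[halfSp k] (e.extend (𝓡∂ k) x)]
      (X ∘ (extChartAt (𝓡∂ k) x).symm) ∘ toChart e x := by
  filter_upwards [toChart_eventually hx] with z hz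
  simp only [Function.comp_apply, toChart, ModelWithCorners.extendCoordChange,
    PartialEquiv.coe_trans, extChartAt]
  have hz2 : (e.extend (𝓡∂ k)).symm z ∈ (chartAt (EuclideanHalfSpace k) x).source := by
    have := hz.2
    simpa using this
  rw [(chartAt (EuclideanHalfSpace k) x).extend_left_inv hz2]

lemma mapsTo_toChart (x : M) : Set.MapsTo (toChart e x) Set.univ (halfSp k) := by
  intro z _
  simp only [toChart, ModelWithCorners.extendCoordChange, PartialEquiv.coe_trans,
    Function.comp_apply, OpenPartialHomeomorph.extend_coe]
  exact ⟨_, rfl⟩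

lemma surfDer_eq {X : M → G} {x : M} (hX : ContMDiffAt (𝓡∂ k) 𝓘(ℝ, G) 1 X x) :
    surfDer X x = fderivWithin ℝ (X ∘ (extChartAt (𝓡∂ k) x).symm) (halfSp k)
      (extChartAt (𝓡∂ k) x x) := by
  have hd := hX.mdifferentiableAt (by simp)
  exact hd.mfderiv

lemma contDiffWithinAt_comp_extChartAt_symm {m : ℕ∞ω} (hm : m ≤ ∞) {X : M → G} {x : M}
    (hX : ContMDiffAt (𝓡∂ k) 𝓘(ℝ, G) m X x) :
    ContDiffWithinAt ℝ m (X ∘ (extChartAt (𝓡∂ k) x).symm) (halfSp k) (extChartAt (𝓡∂ k) x x) := by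
  refine contDiffWithinAt_comp_extend_symm hm (chart_mem_atlas _ x)
    (mem_extChartAt_target x) ?_
  have : ((chartAt (EuclideanHalfSpace k) x).extend (𝓡∂ k)).symm (extChartAt (𝓡∂ k) x x) = x :=
    extChartAt_to_inv x
  rwa [this]

lemma locDer_eq_comp (he : e ∈ atlas (EuclideanHalfSpace k) M) {X : M → G} {x : M}
    (hx : x ∈ e.source) (hX : ContMDiffAt (𝓡∂ k) 𝓘(ℝ, G) 1 X x) :
    locDer e X (e.extend (𝓡∂ k) x) = (surfDer X x).comp
      (fderivWithin ℝ (toChart e x) (halfSp k) (e.extend (𝓡∂ k) x)) := by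
  have ha : e.extend (𝓡∂ k) x ∈ halfSp k := ⟨e x, rfl⟩
  rw [locDer, Filter.EventuallyEq.fderivWithin_eq_of_mem (comp_toChart_eventuallyEq X hx) ha,
    surfDer_eq hX, ← toChart_apply hx]
  refine fderivWithin_comp _ ?_ ((contDiffWithinAt_toChart he hx).differentiableWithinAt (by simp))
    ((mapsTo_toChart x).mono_left (Set.subset_univ _)) (uniqueDiffOn_halfSp _ ha)
  rw [toChart_apply hx]
  exact (contDiffWithinAt_comp_extChartAt_symm (by norm_num) hX).differentiableWithinAt (by simp)

/-- The second derivatives of a map in two charts. -/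
lemma locDer₂_eq (he : e ∈ atlas (EuclideanHalfSpace k) M) {X : M → G} {x : M}
    (hx : x ∈ e.source) (hX : ContMDiffAt (𝓡∂ k) 𝓘(ℝ, G) ∞ X x) :
    ∃ Γ : Dom k → Dom k → Dom k, ∀ v w,
      locDer₂ e X (e.extend (𝓡∂ k) x) v w =
        fderivWithin ℝ (fderivWithin ℝ (X ∘ (extChartAt (𝓡∂ k) x).symm) (halfSp k)) (halfSp k)
          (extChartAt (𝓡∂ k) x x)
          (fderivWithin ℝ (toChart e x) (halfSp k) (e.extend (𝓡∂ k) x) v)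
          (fderivWithin ℝ (toChart e x) (halfSp k) (e.extend (𝓡∂ k) x) w)
        + surfDer X x (Γ v w) := by
  set a := e.extend (𝓡∂ k) x
  set τ := toChart e x
  set u := X ∘ (extChartAt (𝓡∂ k) x).symm
  have ha : a ∈ halfSp k := ⟨e x, rfl⟩
  have hu : ContDiffWithinAt ℝ ∞ u (halfSp k) (τ a) := by
    rw [show τ a = _ from toChart_apply hx]
    exact contDiffWithinAt_comp_extChartAt_symm le_rfl hX
  have hτ : ContDiffWithinAt ℝ ∞ τ (halfSp k) a := contDiffWithinAt_toChart he hx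
  have hmaps : Set.MapsTo τ (halfSp k) (halfSp k) :=
    (mapsTo_toChart x).mono_left (Set.subset_univ _)
  have hτc : Filter.Tendsto τ (𝓝[halfSp k] a) (𝓝[halfSp k] (τ a)) :=
    hτ.continuousWithinAt.tendsto_nhdsWithin hmaps
  have hu' : ∀ᶠ z in 𝓝[halfSp k] (τ a), ContDiffWithinAt ℝ 2 u (halfSp k) z := by
    have := (hu.of_le (m := 2) two_le_infty).eventually (by simp)
    rwa [Set.insert_eq_of_mem (hmaps ha)] at this
  have hτ' : ∀ᶠ z in 𝓝[halfSp k] a, ContDiffWithinAt ℝ 2 τ (halfSp k) z := by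
    have := (hτ.of_le (m := 2) two_le_infty).eventually (by simp)
    rwa [Set.insert_eq_of_mem ha] at this
  have hloc : locDer e X =ᶠ[𝓝[halfSp k] a] fun z =>
      (fderivWithin ℝ u (halfSp k) (τ z)).comp (fderivWithin ℝ τ (halfSp k) z) := by
    have h0 : ∀ᶠ z in 𝓝[halfSp k] a, z ∈ halfSp k := eventually_mem_nhdsWithin
    have h1 := eventually_eventually_nhdsWithin.mpr (comp_toChart_eventuallyEq X hx)
    filter_upwards [h0, h1, hτc.eventually hu', hτ'] with z hz hz1 hz2 hz3
    have : (X ∘ (e.extend (𝓡∂ k)).symm) =ᶠ[𝓝[halfSp k] z] u ∘ τ := hz1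
    rw [locDer, this.fderivWithin_eq_of_mem hz]
    exact fderivWithin_comp _ (hz2.differentiableWithinAt (by simp))
      (hz3.differentiableWithinAt (by simp)) hmaps (uniqueDiffOn_halfSp _ hz)
  have hdu : HasFDerivWithinAt (fderivWithin ℝ u (halfSp k))
      (fderivWithin ℝ (fderivWithin ℝ u (halfSp k)) (halfSp k) (τ a)) (halfSp k) (τ a) :=
    ((hu.fderivWithin_right (m := 1) uniqueDiffOn_halfSp two_le_infty
      (hmaps ha)).differentiableWithinAt (by simp)).hasFDerivWithinAt
  have hdτ : HasFDerivWithinAt (fderivWithin ℝ τ (halfSp k))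
      (fderivWithin ℝ (fderivWithin ℝ τ (halfSp k)) (halfSp k) a) (halfSp k) a :=
    ((hτ.fderivWithin_right (m := 1) uniqueDiffOn_halfSp two_le_infty
      ha).differentiableWithinAt (by simp)).hasFDerivWithinAt
  have hτ1 := (hτ.differentiableWithinAt (by simp)).hasFDerivWithinAt
  have hcomp := hdu.comp a hτ1 hmaps
  have hfin := hcomp.clm_comp hdτ
  -- `Γ` is the second derivative of the change of coordinates. It enters through the differential
  -- of `X`; for `X = F` its contribution is tangential and is invisible to normal vectors.
  refine ⟨fun v w => fderivWithin ℝ (fderivWithin ℝ τ (halfSp k)) (halfSp k) a v w,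
    fun v w => ?_⟩
  rw [locDer₂, hloc.fderivWithin_eq_of_mem ha]
  rw [show fderivWithin ℝ (fun z => (fderivWithin ℝ u (halfSp k) (τ z)).comp
    (fderivWithin ℝ τ (halfSp k) z)) (halfSp k) a = _ from
      hfin.fderivWithin (uniqueDiffOn_halfSp _ ha)]
  rw [surfDer_eq (hX.of_le (by exact_mod_cast le_top)), ← toChart_apply hx]
  simp [add_comm, τ, u, a]

end Charts

/-! ### Divergence, tangent planes and mean curvature in a chart -/

section Geometry

variable {n k : ℕ} [NeZero k] {M : Type*} [TopologicalSpace M]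
  [ChartedSpace (EuclideanHalfSpace k) M]
  {e : OpenPartialHomeomorph M (EuclideanHalfSpace k)}

lemma surfDiv_def (F X : M → Amb n) (x : M) :
    surfDiv (k := k) F X x = gramTrace (surfDer (k := k) F x)
      (fun i j => ⟪surfDer (k := k) X x (bv i), surfDer F x (bv j)⟫) := rfl

lemma areaDensity_eq (F : M → Amb n) (a : Dom k) :
    areaDensity F e a = Real.sqrt (gramMat (locDer e F a)).det := rfl

lemma mem_tangentPlane_iff (F : M → Amb n) (x : M) (b : Amb n) :
    b ∈ tangentPlane (k := k) F x ↔ ∃ v : Dom k, surfDer F x v = b := by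
  have : tangentPlane (k := k) F x = LinearMap.range (surfDer F x : Dom k →L[ℝ] Amb n).toLinearMap := by
    apply le_antisymm
    · rw [tangentPlane, Submodule.span_le]
      rintro _ ⟨i, rfl⟩
      exact ⟨bv i, rfl⟩
    · rintro _ ⟨v, rfl⟩
      have := clm_eq_sum (surfDer F x) v
      change surfDer F x v ∈ _
      rw [this]
      exact Submodule.sum_mem _ fun i _ => Submodule.smul_mem _ _
        (Submodule.subset_span ⟨i, rfl⟩)
  rw [this]; rfl

variable [IsManifold (𝓡∂ k) ∞ M]

lemma surfDiv_eq_locDer (he : e ∈ atlas (EuclideanHalfSpace k) M) {F X : M → Amb n} {x : M}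
    (hx : x ∈ e.source) (hF : ContMDiffAt (𝓡∂ k) 𝓘(ℝ, Amb n) 1 F x)
    (hX : ContMDiffAt (𝓡∂ k) 𝓘(ℝ, Amb n) 1 X x) :
    surfDiv (k := k) F X x = gramTrace (locDer e F (e.extend (𝓡∂ k) x))
      (fun i j => ⟪locDer e X (e.extend (𝓡∂ k) x) (bv i),
        locDer e F (e.extend (𝓡∂ k) x) (bv j)⟫) := by
  rw [surfDiv_def, locDer_eq_comp he hx hF, locDer_eq_comp he hx hX,
    gramTrace_pair_comp _ _ _ (fderivWithin_toChart_det_ne_zero he hx)]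

lemma injective_locDer (he : e ∈ atlas (EuclideanHalfSpace k) M) {F : M → Amb n} {x : M}
    (hx : x ∈ e.source) (hF : ContMDiffAt (𝓡∂ k) 𝓘(ℝ, Amb n) 1 F x)
    (hi : Function.Injective (surfDer F x : Dom k →L[ℝ] Amb n)) :
    Function.Injective (locDer e F (e.extend (𝓡∂ k) x)) := by
  rw [locDer_eq_comp he hx hF]
  have hdet := fderivWithin_toChart_det_ne_zero he hx
  set B := fderivWithin ℝ (toChart e x) (halfSp k) (e.extend (𝓡∂ k) x)
  have hB : Function.Injective B := by
    have := LinearMap.equivOfDetNeZero B.toLinearMap hdet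
    exact (LinearEquiv.ofIsUnitDet (f := B.toLinearMap) (v := (EuclideanSpace.basisFun (Fin k) ℝ).toBasis)
      (v' := (EuclideanSpace.basisFun (Fin k) ℝ).toBasis)
      (by rw [LinearMap.det_toMatrix]; exact isUnit_iff_ne_zero.mpr hdet)).injective
  exact hi.comp hB

lemma mem_tangentPlane_iff_locDer (he : e ∈ atlas (EuclideanHalfSpace k) M) {F : M → Amb n} {x : M}
    (hx : x ∈ e.source) (hF : ContMDiffAt (𝓡∂ k) 𝓘(ℝ, Amb n) 1 F x) (b : Amb n) :
    b ∈ tangentPlane (k := k) F x ↔ ∃ v, locDer e F (e.extend (𝓡∂ k) x) v = b := by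
  rw [mem_tangentPlane_iff, locDer_eq_comp he hx hF]
  have hdet := fderivWithin_toChart_det_ne_zero he hx
  set B := fderivWithin ℝ (toChart e x) (halfSp k) (e.extend (𝓡∂ k) x)
  let L := LinearMap.equivOfDetNeZero B.toLinearMap hdet
  constructor
  · rintro ⟨v, rfl⟩
    refine ⟨L.symm v, ?_⟩
    have : B (L.symm v) = v := L.apply_symm_apply v
    simp [this]
  · rintro ⟨v, rfl⟩
    exact ⟨B v, rfl⟩

/-- The minimal surface equation in the chart `e`. -/
lemma gramTrace_locDer₂_eq_zero (he : e ∈ atlas (EuclideanHalfSpace k) M) {F : M → Amb n} {x : M}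
    (hx : x ∈ e.source) (hF : ContMDiffAt (𝓡∂ k) 𝓘(ℝ, Amb n) ∞ F x)
    (hmin : meanCurvature (k := k) F x = 0) {ξ : Amb n}
    (hξ : ∀ v, ⟪ξ, locDer e F (e.extend (𝓡∂ k) x) v⟫ = 0) (hξF : ⟪ξ, F x⟫ = 0) :
    gramTrace (locDer e F (e.extend (𝓡∂ k) x))
      (fun i j => ⟪ξ, locDer₂ e F (e.extend (𝓡∂ k) x) (bv i) (bv j)⟫) = 0 := by
  have hF1 : ContMDiffAt (𝓡∂ k) 𝓘(ℝ, Amb n) 1 F x := hF.of_le (by exact_mod_cast le_top)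
  have hT : ∀ v, ⟪ξ, surfDer (k := k) F x v⟫ = 0 := by
    intro v
    obtain ⟨w, hw⟩ := (mem_tangentPlane_iff_locDer he hx hF1 (surfDer F x v)).mp
      ((mem_tangentPlane_iff F x _).mpr ⟨v, rfl⟩)
    rw [← hw, hξ]
  have hξmem : ξ ∈ (tangentPlane (k := k) F x ⊔ Submodule.span ℝ {F x})ᗮ := by
    rw [← Submodule.inf_orthogonal]
    refine ⟨?_, ?_⟩
    · rw [SetLike.mem_coe, Submodule.mem_orthogonal]
      intro b hb
      obtain ⟨v, rfl⟩ := (mem_tangentPlane_iff F x b).mp hb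
      rw [real_inner_comm]; exact hT v
    · rw [SetLike.mem_coe, Submodule.mem_orthogonal_singleton_iff_inner_left]
      exact hξF
  have hN : ⟪ξ, ∑ i : Fin k, ∑ j : Fin k, invMetric F x i j • coordDeriv₂ F x i j⟫ = 0 := by
    rw [meanCurvature, Submodule.starProjection_apply_eq_zero_iff] at hmin
    exact (Submodule.mem_orthogonal _ _).mp hmin ξ hξmem
  obtain ⟨Γ, hΓ⟩ := locDer₂_eq he hx hF
  set D := fderivWithin ℝ (fderivWithin ℝ (F ∘ (extChartAt (𝓡∂ k) x).symm) (halfSp k)) (halfSp k)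
          (extChartAt (𝓡∂ k) x x)
  have hN2 : gramTrace (surfDer F x) (fun i j => ⟪ξ, D (bv i) (bv j)⟫) = 0 := by
    rw [← hN]
    simp only [inner_sum, inner_smul_right]
    refine Finset.sum_congr rfl fun i _ => Finset.sum_congr rfl fun j _ => ?_
    congr 2
    exact congrArg (fun z => ⟪ξ, z⟫)
      (iteratedFDerivWithin_two_apply (𝕜 := ℝ) (F ∘ (extChartAt (𝓡∂ k) x).symm)
        uniqueDiffOn_halfSp (z := extChartAt (𝓡∂ k) x x) ⟨_, rfl⟩ ![bv i, bv j]).symm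
  -- The term with `Γ` is tangential and `ξ` is normal, so the second derivatives transform as a
  -- bilinear form here.
  simp only [hΓ, inner_add_right, hT, add_zero]
  rw [locDer_eq_comp he hx hF1]
  rw [← hN2]
  let q : Dom k →ₗ[ℝ] Dom k →ₗ[ℝ] ℝ := LinearMap.mk₂ ℝ (fun v w => ⟪ξ, D v w⟫)
    (fun _ _ _ => by simp [inner_add_right]) (fun _ _ _ => by simp [inner_smul_right])
    (fun _ _ _ => by simp [inner_add_right]) (fun _ _ _ => by simp [inner_smul_right])
  exact gramTrace_comp (surfDer F x) _ (fderivWithin_toChart_det_ne_zero he hx) q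

end Geometry

end SphereBall

end

noncomputable section

namespace SphereBall

/-! ### The divergence formula in coordinates for minimal immersions -/

section LocalDivergence

variable {k : ℕ} {G : Type*} [NormedAddCommGroup G] [InnerProductSpace ℝ G]
  {V : Type*} [NormedAddCommGroup V] [NormedSpace ℝ V]

/-- The volume density of a linear map. -/
def volDens (A : Dom k →L[ℝ] G) : ℝ := Real.sqrt (gramMat A).det

lemma volDens_pos (A : Dom k →L[ℝ] G) (hA : Function.Injective A) : 0 < volDens A :=
  Real.sqrt_pos.mpr (det_gramMat_pos A hA)

lemma contDiffWithinAt_gramMat {m : ℕ∞ω} {A : V → Dom k →L[ℝ] G} {s : Set V} {a : V}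
    (hA : ContDiffWithinAt ℝ m A s a) (i j : Fin k) :
    ContDiffWithinAt ℝ m (fun z => gramMat (A z) i j) s a :=
  (hA.clm_apply contDiffWithinAt_const).inner ℝ (hA.clm_apply contDiffWithinAt_const)

lemma contDiffWithinAt_gramMat_inv {m : ℕ∞ω} {A : V → Dom k →L[ℝ] G} {s : Set V} {a : V}
    (hA : ContDiffWithinAt ℝ m A s a) (hi : Function.Injective (A a)) (i j : Fin k) :
    ContDiffWithinAt ℝ m (fun z => (gramMat (A z))⁻¹ i j) s a :=
  ContDiffWithinAt.matrix_inv (contDiffWithinAt_gramMat hA) (det_gramMat_pos _ hi).ne' i j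

lemma contDiffWithinAt_volDens {m : ℕ∞ω} {A : V → Dom k →L[ℝ] G} {s : Set V} {a : V}
    (hA : ContDiffWithinAt ℝ m A s a) (hi : Function.Injective (A a)) :
    ContDiffWithinAt ℝ m (fun z => volDens (A z)) s a :=
  (ContDiffWithinAt.matrix_det (contDiffWithinAt_gramMat hA)).sqrt (det_gramMat_pos _ hi).ne'

lemma contDiffWithinAt_tanCoord {m : ℕ∞ω} {A : V → Dom k →L[ℝ] G} {X : V → G} {s : Set V} {a : V}
    (hA : ContDiffWithinAt ℝ m A s a) (hX : ContDiffWithinAt ℝ m X s a)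
    (hi : Function.Injective (A a)) (i : Fin k) :
    ContDiffWithinAt ℝ m (fun z => tanCoord (A z) (X z) i) s a := by
  simp only [tanCoord_apply]
  refine ContDiffWithinAt.sum fun j _ => ?_
  exact (contDiffWithinAt_gramMat_inv hA hi i j).mul
    (hX.inner ℝ (hA.clm_apply contDiffWithinAt_const))

lemma contDiffWithinAt_gramTrace {m : ℕ∞ω} {A : V → Dom k →L[ℝ] G} {Q : V → Fin k → Fin k → ℝ}
    {s : Set V} {a : V} (hA : ContDiffWithinAt ℝ m A s a) (hi : Function.Injective (A a))
    (hQ : ∀ i j, ContDiffWithinAt ℝ m (fun z => Q z i j) s a) :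
    ContDiffWithinAt ℝ m (fun z => gramTrace (A z) (Q z)) s a := by
  unfold gramTrace
  refine ContDiffWithinAt.sum fun i _ => ContDiffWithinAt.sum fun j _ => ?_
  exact (contDiffWithinAt_gramMat_inv hA hi i j).mul (hQ i j)

/-- By Jacobi's formula the derivative of `√det g` is `√det g` times half the trace of `g⁻¹ dg`. The
two terms of `dg` have the same trace, which cancels the half. Only the values of the derivative are
needed later, hence the existential form. -/
lemma hasFDerivAt_volDens {A : V → Dom k →L[ℝ] G} {A' : V →L[ℝ] Dom k →L[ℝ] G} {a : V}
    (hA : HasFDerivAt A A' a) (hi : Function.Injective (A a)) :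
    ∃ L : V →L[ℝ] ℝ, HasFDerivAt (fun z => volDens (A z)) L a ∧
      ∀ v, L v = volDens (A a) *
        gramTrace (A a) (fun i j => ⟪A' v (bv i), A a (bv j)⟫) := by
  have hA1 : ∀ i, HasFDerivAt (fun z => A z (bv i))
      ((ContinuousLinearMap.apply ℝ G (bv i : Dom k)).comp A') a := fun i =>
    (ContinuousLinearMap.apply ℝ G (bv i : Dom k)).hasFDerivAt.comp a hA
  have hg : ∀ i j, HasFDerivAt (fun z => gramMat (A z) i j) _ a :=
    fun i j => (hA1 i).inner ℝ (hA1 j)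
  have hdet := hasFDerivAt_det (M := fun z => gramMat (A z)) hg
  have hpos := det_gramMat_pos _ hi
  refine ⟨_, hdet.sqrt hpos.ne', fun v => ?_⟩
  have hadj : ∀ i j, (gramMat (A a)).adjugate j i = (gramMat (A a)).det * (gramMat (A a))⁻¹ i j := by
    intro i j
    rw [gramMat_inv_symm, Matrix.inv_def, Matrix.smul_apply, Ring.inverse_eq_inv', smul_eq_mul,
      mul_inv_cancel_left₀ hpos.ne']
  simp only [smul_apply, sum_apply, smul_eq_mul, hadj]
  have h1 : ∑ i, ∑ j, (gramMat (A a)).det * (gramMat (A a))⁻¹ i j *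
        ((fderivInnerCLM ℝ (A a (bv i), A a (bv j))).comp
          (((ContinuousLinearMap.apply ℝ G (bv i : Dom k)).comp A').prod
            ((ContinuousLinearMap.apply ℝ G (bv j : Dom k)).comp A'))) v
      = 2 * ((gramMat (A a)).det *
        gramTrace (A a) (fun i j => ⟪A' v (bv i), A a (bv j)⟫)) := by
    have h2 : gramTrace (A a) (fun i j => ⟪A a (bv i), A' v (bv j)⟫ + ⟪A' v (bv i), A a (bv j)⟫)
        = 2 * gramTrace (A a) (fun i j => ⟪A' v (bv i), A a (bv j)⟫) := by
      rw [gramTrace_add, ← gramTrace_swap, two_mul]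
      simp only [real_inner_comm]
    rw [mul_left_comm, ← h2, gramTrace, Finset.mul_sum]
    refine Finset.sum_congr rfl fun i _ => ?_
    rw [Finset.mul_sum]
    refine Finset.sum_congr rfl fun j _ => ?_
    rw [mul_assoc]
    congr 2
  rw [h1]
  have hs : Real.sqrt (gramMat (A a)).det ^ 2 = (gramMat (A a)).det := Real.sq_sqrt hpos.le
  have hs0 : Real.sqrt (gramMat (A a)).det ≠ 0 := (Real.sqrt_pos.mpr hpos).ne'
  rw [volDens]
  field_simp
  rw [hs]

/-- The divergence of the tangential part of a field along a minimal immersion `u` into the unit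
sphere, in coordinates: `∑ ∂ᵢ (√g Xⁱ) = √g div X`. -/
lemma divergence_in_coordinates {u X : Dom k → G} {A : Dom k → Dom k →L[ℝ] G} {a : Dom k}
    (hu : ∀ᶠ z in 𝓝 a, HasFDerivAt u (A z) z) (hA : ContDiffAt ℝ 1 A a)
    (hi : ∀ᶠ z in 𝓝 a, Function.Injective (A z)) (hX : ContDiffAt ℝ 1 X a)
    (hu1 : ∀ᶠ z in 𝓝 a, ‖u z‖ = 1) (hXu : ⟪X a, u a⟫ = 0)
    (hmin : ∀ ξ, (∀ v, ⟪ξ, A a v⟫ = 0) → ⟪ξ, u a⟫ = 0 →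
      gramTrace (A a) (fun i j => ⟪ξ, fderiv ℝ A a (bv i) (bv j)⟫) = 0) :
    ∃ V' : Fin k → Dom k →L[ℝ] ℝ,
      (∀ i, HasFDerivAt (fun z => volDens (A z) * tanCoord (A z) (X z) i) (V' i) a) ∧
      ∑ i, V' i (bv i) =
        volDens (A a) * gramTrace (A a) (fun i j => ⟪fderiv ℝ X a (bv i), A a (bv j)⟫) := by
  have hia := hi.self_of_nhds
  have hA' : HasFDerivAt A (fderiv ℝ A a) a := (hA.differentiableAt (by simp)).hasFDerivAt
  have hX' : HasFDerivAt X (fderiv ℝ X a) a := (hX.differentiableAt (by simp)).hasFDerivAt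
  set A' := fderiv ℝ A a
  set X' := fderiv ℝ X a
  have hsym : ∀ v w, A' v w = A' w v := fun v w =>
    second_derivative_symmetric_of_eventually hu hA' v w
  obtain ⟨vol', hvol, hvol'⟩ := hasFDerivAt_volDens hA' hia
  have hc : ∀ i, HasFDerivAt (fun z => tanCoord (A z) (X z) i)
      (fderiv ℝ (fun z => tanCoord (A z) (X z) i) a) a := fun i =>
    ((contDiffWithinAt_tanCoord (s := Set.univ) hA.contDiffWithinAt hX.contDiffWithinAt hia
      i).contDiffAt Filter.univ_mem).differentiableAt (by simp) |>.hasFDerivAt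
  set c' := fun i => fderiv ℝ (fun z => tanCoord (A z) (X z) i) a
  set c := tanCoord (A a) (X a)
  refine ⟨fun i => _, fun i => hvol.mul (hc i), ?_⟩
  have hA1 : ∀ i, HasFDerivAt (fun z => A z (bv i))
      ((ContinuousLinearMap.apply ℝ G (bv i : Dom k)).comp A') a := fun i =>
    (ContinuousLinearMap.apply ℝ G (bv i : Dom k)).hasFDerivAt.comp a hA'
  -- the normal part
  have hC : HasFDerivAt (fun z => X z - ∑ m, tanCoord (A z) (X z) m • A z (bv m)) _ a :=
    hX'.sub (HasFDerivAt.fun_sum (u := Finset.univ) fun m _ => (hc m).smul (hA1 m))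
  set N := X a - ∑ m, c m • A a (bv m)
  have hperp : ∀ j, (fun z => ⟪X z - ∑ m, tanCoord (A z) (X z) m • A z (bv m), A z (bv j)⟫)
      =ᶠ[𝓝 a] fun _ => (0 : ℝ) := by
    intro j
    filter_upwards [hi] with z hz
    rw [← clm_eq_sum, inner_sub_left, inner_map_tanCoord _ hz, sub_self]
  have hNA : ∀ v, ⟪N, A a v⟫ = 0 := by
    intro v
    have h0 : ∀ j, ⟪N, A a (bv j)⟫ = 0 := fun j => (hperp j).self_of_nhds
    rw [inner_clm_eq_sum]; simp [h0]
  have hAu : ∀ v, ⟪A a v, u a⟫ = 0 := by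
    intro v
    have h1 := (hu.self_of_nhds).inner ℝ (hu.self_of_nhds)
    have h2 : (fun z => ⟪u z, u z⟫) =ᶠ[𝓝 a] fun _ => (1 : ℝ) := by
      filter_upwards [hu1] with z hz
      rw [real_inner_self_eq_norm_sq, hz]; norm_num
    have h3 := (h1.congr_of_eventuallyEq h2.symm).unique (hasFDerivAt_const (1 : ℝ) a)
    have h4 := congrArg (fun L : Dom k →L[ℝ] ℝ => L v) h3
    simp only [ContinuousLinearMap.comp_apply, ContinuousLinearMap.prod_apply,
      fderivInnerCLM_apply, zero_apply] at h4
    rw [real_inner_comm (A a v)] at h4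
    rw [real_inner_comm] at h4 ⊢
    linarith
  have hNu : ⟪N, u a⟫ = 0 := by
    rw [show N = X a - A a c from by rw [clm_eq_sum (A a) c], inner_sub_left, hXu, hAu, sub_zero]
  -- The formula is the derivative of `⟪X - X^T, ∂_j u⟫ = 0` in direction `i`. The last term is the
  -- second fundamental form in the direction of the normal part `N`; the middle sum is put, by
  -- symmetry of second derivatives, in the form in which the derivative of the density produces it.
  have hkey : ∀ i j, ⟪X' (bv i), A a (bv j)⟫ =
      ∑ m, c' m (bv i) * ⟪A a (bv m), A a (bv j)⟫ +
        ∑ m, c m * ⟪A' (bv m) (bv i), A a (bv j)⟫ - ⟪N, A' (bv i) (bv j)⟫ := by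
    intro i j
    have h1 := (hC.inner ℝ (hA1 j)).congr_of_eventuallyEq (hperp j).symm
    have h2 := h1.unique (hasFDerivAt_const (0 : ℝ) a)
    have h4 := congrArg (fun L : Dom k →L[ℝ] ℝ => L (bv i)) h2
    simp only [ContinuousLinearMap.comp_apply, ContinuousLinearMap.prod_apply,
      fderivInnerCLM_apply, zero_apply, sub_apply, sum_apply,
      add_apply, smul_apply, ContinuousLinearMap.smulRight_apply,
      ContinuousLinearMap.apply_apply, inner_sub_left, sum_inner, inner_add_left,
      real_inner_smul_left, Finset.sum_add_distrib] at h4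
    have h5 : ⟪N, A' (bv i) (bv j)⟫ = ⟪X a, A' (bv i) (bv j)⟫ -
        ∑ m, c m * ⟪A a (bv m), A' (bv i) (bv j)⟫ := by
      simp only [N, inner_sub_left, sum_inner, real_inner_smul_left]
    have h6 : ∀ m, A' (bv m) (bv i) = A' (bv i) (bv m) := fun m => hsym _ _
    simp only [h6]
    rw [h5]
    linarith
  -- After taking the trace, the term with `N` vanishes by minimality, because `N` is orthogonal to
  -- the tangent plane and to `u`.
  have hfin : gramTrace (A a) (fun i j => ⟪X' (bv i), A a (bv j)⟫) =
      ∑ i, c' i (bv i) + ∑ m, c m *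
        gramTrace (A a) (fun i j => ⟪A' (bv m) (bv i), A a (bv j)⟫) := by
    simp only [hkey]
    rw [gramTrace_sub, gramTrace_add, gramTrace_mul_gramMat _ hia (fun i m => c' m (bv i)),
      hmin N hNA hNu, sub_zero, gramTrace_sum]
    simp only [gramTrace_smul]
  rw [hfin]
  simp only [add_apply, smul_apply, smul_eq_mul, hvol', Finset.sum_add_distrib, mul_add,
    Finset.mul_sum]
  congr 1
  exact Finset.sum_congr rfl fun m _ => by ring

end LocalDivergence

end SphereBall

end

noncomputable section

namespace SphereBall

/-! ### The divergence theorem on the half-space -/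

section HalfSpace

open MeasureTheory

lemma convex_halfSp {k : ℕ} [NeZero k] : Convex ℝ (halfSp k) := by
  intro x hx y hy s t hs ht _
  rw [mem_halfSp] at *
  simp only [PiLp.add_apply, PiLp.smul_apply, smul_eq_mul]
  positivity

lemma isClosed_halfSp {k : ℕ} [NeZero k] : IsClosed (halfSp k) := by
  have : halfSp k = {z : Dom k | 0 ≤ z 0} := by ext z; exact mem_halfSp
  rw [this]
  exact isClosed_le continuous_const (by fun_prop)

lemma interior_halfSp {k : ℕ} [NeZero k] : interior (halfSp k) = {z : Dom k | 0 < z 0} :=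
  interior_range_modelWithCornersEuclideanHalfSpace k

lemma volume_frontier_halfSp {k : ℕ} [NeZero k] : volume (frontier (halfSp k)) = 0 :=
  convex_halfSp.addHaar_frontier volume

lemma ae_interior_halfSp {k : ℕ} [NeZero k] :
    ∀ᵐ z ∂(volume.restrict (halfSp k)), z ∈ interior (halfSp k) := by
  rw [ae_restrict_iff' isClosed_halfSp.measurableSet]
  have h : ∀ᵐ z : Dom k, z ∉ frontier (halfSp k) :=
    measure_eq_zero_iff_ae_notMem.mp volume_frontier_halfSp
  filter_upwards [h] with z hz hzH
  by_contra hcon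
  exact hz ⟨subset_closure hzH, hcon⟩

/-- The divergence theorem on the half-space, for a compactly supported field that is tangent to
the boundary. -/
theorem integral_divergence_halfSp {k : ℕ} [NeZero k] (V : Fin k → Dom k → ℝ)
    (V' : Fin k → Dom k → Dom k →L[ℝ] ℝ) {K : Set (Dom k)} (hK : IsCompact K)
    (hVK : ∀ i, ∀ z ∈ halfSp k, z ∉ K → V i z = 0)
    (hVc : ∀ i, ContinuousOn (V i) (halfSp k))
    (hVd : ∀ i, ∀ z ∈ interior (halfSp k), HasFDerivAt (V i) (V' i z) z)
    (hV0 : ∀ z : Dom k, z 0 = 0 → V 0 z = 0)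
    (hint : IntegrableOn (fun z => ∑ i, V' i z (bv i)) (halfSp k)) :
    ∫ z in halfSp k, ∑ i, V' i z (bv i) = 0 := by
  -- The strict bound keeps `K` away from the faces `|z i| = r` of the box used below.
  obtain ⟨r, hr0, hr⟩ : ∃ r : ℝ, 0 < r ∧ ∀ z ∈ K, ∀ i, |z i| < r := by
    obtain ⟨r, hr⟩ := hK.isBounded.exists_norm_le
    refine ⟨|r| + 1, by positivity, fun z hz i => ?_⟩
    have h1 : ‖z i‖ ≤ ‖z‖ := PiLp.norm_apply_le z i
    rw [Real.norm_eq_abs] at h1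
    have := hr z hz
    have := le_abs_self r
    linarith
  set D : Dom k → ℝ := fun z => ∑ i, V' i z (bv i)
  obtain ⟨m, rfl⟩ := Nat.exists_eq_succ_of_ne_zero (NeZero.ne k)
  have hD0 : ∀ z ∈ interior (halfSp (m + 1)), z ∉ K → D z = 0 := by
    intro z hz hzK
    have : ∀ i, V' i z = 0 := by
      intro i
      have h1 : V i =ᶠ[𝓝 z] fun _ => (0 : ℝ) := by
        filter_upwards [hK.isClosed.isOpen_compl.mem_nhds hzK, isOpen_interior.mem_nhds hz]
          with w hw hw2
        exact hVK i w (interior_subset hw2) hw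
      exact ((hVd i z hz).congr_of_eventuallyEq h1.symm).unique (hasFDerivAt_const (0 : ℝ) z)
    simp [D, this]
  -- The box is `[0, r] × [-r, r]ᵐ`. On the faces `|z i| = r` the field vanishes as they avoid `K`;
  -- on the remaining face `z 0 = 0` only the component `V 0` counts, and it vanishes by `hV0`.
  set a : Fin (m + 1) → ℝ := fun i => if i = 0 then 0 else -r
  set b : Fin (m + 1) → ℝ := fun _ => r
  have hab : a ≤ b := by
    intro i; simp only [a, b]; split_ifs <;> linarith
  set ψ : (Fin (m + 1) → ℝ) → Dom (m + 1) := WithLp.toLp 2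
  have hψ : MeasurePreserving ψ volume volume := PiLp.volume_preserving_toLp (Fin (m + 1))
  have hψe : MeasurableEmbedding ψ :=
    (MeasurableEquiv.toLp 2 (Fin (m + 1) → ℝ)).measurableEmbedding
  have hψH : ∀ w ∈ Set.Icc a b, ψ w ∈ halfSp (m + 1) := by
    intro w hw
    rw [mem_halfSp]
    have := hw.1 0
    simpa [a] using this
  have hψI : ∀ w ∈ Set.pi Set.univ (fun i => Set.Ioo (a i) (b i)),
      ψ w ∈ interior (halfSp (m + 1)) := by
    intro w hw
    rw [interior_halfSp]
    have := (hw 0 (Set.mem_univ _)).1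
    simpa [a] using this
  let L : (Fin (m + 1) → ℝ) →L[ℝ] Dom (m + 1) :=
    (PiLp.continuousLinearEquiv 2 ℝ (fun _ : Fin (m + 1) => ℝ)).symm.toContinuousLinearMap
  have hL : ∀ w, L w = ψ w := fun w => rfl
  have hsub : Set.Icc a b ⊆ ψ ⁻¹' halfSp (m + 1) := hψH
  have hintP : IntegrableOn (fun w => D (ψ w)) (ψ ⁻¹' halfSp (m + 1)) :=
    (hψ.integrableOn_comp_preimage hψe).mpr hint
  have hdiv := integral_divergence_of_hasFDerivAt_off_countable' a b hab
    (fun i w => V i (ψ w)) (fun i w => (V' i (ψ w)).comp L) ∅ Set.countable_empty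
    (fun i => (hVc i).comp L.continuous.continuousOn hψH)
    (fun w hw i => (hVd i _ (hψI w hw.1)).comp w L.hasFDerivAt)
    (hintP.mono_set hsub)
  have hcoe : ∀ w, ∑ i, ((V' i (ψ w)).comp L) (Pi.single i 1) = D (ψ w) := fun w => rfl
  simp only [hcoe] at hdiv
  rw [← hψ.setIntegral_preimage_emb hψe]
  change ∫ w in ψ ⁻¹' halfSp (m + 1), D (ψ w) = 0
  rw [setIntegral_eq_of_subset_of_ae_sdiff_eq_zero
    (hψe.measurable isClosed_halfSp.measurableSet).nullMeasurableSet hsub, hdiv]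
  · refine Finset.sum_eq_zero fun i _ => ?_
    have hout : ∀ w, ψ w ∈ halfSp (m + 1) → |w i| = r → V i (ψ w) = 0 := by
      intro w hw hwi
      refine hVK i _ hw fun hwK => ?_
      have := hr _ hwK i
      exact absurd hwi this.ne
    have hins : ∀ t ∈ Set.Icc (a i) (b i), ∀ x ∈ Set.Icc (a ∘ i.succAbove) (b ∘ i.succAbove),
        ψ (i.insertNth t x) ∈ halfSp (m + 1) := by
      intro t ht x hx
      refine hψH _ ?_
      rw [Fin.insertNth_mem_Icc]
      exact ⟨ht, hx⟩
    have h1 : ∫ x in Set.Icc (a ∘ i.succAbove) (b ∘ i.succAbove),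
        V i (ψ (i.insertNth (b i) x)) = 0 := by
      refine setIntegral_eq_zero_of_forall_eq_zero fun x hx => ?_
      refine hout _ (hins _ ⟨hab i, le_rfl⟩ x hx) ?_
      simp [b, abs_of_pos hr0]
    have h2 : ∫ x in Set.Icc (a ∘ i.succAbove) (b ∘ i.succAbove),
        V i (ψ (i.insertNth (a i) x)) = 0 := by
      refine setIntegral_eq_zero_of_forall_eq_zero fun x hx => ?_
      by_cases hi : i = 0
      · subst hi
        refine hV0 _ ?_
        simp [ψ, a]
      · refine hout _ (hins _ ⟨le_rfl, hab i⟩ x hx) ?_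
        simp [a, hi, abs_of_pos hr0]
    rw [h1, h2, sub_zero]
  -- The derivatives are controlled only in the interior of the half-space, so the vanishing of the
  -- divergence outside the box is shown off the frontier, a null set.
  · have h1 : ∀ᵐ w, ψ w ∉ frontier (halfSp (m + 1)) :=
      hψ.quasiMeasurePreserving.ae
        (measure_eq_zero_iff_ae_notMem.mp volume_frontier_halfSp)
    filter_upwards [h1] with w hw hwd
    have hwi : ψ w ∈ interior (halfSp (m + 1)) := by
      by_contra hcon
      exact hw ⟨subset_closure hwd.1, hcon⟩
    refine hD0 _ hwi fun hwK => hwd.2 ⟨fun i => ?_, fun i => ?_⟩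
    · have h2 := hr _ hwK i
      simp only [a]
      split_ifs with hi
      · subst hi; exact mem_halfSp.mp hwd.1
      · exact (abs_lt.mp h2).1.le
    · exact (abs_lt.mp (hr _ hwK i)).2.le

end HalfSpace

end SphereBall

end

noncomputable section

namespace SphereBall

/-! ### The area measure of an immersion -/

section AreaMeasure

open MeasureTheory

variable {n k : ℕ} [NeZero k] {M : Type*} [TopologicalSpace M]
  [ChartedSpace (EuclideanHalfSpace k) M] [IsManifold (𝓡∂ k) ∞ M]
  {e e' : OpenPartialHomeomorph M (EuclideanHalfSpace k)} {F : M → Amb n}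

lemma measurableSet_extend_target : MeasurableSet (e.extend (𝓡∂ k)).target := by
  rw [e.extend_target]
  exact ((e.open_target.preimage (𝓡∂ k).continuous_symm).measurableSet).inter
    (isClosed_halfSp.measurableSet)

lemma contDiffWithinAt_locDer {G : Type*} [NormedAddCommGroup G] [NormedSpace ℝ G]
    {m m' : ℕ∞ω} (hm' : m' ≤ ∞) (hm : m + 1 ≤ m') (he : e ∈ atlas (EuclideanHalfSpace k) M)
    {X : M → G} {a : Dom k} (ha : a ∈ (e.extend (𝓡∂ k)).target)
    (hX : ContMDiffAt (𝓡∂ k) 𝓘(ℝ, G) m' X ((e.extend (𝓡∂ k)).symm a)) :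
    ContDiffWithinAt ℝ m (locDer e X) (halfSp k) a :=
  (contDiffWithinAt_comp_extend_symm hm' he ha hX).fderivWithin_right uniqueDiffOn_halfSp hm
    (extend_target_subset ha)

lemma locDer_coordChange (he : e ∈ atlas (EuclideanHalfSpace k) M)
    (he' : e' ∈ atlas (EuclideanHalfSpace k) M) (hF : ContMDiff (𝓡∂ k) 𝓘(ℝ, Amb n) ∞ F)
    {a : Dom k} (ha : a ∈ ((𝓡∂ k).extendCoordChange e e').source) :
    locDer e F a = (locDer e' F ((𝓡∂ k).extendCoordChange e e' a)).comp
      (fderivWithin ℝ ((𝓡∂ k).extendCoordChange e e') (halfSp k) a) := by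
  have haH : a ∈ halfSp k := extend_target_subset ha.1
  have hτ := (𝓡∂ k).contDiffWithinAt_extendCoordChange (n := ∞) (IsManifold.subset_maximalAtlas he)
    (IsManifold.subset_maximalAtlas he') ha
  have hta : (𝓡∂ k).extendCoordChange e e' a ∈ (e'.extend (𝓡∂ k)).target :=
    (e'.extend (𝓡∂ k)).map_source ha.2
  have hev : (F ∘ (e.extend (𝓡∂ k)).symm) =ᶠ[𝓝[halfSp k] a]
      (F ∘ (e'.extend (𝓡∂ k)).symm) ∘ ((𝓡∂ k).extendCoordChange e e') := by
    filter_upwards [(𝓡∂ k).extendCoordChange_source_mem_nhdsWithin ha] with z hz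
    simp only [Function.comp_apply, ModelWithCorners.extendCoordChange, PartialEquiv.coe_trans]
    exact congrArg F ((e'.extend (𝓡∂ k)).left_inv hz.2).symm
  rw [locDer, hev.fderivWithin_eq_of_mem haH]
  refine fderivWithin_comp _ ?_ (hτ.differentiableWithinAt (by simp)) ?_
    (uniqueDiffOn_halfSp _ haH)
  · exact (contDiffWithinAt_comp_extend_symm le_rfl he' hta
      hF.contMDiffAt).differentiableWithinAt (by simp)
  · intro z _
    simp only [ModelWithCorners.extendCoordChange, PartialEquiv.coe_trans, Function.comp_apply,
      OpenPartialHomeomorph.extend_coe]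
    exact ⟨_, rfl⟩

lemma continuousOn_areaDensity (he : e ∈ atlas (EuclideanHalfSpace k) M)
    (hF : ContMDiff (𝓡∂ k) 𝓘(ℝ, Amb n) ∞ F) :
    ContinuousOn (areaDensity F e) (e.extend (𝓡∂ k)).target := by
  intro a ha
  have h1 : ContDiffWithinAt ℝ 0 (locDer e F) (halfSp k) a :=
    contDiffWithinAt_locDer le_rfl (by simp) he ha hF.contMDiffAt
  have h2 : ContinuousWithinAt (fun z => (gramMat (locDer e F z)).det) (halfSp k) a :=
    (ContDiffWithinAt.matrix_det (contDiffWithinAt_gramMat h1)).continuousWithinAt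
  exact (h2.sqrt).mono extend_target_subset

variable [MeasurableSpace M] [BorelSpace M]

/-- The inverse of the chart is continuous on the target only, so the set is obtained as the image
of a measurable subset of the subtype. -/
lemma measurableSet_target_inter_preimage {S : Set M} (hS : MeasurableSet S) :
    MeasurableSet ((e.extend (𝓡∂ k)).target ∩ (e.extend (𝓡∂ k)).symm ⁻¹' S) := by
  have hc : Continuous ((e.extend (𝓡∂ k)).target.domRestrict (e.extend (𝓡∂ k)).symm) :=
    continuousOn_iff_continuous_domRestrict.mp e.continuousOn_extend_symm
  have := (measurableSet_extend_target (e := e)).subtype_image (hc.measurable hS)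
  convert this using 1
  ext z
  constructor
  · rintro ⟨hz, hzS⟩
    exact ⟨⟨z, hz⟩, hzS, rfl⟩
  · rintro ⟨⟨w, hw⟩, hwS, rfl⟩
    exact ⟨hw, hwS⟩

lemma aemeasurable_extend_symm :
    AEMeasurable (e.extend (𝓡∂ k)).symm
      ((volume : Measure (Dom k)).restrict (e.extend (𝓡∂ k)).target) :=
  e.continuousOn_extend_symm.aemeasurable measurableSet_extend_target

lemma aemeasurable_areaDensity (he : e ∈ atlas (EuclideanHalfSpace k) M)
    (hF : ContMDiff (𝓡∂ k) 𝓘(ℝ, Amb n) ∞ F) :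
    AEMeasurable (areaDensity F e)
      ((volume : Measure (Dom k)).restrict (e.extend (𝓡∂ k)).target) :=
  (continuousOn_areaDensity he hF).aemeasurable measurableSet_extend_target

lemma lintegral_chartArea (he : e ∈ atlas (EuclideanHalfSpace k) M)
    (hF : ContMDiff (𝓡∂ k) 𝓘(ℝ, Amb n) ∞ F) {f : M → ENNReal} (hf : Measurable f) :
    ∫⁻ x, f x ∂(chartArea F e) = ∫⁻ a in (e.extend (𝓡∂ k)).target,
      ENNReal.ofReal (areaDensity F e a) * f ((e.extend (𝓡∂ k)).symm a) := by
  rw [chartArea, lintegral_map' hf.aemeasurable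
    (aemeasurable_extend_symm.mono_ac (withDensity_absolutelyContinuous _ _)),
    lintegral_withDensity_eq_lintegral_mul₀ (aemeasurable_areaDensity he hF).ennreal_ofReal
      (g := fun a => f ((e.extend (𝓡∂ k)).symm a)) (hf.comp_aemeasurable aemeasurable_extend_symm)]
  rfl

lemma chartArea_apply (he : e ∈ atlas (EuclideanHalfSpace k) M)
    (hF : ContMDiff (𝓡∂ k) 𝓘(ℝ, Amb n) ∞ F) {S : Set M} (hS : MeasurableSet S) :
    chartArea F e S = ∫⁻ a in (e.extend (𝓡∂ k)).target ∩ (e.extend (𝓡∂ k)).symm ⁻¹' S,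
      ENNReal.ofReal (areaDensity F e a) := by
  rw [← lintegral_indicator_one hS, lintegral_chartArea he hF (measurable_one.indicator hS),
    ← lintegral_indicator measurableSet_extend_target,
    ← lintegral_indicator (measurableSet_target_inter_preimage hS)]
  congr 1
  ext a
  by_cases h1 : a ∈ (e.extend (𝓡∂ k)).target
  · rw [Set.indicator_of_mem h1]
    by_cases h2 : (e.extend (𝓡∂ k)).symm a ∈ S
    · rw [Set.indicator_of_mem h2, Set.indicator_of_mem (Set.mem_inter h1 h2)]; simp
    · rw [Set.indicator_of_notMem h2, Set.indicator_of_notMem fun h => h2 h.2, mul_zero]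
  · rw [Set.indicator_of_notMem h1, Set.indicator_of_notMem fun h => h1 h.1]

/-- Under the change of coordinates `det g` acquires the square of the Jacobian determinant, so the
density acquires exactly the absolute value required by the change of variables formula. -/
lemma chartArea_eq_of_subset (he : e ∈ atlas (EuclideanHalfSpace k) M)
    (he' : e' ∈ atlas (EuclideanHalfSpace k) M) (hF : ContMDiff (𝓡∂ k) 𝓘(ℝ, Amb n) ∞ F)
    {S : Set M} (hS : MeasurableSet S) (h1 : S ⊆ e.source) (h2 : S ⊆ e'.source) :
    chartArea F e S = chartArea F e' S := by
  rw [chartArea_apply he hF hS, chartArea_apply he' hF hS]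
  set τ := (𝓡∂ k).extendCoordChange e e'
  set A := (e.extend (𝓡∂ k)).target ∩ (e.extend (𝓡∂ k)).symm ⁻¹' S
  have hAτ : A ⊆ τ.source := by
    rintro a ⟨ha, haS⟩
    refine ⟨ha, ?_⟩
    change (e.extend (𝓡∂ k)).symm a ∈ (e'.extend (𝓡∂ k)).source
    rw [e'.extend_source]
    exact h2 haS
  have himg : τ '' A = (e'.extend (𝓡∂ k)).target ∩ (e'.extend (𝓡∂ k)).symm ⁻¹' S := by
    ext b
    constructor
    · rintro ⟨a, ha, rfl⟩
      refine ⟨(e'.extend (𝓡∂ k)).map_source (hAτ ha).2, ?_⟩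
      change (e'.extend (𝓡∂ k)).symm ((e'.extend (𝓡∂ k)) ((e.extend (𝓡∂ k)).symm a)) ∈ S
      have h3 := (e'.extend (𝓡∂ k)).left_inv (hAτ ha).2
      rw [show (e'.extend (𝓡∂ k)).symm ((e'.extend (𝓡∂ k)) ((e.extend (𝓡∂ k)).symm a)) = _ from h3]
      exact ha.2
    · rintro ⟨hb, hbS⟩
      have hs : (e'.extend (𝓡∂ k)).symm b ∈ (e.extend (𝓡∂ k)).source := by
        rw [e.extend_source]; exact h1 hbS
      refine ⟨e.extend (𝓡∂ k) ((e'.extend (𝓡∂ k)).symm b),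
        ⟨(e.extend (𝓡∂ k)).map_source hs, ?_⟩, ?_⟩
      · change (e.extend (𝓡∂ k)).symm (e.extend (𝓡∂ k) ((e'.extend (𝓡∂ k)).symm b)) ∈ S
        rw [(e.extend (𝓡∂ k)).left_inv hs]; exact hbS
      · change e'.extend (𝓡∂ k) ((e.extend (𝓡∂ k)).symm
          (e.extend (𝓡∂ k) ((e'.extend (𝓡∂ k)).symm b))) = b
        rw [(e.extend (𝓡∂ k)).left_inv hs, (e'.extend (𝓡∂ k)).right_inv hb]
  have hτd : ∀ a ∈ A, HasFDerivWithinAt τ (fderivWithin ℝ τ (halfSp k) a) A a := by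
    intro a ha
    exact (((𝓡∂ k).contDiffWithinAt_extendCoordChange (n := ∞)
      (IsManifold.subset_maximalAtlas he) (IsManifold.subset_maximalAtlas he')
      (hAτ ha)).differentiableWithinAt (by simp)).hasFDerivWithinAt.mono
      (fun z hz => extend_target_subset hz.1)
  rw [← himg, lintegral_image_eq_lintegral_abs_det_fderiv_mul volume
    (measurableSet_target_inter_preimage hS) hτd (τ.injOn.mono hAτ)]
  refine setLIntegral_congr_fun (measurableSet_target_inter_preimage hS) fun a ha => ?_
  rw [areaDensity_eq, locDer_coordChange he he' hF (hAτ ha), det_gramMat_comp,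
    Real.sqrt_mul' _ (sq_nonneg _), Real.sqrt_sq_eq_abs, mul_comm,
    ENNReal.ofReal_mul (abs_nonneg _)]
  rfl

/-- On the domain of a chart, the area measure is the area measure of this chart. -/
lemma areaMeasure_restrict_source (he : e ∈ atlas (EuclideanHalfSpace k) M)
    (hF : ContMDiff (𝓡∂ k) 𝓘(ℝ, Amb n) ∞ F) :
    (areaMeasure k F).restrict e.source = chartArea F e := by
  have hes : MeasurableSet e.source := e.open_source.measurableSet
  have hzero : chartArea F e e.sourceᶜ = 0 := by
    rw [chartArea_apply he hF hes.compl]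
    have : (e.extend (𝓡∂ k)).target ∩ (e.extend (𝓡∂ k)).symm ⁻¹' e.sourceᶜ = ∅ := by
      ext a
      simp only [Set.mem_inter_iff, Set.mem_preimage, Set.mem_compl_iff, Set.mem_empty_iff_false,
        iff_false, not_and, not_not]
      exact fun ha => extend_symm_mem_source ha
    rw [this]; simp
  have hself : (chartArea F e).restrict e.source = chartArea F e := by
    rw [Measure.restrict_eq_self_of_ae_mem]
    exact measure_eq_zero_iff_ae_notMem.mp hzero |>.mono fun x hx => by simpa using hx
  apply le_antisymm
  · have hle : areaMeasure k F ≤ chartArea F e + (⊤ : Measure M).restrict e.sourceᶜ := by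
      refine iSup₂_le fun e' he' => ?_
      refine Measure.le_iff.mpr fun S hS => ?_
      rw [← measure_inter_add_sdiff S hes, Measure.add_apply]
      refine add_le_add ?_ ?_
      · have h1 : chartArea F e' (S ∩ e.source) = chartArea F e' (S ∩ e.source ∩ e'.source) := by
          have hzero' : chartArea F e' ((S ∩ e.source) \ e'.source) = 0 := by
            rw [chartArea_apply he' hF ((hS.inter hes).diff e'.open_source.measurableSet)]
            have : (e'.extend (𝓡∂ k)).target ∩
                (e'.extend (𝓡∂ k)).symm ⁻¹' ((S ∩ e.source) \ e'.source) = ∅ := by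
              ext a
              simp only [Set.mem_inter_iff, Set.mem_preimage, Set.mem_sdiff,
                Set.mem_empty_iff_false, iff_false, not_and, not_not]
              exact fun ha _ => extend_symm_mem_source ha
            rw [this]; simp
          rw [← measure_inter_add_sdiff (S ∩ e.source) e'.open_source.measurableSet, hzero',
            add_zero]
        rw [h1, chartArea_eq_of_subset he' he hF
          ((hS.inter hes).inter e'.open_source.measurableSet) Set.inter_subset_right
          (Set.inter_subset_left.trans Set.inter_subset_right)]
        exact measure_mono (Set.inter_subset_left.trans Set.inter_subset_left)
      · rw [Measure.restrict_apply hS, Set.sdiff_eq]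
        exact Measure.le_iff.mp le_top _ (hS.inter hes.compl)
    calc (areaMeasure k F).restrict e.source
        ≤ (chartArea F e + (⊤ : Measure M).restrict e.sourceᶜ).restrict e.source :=
          Measure.restrict_mono le_rfl hle
      _ = chartArea F e := by
          rw [Measure.restrict_add, hself, Measure.restrict_restrict hes, Set.inter_compl_self]
          simp
  · rw [← hself]
    exact Measure.restrict_mono le_rfl (le_iSup₂ (f := fun e _ => chartArea F e) e he)

lemma areaMeasure_apply_of_subset (he : e ∈ atlas (EuclideanHalfSpace k) M)
    (hF : ContMDiff (𝓡∂ k) 𝓘(ℝ, Amb n) ∞ F) {S : Set M} (hS : MeasurableSet S)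
    (h : S ⊆ e.source) :
    areaMeasure k F S = ∫⁻ a in (e.extend (𝓡∂ k)).target ∩ (e.extend (𝓡∂ k)).symm ⁻¹' S,
      ENNReal.ofReal (areaDensity F e a) := by
  rw [← chartArea_apply he hF hS, ← areaMeasure_restrict_source he hF, Measure.restrict_apply hS,
    Set.inter_eq_left.mpr h]

/-- Integrals of functions supported in the domain of a chart. -/
lemma integral_areaMeasure_of_support (he : e ∈ atlas (EuclideanHalfSpace k) M)
    (hF : ContMDiff (𝓡∂ k) 𝓘(ℝ, Amb n) ∞ F) {f : M → ℝ} (hf : Measurable f)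
    (hs : ∀ x ∉ e.source, f x = 0) :
    ∫ x, f x ∂(areaMeasure k F) = ∫ a in (e.extend (𝓡∂ k)).target,
      areaDensity F e a * f ((e.extend (𝓡∂ k)).symm a) := by
  rw [← setIntegral_eq_integral_of_forall_compl_eq_zero (s := e.source) hs,
    areaMeasure_restrict_source he hF, chartArea,
    integral_map (aemeasurable_extend_symm.mono_ac (withDensity_absolutelyContinuous _ _))
      hf.aestronglyMeasurable,
    integral_withDensity_eq_integral_toReal_smul₀ (aemeasurable_areaDensity he hF).ennreal_ofReal
      (Filter.Eventually.of_forall fun _ => ENNReal.ofReal_lt_top)]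
  refine integral_congr_ae (Filter.Eventually.of_forall fun a => ?_)
  simp only [smul_eq_mul]
  rw [ENNReal.toReal_ofReal (by rw [areaDensity_eq]; exact Real.sqrt_nonneg _)]

lemma target_inter_preimage_mem_nhdsWithin {U : Set M} (hU : IsOpen U) {x : M}
    (hxe : x ∈ e.source) (hx : x ∈ U) :
    (e.extend (𝓡∂ k)).target ∩ (e.extend (𝓡∂ k)).symm ⁻¹' U ∈ 𝓝[halfSp k] (e.extend (𝓡∂ k) x) := by
  have hat : e.extend (𝓡∂ k) x ∈ (e.extend (𝓡∂ k)).target :=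
    (e.extend (𝓡∂ k)).map_source (by rwa [e.extend_source])
  refine Filter.inter_mem (extend_target_mem_nhdsWithin hat) ?_
  refine continuousWithinAt_extend_symm hat ?_
  rw [e.extend_left_inv hxe]
  exact hU.mem_nhds hx

/-- Each point has a neighborhood that a chart maps into a compact set on which the density is
bounded; compactness of `M` does the rest. -/
theorem isFiniteMeasure_areaMeasure [CompactSpace M] (hF : ContMDiff (𝓡∂ k) 𝓘(ℝ, Amb n) ∞ F) :
    IsFiniteMeasure (areaMeasure k F) := by
  refine ⟨isCompact_univ.measure_lt_top_of_nhdsWithin fun x _ => ?_⟩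
  rw [nhdsWithin_univ]
  set e := chartAt (EuclideanHalfSpace k) x
  have he : e ∈ atlas (EuclideanHalfSpace k) M := chart_mem_atlas _ x
  have hxe : x ∈ e.source := mem_chart_source _ x
  set a := e.extend (𝓡∂ k) x
  obtain ⟨r, hr, hrT⟩ := Metric.mem_nhdsWithin_iff.mp
    (target_inter_preimage_mem_nhdsWithin (k := k) (e := e) isOpen_univ hxe (Set.mem_univ x))
  have hrT' : Metric.ball a r ∩ halfSp k ⊆ (e.extend (𝓡∂ k)).target :=
    hrT.trans Set.inter_subset_left
  set K := Metric.closedBall a (r / 2) ∩ halfSp k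
  have hK : IsCompact K := (isCompact_closedBall a (r / 2)).inter_right isClosed_halfSp
  have hKT : K ⊆ (e.extend (𝓡∂ k)).target := fun z hz =>
    hrT' ⟨Metric.closedBall_subset_ball (by linarith) hz.1, hz.2⟩
  obtain ⟨C, hC⟩ := (hK.image_of_continuousOn
    ((continuousOn_areaDensity he hF).mono hKT)).isBounded.exists_norm_le
  set U := e.source ∩ e.extend (𝓡∂ k) ⁻¹' Metric.ball a (r / 2)
  have hUo : IsOpen U := e.isOpen_extend_preimage Metric.isOpen_ball
  refine ⟨U, hUo.mem_nhds ⟨hxe, Metric.mem_ball_self (by linarith)⟩, ?_⟩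
  rw [areaMeasure_apply_of_subset he hF hUo.measurableSet Set.inter_subset_left]
  have hsub : (e.extend (𝓡∂ k)).target ∩ (e.extend (𝓡∂ k)).symm ⁻¹' U ⊆ K := by
    rintro z ⟨hz, hzU⟩
    have := hzU.2
    rw [Set.mem_preimage, (e.extend (𝓡∂ k)).right_inv hz] at this
    exact ⟨Metric.ball_subset_closedBall this, extend_target_subset hz⟩
  calc _ ≤ ∫⁻ a in K, ENNReal.ofReal (areaDensity F e a) := lintegral_mono_set hsub
    _ ≤ ∫⁻ _ in K, ENNReal.ofReal C := by
        refine setLIntegral_mono' hK.measurableSet fun z hz => ENNReal.ofReal_le_ofReal ?_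
        exact (le_abs_self _).trans (hC _ ⟨z, hz, rfl⟩)
    _ < ⊤ := by
        rw [setLIntegral_const]
        exact ENNReal.mul_lt_top ENNReal.ofReal_lt_top hK.measure_lt_top

/-- The density of an immersion is positive, and a nonempty relatively open part of the half-space
meets its interior, hence has positive volume. -/
theorem areaMeasure_pos_of_isOpen (hF : ContMDiff (𝓡∂ k) 𝓘(ℝ, Amb n) ∞ F)
    (hi : ∀ x, Function.Injective (surfDer (k := k) F x)) {U : Set M} (hU : IsOpen U)
    (hne : U.Nonempty) : 0 < areaMeasure k F U := by
  obtain ⟨x, hx⟩ := hne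
  set e := chartAt (EuclideanHalfSpace k) x
  have he : e ∈ atlas (EuclideanHalfSpace k) M := chart_mem_atlas _ x
  have hxe : x ∈ e.source := mem_chart_source _ x
  set a := e.extend (𝓡∂ k) x
  refine lt_of_lt_of_le ?_ (measure_mono (Set.inter_subset_left : U ∩ e.source ⊆ U))
  have hUo : IsOpen (U ∩ e.source) := hU.inter e.open_source
  rw [areaMeasure_apply_of_subset he hF hUo.measurableSet Set.inter_subset_right]
  obtain ⟨r, hr, hrT⟩ := Metric.mem_nhdsWithin_iff.mp
    (target_inter_preimage_mem_nhdsWithin (k := k) (e := e) hUo hxe ⟨hx, hxe⟩)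
  set T := (e.extend (𝓡∂ k)).target ∩ (e.extend (𝓡∂ k)).symm ⁻¹' (U ∩ e.source)
  have hT : MeasurableSet T := measurableSet_target_inter_preimage hUo.measurableSet
  have hpos : ∀ z ∈ T, 0 < areaDensity F e z := by
    intro z hz
    have h := injective_locDer he hz.2.2
      (hF.contMDiffAt.of_le (by exact_mod_cast le_top)) (hi _)
    rw [(e.extend (𝓡∂ k)).right_inv hz.1] at h
    exact volDens_pos _ h
  have hTpos : 0 < volume T := by
    refine lt_of_lt_of_le ?_ (measure_mono (?_ : Metric.ball a r ∩ interior (halfSp k) ⊆ _))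
    · refine (Metric.isOpen_ball.inter isOpen_interior).measure_pos volume ?_
      have hcl : a ∈ closure (interior (halfSp k)) := by
        rw [convex_halfSp.closure_interior_eq_closure_of_nonempty_interior]
        · exact subset_closure ⟨e x, rfl⟩
        · exact (𝓡∂ k).nonempty_interior
      exact mem_closure_iff.mp hcl _ Metric.isOpen_ball (Metric.mem_ball_self hr)
    · rintro z ⟨hz1, hz2⟩
      exact hrT ⟨hz1, interior_subset hz2⟩
  by_contra hcon
  rw [not_lt, nonpos_iff_eq_zero, lintegral_eq_zero_iff'
    (((continuousOn_areaDensity he hF).mono Set.inter_subset_left).aemeasurable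
      hT).ennreal_ofReal] at hcon
  refine hTpos.ne' (measure_eq_zero_iff_ae_notMem.mpr ?_)
  filter_upwards [(ae_restrict_iff' hT).mp hcon] with z hz hzT
  have := hz hzT
  simp only [Pi.zero_apply, ENNReal.ofReal_eq_zero] at this
  exact absurd (hpos z hzT) (not_lt.mpr this)

end AreaMeasure

end SphereBall

end

noncomputable section

namespace SphereBall

/-! ### The divergence theorem on minimal surfaces -/

section GlobalDivergence

open MeasureTheory

variable {n k : ℕ} [NeZero k] {M : Type*} [TopologicalSpace M]
  [ChartedSpace (EuclideanHalfSpace k) M]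

variable (k) in
/-- A minimal immersion into the unit sphere that maps the boundary into a level set of `⟪p, ·⟫`
(with level `c`, `|c| < 1`) and is orthogonal to this level set there. -/
structure IsMinimalOrthogonal (p : Amb n) (c : ℝ) (F : M → Amb n) : Prop where
  smooth : ContMDiff (𝓡∂ k) 𝓘(ℝ, Amb n) ∞ F
  injective : ∀ x, Function.Injective (surfDer (k := k) F x)
  norm_eq : ∀ x, ‖F x‖ = 1
  minimal : ∀ x, meanCurvature (k := k) F x = 0
  boundary_inner : ∀ x ∈ (𝓡∂ k).boundary M, ⟪p, F x⟫ = c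
  boundary_mem : ∀ x ∈ (𝓡∂ k).boundary M, p - ⟪p, F x⟫ • F x ∈ tangentPlane (k := k) F x
  norm_p : ‖p‖ = 1
  sq_lt : c ^ 2 < 1

variable [IsManifold (𝓡∂ k) ∞ M]
  {e : OpenPartialHomeomorph M (EuclideanHalfSpace k)} {F X : M → Amb n} {p : Amb n} {c : ℝ}

lemma IsMinimalOrthogonal.smooth_one (hF : IsMinimalOrthogonal k p c F) :
    ContMDiff (𝓡∂ k) 𝓘(ℝ, Amb n) 1 F := hF.smooth.of_le (by exact_mod_cast le_top)

lemma hasFDerivWithinAt_locDer {G : Type*} [NormedAddCommGroup G] [NormedSpace ℝ G]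
    (he : e ∈ atlas (EuclideanHalfSpace k) M) {X : M → G}
    {a : Dom k} (ha : a ∈ (e.extend (𝓡∂ k)).target)
    (hX : ContMDiffAt (𝓡∂ k) 𝓘(ℝ, G) 1 X ((e.extend (𝓡∂ k)).symm a)) :
    HasFDerivWithinAt (X ∘ (e.extend (𝓡∂ k)).symm) (locDer e X a) (halfSp k) a :=
  ((contDiffWithinAt_comp_extend_symm (by norm_num) he ha hX).differentiableWithinAt
    (by simp)).hasFDerivWithinAt

lemma injective_locDer' (he : e ∈ atlas (EuclideanHalfSpace k) M)
    (hF : IsMinimalOrthogonal k p c F) {a : Dom k} (ha : a ∈ (e.extend (𝓡∂ k)).target) :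
    Function.Injective (locDer e F a) := by
  have h := injective_locDer he (extend_symm_mem_source ha) hF.smooth_one.contMDiffAt (hF.injective _)
  rwa [(e.extend (𝓡∂ k)).right_inv ha] at h

lemma inner_locDer_self (he : e ∈ atlas (EuclideanHalfSpace k) M)
    (hF : ContMDiff (𝓡∂ k) 𝓘(ℝ, Amb n) 1 F) (hn : ∀ x, ‖F x‖ = 1)
    {a : Dom k} (ha : a ∈ (e.extend (𝓡∂ k)).target) (v : Dom k) :
    ⟪F ((e.extend (𝓡∂ k)).symm a), locDer e F a v⟫ = 0 := by
  have h := hasFDerivWithinAt_locDer he ha hF.contMDiffAt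
  have h1 := h.inner ℝ h
  have h2 : (fun z => ⟪(F ∘ (e.extend (𝓡∂ k)).symm) z, (F ∘ (e.extend (𝓡∂ k)).symm) z⟫)
      = fun _ => (1 : ℝ) := by
    ext z
    rw [real_inner_self_eq_norm_sq, Function.comp_apply, hn]; norm_num
  rw [h2] at h1
  have h3 := (uniqueDiffOn_halfSp _ (extend_target_subset ha)).eq h1
    (hasFDerivWithinAt_const (1 : ℝ) a _)
  have h4 := congrArg (fun L : Dom k →L[ℝ] ℝ => L v) h3
  simp only [ContinuousLinearMap.comp_apply, ContinuousLinearMap.prod_apply,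
    fderivInnerCLM_apply, zero_apply, Function.comp_apply] at h4
  rw [real_inner_comm] at h4
  rw [real_inner_comm] at h4 ⊢
  linarith [real_inner_comm (F ((e.extend (𝓡∂ k)).symm a)) (locDer e F a v)]

lemma surfDer_eq_locDer {G : Type*} [NormedAddCommGroup G] [NormedSpace ℝ G] {X : M → G} {x : M}
    (hX : ContMDiffAt (𝓡∂ k) 𝓘(ℝ, G) 1 X x) :
    surfDer X x = locDer (chartAt (EuclideanHalfSpace k) x) X (extChartAt (𝓡∂ k) x x) :=
  surfDer_eq hX

lemma inner_surfDer_self (hF : ContMDiff (𝓡∂ k) 𝓘(ℝ, Amb n) 1 F) (hn : ∀ x, ‖F x‖ = 1)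
    (x : M) (v : Dom k) : ⟪F x, surfDer F x v⟫ = 0 := by
  rw [surfDer_eq_locDer hF.contMDiffAt]
  have := inner_locDer_self (chart_mem_atlas _ x) hF hn (mem_extChartAt_target (I := 𝓡∂ k) x) v
  rwa [show ((chartAt (EuclideanHalfSpace k) x).extend (𝓡∂ k)).symm (extChartAt (𝓡∂ k) x x) = x
    from extChartAt_to_inv x] at this

lemma continuousAt_surfDiv (hF : ContMDiff (𝓡∂ k) 𝓘(ℝ, Amb n) ∞ F) {x : M}
    (hi : Function.Injective (surfDer (k := k) F x))
    (hX : ∀ᶠ y in 𝓝 x, ContMDiffAt (𝓡∂ k) 𝓘(ℝ, Amb n) 1 X y) :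
    ContinuousAt (surfDiv (k := k) F X) x := by
  set e := chartAt (EuclideanHalfSpace k) x
  have he : e ∈ atlas (EuclideanHalfSpace k) M := chart_mem_atlas _ x
  have hxe : x ∈ e.source := mem_chart_source _ x
  have hF1 : ContMDiff (𝓡∂ k) 𝓘(ℝ, Amb n) 1 F := hF.of_le (by exact_mod_cast le_top)
  set a := e.extend (𝓡∂ k) x
  have ha : a ∈ (e.extend (𝓡∂ k)).target :=
    (e.extend (𝓡∂ k)).map_source (by rwa [e.extend_source])
  have hax : (e.extend (𝓡∂ k)).symm a = x := e.extend_left_inv hxe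
  have hAF : ContDiffWithinAt ℝ 0 (locDer e F) (halfSp k) a :=
    contDiffWithinAt_locDer le_rfl (by simp) he ha hF.contMDiffAt
  have hAX : ContDiffWithinAt ℝ 0 (locDer e X) (halfSp k) a :=
    contDiffWithinAt_locDer (m' := 1) (by norm_num) (by simp) he ha
      (by rw [hax]; exact hX.self_of_nhds)
  have hS : ContinuousWithinAt (fun z => gramTrace (locDer e F z)
      (fun i j => ⟪locDer e X z (bv i), locDer e F z (bv j)⟫)) (halfSp k) a :=
    (contDiffWithinAt_gramTrace hAF (injective_locDer he hxe hF1.contMDiffAt hi) fun i j =>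
      (hAX.clm_apply contDiffWithinAt_const).inner ℝ
        (hAF.clm_apply contDiffWithinAt_const)).continuousWithinAt
  have hcomp : ContinuousAt ((fun z => gramTrace (locDer e F z)
      (fun i j => ⟪locDer e X z (bv i), locDer e F z (bv j)⟫)) ∘ (e.extend (𝓡∂ k))) x := by
    rw [← continuousWithinAt_univ]
    refine ContinuousWithinAt.comp (t := halfSp k) hS
      (e.continuousAt_extend hxe).continuousWithinAt fun y _ => ⟨e y, rfl⟩
  refine hcomp.congr ?_
  filter_upwards [e.open_source.mem_nhds hxe, hX] with y hy hXy
  exact (surfDiv_eq_locDer he hy hF1.contMDiffAt hXy).symm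

lemma continuous_surfDiv (hF : IsMinimalOrthogonal k p c F)
    (hX : ContMDiff (𝓡∂ k) 𝓘(ℝ, Amb n) 1 X) : Continuous (surfDiv (k := k) F X) :=
  continuous_iff_continuousAt.mpr fun x => continuousAt_surfDiv hF.smooth (hF.injective x)
    (Filter.Eventually.of_forall fun _ => hX.contMDiffAt)

/-- Being a boundary point does not depend on the chart, so the vanishing of the `0`-th coordinate
in a single chart of the atlas suffices. -/
lemma boundary_of_mem_target (he : e ∈ atlas (EuclideanHalfSpace k) M) {a : Dom k}
    (ha : a ∈ (e.extend (𝓡∂ k)).target) (h0 : a 0 = 0) :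
    (e.extend (𝓡∂ k)).symm a ∈ (𝓡∂ k).boundary M := by
  change (𝓡∂ k).IsBoundaryPoint _
  rw [(𝓡∂ k).isBoundaryPoint_iff_of_mem_atlas (n := ∞) (by simp) he (extend_symm_mem_source ha),
    (e.extend (𝓡∂ k)).right_inv ha]
  refine ⟨subset_closure ha, fun hint => ?_⟩
  have := interior_mono extend_target_subset hint
  rw [interior_halfSp] at this
  exact (ne_of_gt this) h0

/-- Along the boundary, the conormal component of a field tangent to the level set vanishes. -/
lemma tanCoord_zero_of_boundary (he : e ∈ atlas (EuclideanHalfSpace k) M)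
    (hF : IsMinimalOrthogonal k p c F)
    (hXF : ∀ x, ⟪X x, F x⟫ = 0) (hXb : ∀ x ∈ (𝓡∂ k).boundary M, ⟪X x, p⟫ = 0)
    {a : Dom k} (ha : a ∈ (e.extend (𝓡∂ k)).target) (h0 : a 0 = 0) :
    tanCoord (locDer e F a) (X ((e.extend (𝓡∂ k)).symm a)) 0 = 0 := by
  set A := locDer e F a
  set x := (e.extend (𝓡∂ k)).symm a
  have hA : Function.Injective A := injective_locDer' he hF ha
  have hx : x ∈ (𝓡∂ k).boundary M := boundary_of_mem_target he ha h0
  have hxa : e.extend (𝓡∂ k) x = a := (e.extend (𝓡∂ k)).right_inv ha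
  have hFA : ∀ v, ⟪F x, A v⟫ = 0 := inner_locDer_self he hF.smooth_one hF.norm_eq ha
  obtain ⟨w, hw⟩ := (mem_tangentPlane_iff_locDer he (extend_symm_mem_source ha)
    hF.smooth_one.contMDiffAt _).mp (hF.boundary_mem x hx)
  rw [hxa] at hw
  -- For `j ≠ 0` the line in direction `j` stays in the boundary hyperplane, so `⟪p, F⟫` is constant
  -- along it.
  have hder : ∀ j : Fin k, j ≠ 0 → ⟪p, A (bv j)⟫ = 0 := by
    intro j hj
    have h1 := hasFDerivWithinAt_locDer he ha hF.smooth_one.contMDiffAt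
    have hline : HasDerivAt (fun t : ℝ => a + t • (bv j : Dom k)) (bv j) 0 := by
      simpa using ((hasDerivAt_id (0 : ℝ)).smul_const (bv j : Dom k)).const_add a
    have hz0 : ∀ t : ℝ, (a + t • (bv j : Dom k)) 0 = 0 := by
      intro t; simp [h0, Ne.symm hj]
    have hmaps : ∀ t : ℝ, a + t • (bv j : Dom k) ∈ halfSp k := fun t =>
      mem_halfSp.mpr (hz0 t).ge
    have h2 : HasDerivAt (fun t : ℝ => (F ∘ (e.extend (𝓡∂ k)).symm) (a + t • (bv j : Dom k)))
        (A (bv j)) 0 := by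
      have h1' : HasFDerivWithinAt (F ∘ (e.extend (𝓡∂ k)).symm) A (halfSp k)
          (a + (0 : ℝ) • (bv j : Dom k)) := by simpa using h1
      have := h1'.comp_hasDerivWithinAt (s := Set.univ) (0 : ℝ) hline.hasDerivWithinAt
        (fun t _ => hmaps t)
      exact hasDerivWithinAt_univ.mp this
    have h3 := (hasDerivAt_const (0 : ℝ) p).inner ℝ h2
    have h4 : (fun t : ℝ => ⟪p, (F ∘ (e.extend (𝓡∂ k)).symm) (a + t • (bv j : Dom k))⟫)
        =ᶠ[𝓝 0] fun _ => c := by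
      have ht : Filter.Tendsto (fun t : ℝ => a + t • (bv j : Dom k)) (𝓝 0) (𝓝[halfSp k] a) := by
        refine tendsto_nhdsWithin_iff.mpr ⟨?_, Filter.Eventually.of_forall hmaps⟩
        have := hline.continuousAt.tendsto
        simpa using this
      filter_upwards [ht (extend_target_mem_nhdsWithin ha)] with t htT
      exact hF.boundary_inner _ (boundary_of_mem_target he htT (hz0 t))
    have h5 := (h3.congr_of_eventuallyEq h4.symm).unique (hasDerivAt_const (0 : ℝ) c)
    simpa using h5
  -- Thus `A w`, the tangential part of `p` along the sphere, is a conormal: its product with `A v`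
  -- only sees `v 0`. It is not zero because `c² < 1`, and it is orthogonal to the field.
  have hwv : ∀ v, ⟪A w, A v⟫ = v 0 * ⟪p, A (bv 0)⟫ := by
    intro v
    rw [hw, inner_sub_left, real_inner_smul_left, hFA, mul_zero, sub_zero, inner_clm_eq_sum]
    rw [Finset.sum_eq_single 0]
    · intro j _ hj; rw [hder j hj, mul_zero]
    · simp
  have hnorm : ⟪A w, A w⟫ = 1 - c ^ 2 := by
    rw [hw]
    simp only [inner_sub_left, inner_sub_right, real_inner_smul_left, real_inner_smul_right,
      real_inner_self_eq_norm_sq, norm_smul, mul_pow, Real.norm_eq_abs, sq_abs, hF.norm_eq,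
      hF.norm_p, real_inner_comm p (F x), hF.boundary_inner x hx]
    ring
  have hα : ⟪p, A (bv 0)⟫ ≠ 0 := by
    intro h
    have := hwv w
    rw [hnorm, h, mul_zero] at this
    linarith [hF.sq_lt]
  have hX0 : ⟪A w, A (tanCoord A (X x))⟫ = 0 := by
    rw [real_inner_comm, inner_map_tanCoord A hA, hw, inner_sub_right, real_inner_smul_right,
      hXF, hXb x hx]; simp
  rw [hwv] at hX0
  exact (mul_eq_zero.mp hX0).resolve_right hα

/-- In the interior of a chart, the coordinate components of the density `√g X` have divergence
`√g div X`. -/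
lemma interior_chart_divergence (he : e ∈ atlas (EuclideanHalfSpace k) M)
    (hF : IsMinimalOrthogonal k p c F)
    (hX : ContMDiff (𝓡∂ k) 𝓘(ℝ, Amb n) 1 X) (hXF : ∀ x, ⟪X x, F x⟫ = 0)
    {a : Dom k} (ha : a ∈ (e.extend (𝓡∂ k)).target) (hai : a ∈ interior (halfSp k)) :
    ∃ V' : Fin k → Dom k →L[ℝ] ℝ,
      (∀ i, HasFDerivAt (fun z => volDens (locDer e F z) *
        tanCoord (locDer e F z) (X ((e.extend (𝓡∂ k)).symm z)) i) (V' i) a) ∧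
      ∑ i, V' i (bv i) = areaDensity F e a *
        surfDiv (k := k) F X ((e.extend (𝓡∂ k)).symm a) := by
  have hnh : ∀ z ∈ interior (halfSp k), 𝓝[halfSp k] z = 𝓝 z := fun z hz =>
    nhdsWithin_eq_nhds.mpr (mem_interior_iff_mem_nhds.mp hz)
  have hTn : ∀ᶠ z in 𝓝 a, z ∈ (e.extend (𝓡∂ k)).target := by
    have := extend_target_mem_nhdsWithin ha
    rwa [hnh a hai] at this
  have hIn : ∀ᶠ z in 𝓝 a, z ∈ interior (halfSp k) := isOpen_interior.mem_nhds hai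
  set x := (e.extend (𝓡∂ k)).symm a
  have hxa : e.extend (𝓡∂ k) x = a := (e.extend (𝓡∂ k)).right_inv ha
  have hxs : x ∈ e.source := extend_symm_mem_source ha
  have hmemn : halfSp k ∈ 𝓝 a := mem_interior_iff_mem_nhds.mp hai
  have hXd : fderiv ℝ (X ∘ (e.extend (𝓡∂ k)).symm) a = locDer e X a :=
    (fderivWithin_of_mem_nhds hmemn).symm
  have hA2 : fderiv ℝ (locDer e F) a = locDer₂ e F a := (fderivWithin_of_mem_nhds hmemn).symm
  obtain ⟨V', hV, hsum⟩ := divergence_in_coordinates (a := a)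
    (u := F ∘ (e.extend (𝓡∂ k)).symm) (X := X ∘ (e.extend (𝓡∂ k)).symm) (A := locDer e F)
    (by
      filter_upwards [hTn, hIn] with z hz hzi
      exact (hasFDerivWithinAt_locDer he hz hF.smooth_one.contMDiffAt).hasFDerivAt
        (mem_interior_iff_mem_nhds.mp hzi))
    ((contDiffWithinAt_locDer (m' := ∞) le_rfl two_le_infty he ha
      hF.smooth.contMDiffAt).contDiffAt hmemn)
    (by filter_upwards [hTn] with z hz using injective_locDer' he hF hz)
    ((contDiffWithinAt_comp_extend_symm (by norm_num) he ha hX.contMDiffAt).contDiffAt hmemn)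
    (Filter.Eventually.of_forall fun z => hF.norm_eq _) (hXF _)
    (by
      intro ξ hξ hξF
      rw [hA2]
      have := gramTrace_locDer₂_eq_zero he hxs hF.smooth.contMDiffAt (hF.minimal x) (ξ := ξ)
        (by rw [hxa]; exact hξ) hξF
      rwa [hxa] at this)
  refine ⟨V', hV, ?_⟩
  rw [hsum, surfDiv_eq_locDer he hxs hF.smooth_one.contMDiffAt hX.contMDiffAt, hxa, hXd]
  rfl

variable [T2Space M] [CompactSpace M] [MeasurableSpace M] [BorelSpace M]

/-- In the chart the integrand is the Euclidean divergence of the compactly supported field `√g Xⁱ`.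
Its `0`-th component vanishes on the boundary hyperplane, so the half-space theorem applies. -/
lemma integral_surfDiv_of_tsupport_subset (he : e ∈ atlas (EuclideanHalfSpace k) M)
    (hF : IsMinimalOrthogonal k p c F)
    (hX : ContMDiff (𝓡∂ k) 𝓘(ℝ, Amb n) 1 X) (hXF : ∀ x, ⟪X x, F x⟫ = 0)
    (hXb : ∀ x ∈ (𝓡∂ k).boundary M, ⟪X x, p⟫ = 0) (hs : tsupport X ⊆ e.source) :
    ∫ x, surfDiv (k := k) F X x ∂(areaMeasure k F) = 0 := by
  classical
  set T := (e.extend (𝓡∂ k)).target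
  set ψ := (e.extend (𝓡∂ k)).symm
  have hXz : ∀ x ∉ tsupport X, X x = 0 := fun x hx => image_eq_zero_of_notMem_tsupport hx
  have hdz : ∀ x ∉ tsupport X, surfDiv (k := k) F X x = 0 := by
    intro x hx
    have hev : X =ᶠ[𝓝 x] fun _ => 0 := by
      filter_upwards [(isClosed_tsupport X).isOpen_compl.mem_nhds hx] with y hy using hXz y hy
    have : surfDer (k := k) X x = 0 := by
      rw [surfDer, hev.mfderiv_eq, mfderiv_const]; rfl
    simp [surfDiv_def, this, gramTrace]
  have hcont := continuous_surfDiv hF hX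
  rw [integral_areaMeasure_of_support he hF.smooth hcont.measurable
    fun x hx => hdz x fun h => hx (hs h)]
  set K := e.extend (𝓡∂ k) '' tsupport X
  have hK : IsCompact K := (isClosed_tsupport X).isCompact.image_of_continuousOn
    (e.continuousOn_extend.mono (by rw [e.extend_source]; exact hs))
  have hKT : K ⊆ T := by
    rintro _ ⟨x, hx, rfl⟩
    exact (e.extend (𝓡∂ k)).map_source (by rw [e.extend_source]; exact hs hx)
  have hψK : ∀ z ∈ T, z ∉ K → ψ z ∉ tsupport X := fun z hz hzK h =>
    hzK ⟨ψ z, h, (e.extend (𝓡∂ k)).right_inv hz⟩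
  -- Extension by zero outside the chart target causes no loss of regularity, because the field
  -- vanishes off the compact set `K`, which lies in the target.
  set V : Fin k → Dom k → ℝ := fun i z =>
    if z ∈ T then volDens (locDer e F z) * tanCoord (locDer e F z) (X (ψ z)) i else 0
  have hVT : ∀ i, ∀ z ∈ T, V i z = volDens (locDer e F z) * tanCoord (locDer e F z) (X (ψ z)) i :=
    fun i z hz => if_pos hz
  have hVK : ∀ i, ∀ z, z ∉ K → V i z = 0 := by
    intro i z hzK
    by_cases hz : z ∈ T
    · rw [hVT i z hz, hXz _ (hψK z hz hzK)]
      simp [tanCoord_apply]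
    · exact if_neg hz
  have hTn : ∀ z ∈ T, T ∈ 𝓝[halfSp k] z := fun z hz => extend_target_mem_nhdsWithin hz
  have hmain : ∀ z ∈ interior (halfSp k), ∃ V' : Fin k → Dom k →L[ℝ] ℝ,
      (∀ i, HasFDerivAt (V i) (V' i) z) ∧ ∑ i, V' i (bv i) =
        T.indicator (fun a => areaDensity F e a * surfDiv (k := k) F X (ψ a)) z := by
    intro z hz
    by_cases hzT : z ∈ T
    · obtain ⟨V', h1, h2⟩ := interior_chart_divergence he hF hX hXF hzT hz
      refine ⟨V', fun i => (h1 i).congr_of_eventuallyEq ?_, ?_⟩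
      · have := hTn z hzT
        rw [nhdsWithin_eq_nhds.mpr (mem_interior_iff_mem_nhds.mp hz)] at this
        filter_upwards [this] with w hw using hVT i w hw
      · rw [h2, Set.indicator_of_mem hzT]
    · refine ⟨fun _ => 0, fun i => ?_, by rw [Set.indicator_of_notMem hzT]; simp⟩
      refine (hasFDerivAt_const (0 : ℝ) z).congr_of_eventuallyEq ?_
      filter_upwards [hK.isClosed.isOpen_compl.mem_nhds fun h => hzT (hKT h)] with w hw
        using hVK i w hw
  choose! V' hV'1 hV'2 using hmain
  have hae : (fun z => ∑ i, V' z i (bv i)) =ᵐ[volume.restrict (halfSp k)]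
      T.indicator (fun a => areaDensity F e a * surfDiv (k := k) F X (ψ a)) := by
    filter_upwards [ae_interior_halfSp] with z hz using hV'2 z hz
  have hTH : T ⊆ halfSp k := extend_target_subset
  have hint : IntegrableOn (T.indicator fun a => areaDensity F e a *
      surfDiv (k := k) F X (ψ a)) (halfSp k) := by
    have h1 : IntegrableOn (T.indicator fun a => areaDensity F e a *
      surfDiv (k := k) F X (ψ a)) K := by
      refine ContinuousOn.integrableOn_compact hK ?_
      refine ContinuousOn.congr (f := fun a => areaDensity F e a * surfDiv (k := k) F X (ψ a)) ?_
        fun z hz => Set.indicator_of_mem (hKT hz) _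
      exact ((continuousOn_areaDensity he hF.smooth).mono hKT).mul
        (hcont.comp_continuousOn (e.continuousOn_extend_symm.mono hKT))
    refine (h1.of_forall_sdiff_eq_zero isClosed_halfSp.measurableSet fun z hz => ?_)
    by_cases hzT : z ∈ T
    · rw [Set.indicator_of_mem hzT, hdz _ (hψK z hzT hz.2), mul_zero]
    · exact Set.indicator_of_notMem hzT _
  have h0 := integral_divergence_halfSp V (fun i z => V' z i) hK (fun i z _ h => hVK i z h)
    (by
      intro i z hz
      by_cases hzT : z ∈ T
      · have hA : ContDiffWithinAt ℝ 0 (locDer e F) (halfSp k) z :=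
          contDiffWithinAt_locDer le_rfl (by simp) he hzT hF.smooth.contMDiffAt
        have hinj := injective_locDer' he hF hzT
        have hXc : ContDiffWithinAt ℝ 0 (X ∘ ψ) (halfSp k) z :=
          (contDiffWithinAt_comp_extend_symm (by norm_num) he hzT hX.contMDiffAt).of_le (by simp)
        have h1 : ContinuousWithinAt (fun w => volDens (locDer e F w) *
            tanCoord (locDer e F w) (X (ψ w)) i) (halfSp k) z :=
          ((contDiffWithinAt_volDens hA hinj).mul
            (contDiffWithinAt_tanCoord hA hXc hinj i)).continuousWithinAt
        refine h1.congr_of_eventuallyEq ?_ (hVT i z hzT)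
        filter_upwards [hTn z hzT] with w hw using hVT i w hw
      · refine (continuousWithinAt_const (b := (0 : ℝ))).congr_of_eventuallyEq ?_ (if_neg hzT)
        filter_upwards [mem_nhdsWithin_of_mem_nhds
          (hK.isClosed.isOpen_compl.mem_nhds fun h => hzT (hKT h))] with w hw using hVK i w hw)
    (fun i z hz => hV'1 z hz i)
    (by
      intro z hz
      by_cases hzT : z ∈ T
      · rw [hVT 0 z hzT, tanCoord_zero_of_boundary he hF hXF hXb hzT hz, mul_zero]
      · exact if_neg hzT)
    (hint.congr_fun_ae hae.symm)
  rw [integral_congr_ae hae, setIntegral_indicator measurableSet_extend_target,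
    Set.inter_eq_right.mpr hTH] at h0
  exact h0

lemma surfDiv_sum {ι : Type*} (s : Finset ι) {Y : ι → M → Amb n} {x : M}
    (hY : ∀ i ∈ s, ContMDiffAt (𝓡∂ k) 𝓘(ℝ, Amb n) 1 (Y i) x)
    (hs : ContMDiffAt (𝓡∂ k) 𝓘(ℝ, Amb n) 1 (fun y => ∑ i ∈ s, Y i y) x) :
    surfDiv (k := k) F (fun y => ∑ i ∈ s, Y i y) x = ∑ i ∈ s, surfDiv (k := k) F (Y i) x := by
  have h : surfDer (k := k) (fun y => ∑ i ∈ s, Y i y) x = ∑ i ∈ s, surfDer (Y i) x := by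
    rw [surfDer_eq hs, Finset.sum_congr rfl fun i hi => surfDer_eq (hY i hi)]
    have := fderivWithin_fun_sum (𝕜 := ℝ) (u := s)
      (A := fun i => (Y i) ∘ (extChartAt (𝓡∂ k) x).symm) (s := halfSp k)
      (x := extChartAt (𝓡∂ k) x x) (uniqueDiffOn_halfSp _ ⟨_, rfl⟩)
      (fun i hi => (contDiffWithinAt_comp_extChartAt_symm (by norm_num)
        (hY i hi)).differentiableWithinAt (by simp))
    exact this
  simp only [surfDiv_def, h, sum_apply, sum_inner]
  rw [gramTrace_sum]

/-- **Divergence theorem** on a minimal surface in the unit sphere. -/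
theorem integral_surfDiv_eq_zero (hF : IsMinimalOrthogonal k p c F)
    (hX : ContMDiff (𝓡∂ k) 𝓘(ℝ, Amb n) 1 X) (hXF : ∀ x, ⟪X x, F x⟫ = 0)
    (hXb : ∀ x ∈ (𝓡∂ k).boundary M, ⟪X x, p⟫ = 0) :
    ∫ x, surfDiv (k := k) F X x ∂(areaMeasure k F) = 0 := by
  obtain ⟨ρ, hρ⟩ := SmoothPartitionOfUnity.exists_isSubordinate_chartAt_source (𝓡∂ k) M
  have hfin := ρ.locallyFinite.finite_nonempty_of_compact
  set t := hfin.toFinset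
  have hsum1 : ∀ x, ∑ i ∈ t, ρ i x = 1 := by
    intro x
    rw [← ρ.sum_eq_one (Set.mem_univ x), finsum_eq_sum_of_support_subset]
    intro i hi
    simp only [t, Set.Finite.coe_toFinset, Set.mem_ofPred_eq]
    exact ⟨x, hi⟩
  have hY : ∀ i, ContMDiff (𝓡∂ k) 𝓘(ℝ, Amb n) 1 (fun x => ρ i x • X x) := fun i =>
    ((ρ i).contMDiff.of_le (by exact_mod_cast le_top)).smul hX
  have hXeq : X = fun x => ∑ i ∈ t, ρ i x • X x := by
    ext1 x
    rw [← Finset.sum_smul, hsum1, one_smul]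
  have hdiv : ∀ x, surfDiv (k := k) F X x =
      ∑ i ∈ t, surfDiv (k := k) F (fun x => ρ i x • X x) x := by
    intro x
    conv_lhs => rw [hXeq]
    exact surfDiv_sum t (fun i _ => (hY i).contMDiffAt) (by rw [← hXeq]; exact hX.contMDiffAt)
  simp only [hdiv]
  have := isFiniteMeasure_areaMeasure hF.smooth
  rw [integral_finsetSum]
  · refine Finset.sum_eq_zero fun i _ => ?_
    refine integral_surfDiv_of_tsupport_subset (chart_mem_atlas _ i) hF (hY i) ?_ ?_ ?_
    · intro x; rw [real_inner_smul_left, hXF, mul_zero]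
    · intro x hx; rw [real_inner_smul_left, hXb x hx, mul_zero]
    · exact (tsupport_smul_subset_left _ _).trans (hρ i)
  · intro i _
    exact (continuous_surfDiv hF (hY i)).integrable_of_hasCompactSupport
      (HasCompactSupport.of_compactSpace _)

end GlobalDivergence

end SphereBall

end

noncomputable section

namespace SphereBall

/-! ### The cutoff profile and integrals of radial functions -/

section RadialIntegrals

open MeasureTheory

variable {k : ℕ} {G : Type*} [NormedAddCommGroup G] [InnerProductSpace ℝ G]

/-- A smooth cutoff function, equal to `0` on `(-∞, 1/2]` and to `1` on `[1, ∞)`. -/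
def cutoff (t : ℝ) : ℝ := Real.smoothTransition (2 * t - 1)

lemma contDiff_cutoff : ContDiff ℝ ∞ cutoff :=
  Real.smoothTransition.contDiff.comp (by fun_prop)

lemma cutoff_of_le {t : ℝ} (ht : t ≤ 1 / 2) : cutoff t = 0 :=
  Real.smoothTransition.zero_of_nonpos (by linarith)

lemma cutoff_of_ge {t : ℝ} (ht : 1 ≤ t) : cutoff t = 1 :=
  Real.smoothTransition.one_of_one_le (by linarith)

lemma cutoff_nonneg (t : ℝ) : 0 ≤ cutoff t := Real.smoothTransition.nonneg _

lemma cutoff_le_one (t : ℝ) : cutoff t ≤ 1 := Real.smoothTransition.le_one _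

lemma hasDerivAt_cutoff (t : ℝ) : HasDerivAt cutoff (deriv cutoff t) t :=
  (contDiff_cutoff.differentiable (by simp) t).hasDerivAt

lemma continuous_deriv_cutoff : Continuous (deriv cutoff) :=
  contDiff_cutoff.continuous_deriv (by simp)

lemma deriv_cutoff_of_lt {t : ℝ} (ht : t < 1 / 2) : deriv cutoff t = 0 := by
  have : cutoff =ᶠ[𝓝 t] fun _ => 0 := by
    filter_upwards [Iio_mem_nhds ht] with s hs using cutoff_of_le (le_of_lt hs)
  rw [this.deriv_eq, deriv_const]

lemma deriv_cutoff_of_gt {t : ℝ} (ht : 1 < t) : deriv cutoff t = 0 := by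
  have : cutoff =ᶠ[𝓝 t] fun _ => 1 := by
    filter_upwards [Ioi_mem_nhds ht] with s hs using cutoff_of_ge (le_of_lt hs)
  rw [this.deriv_eq, deriv_const]

lemma exists_deriv_cutoff_bound : ∃ C : ℝ, 0 ≤ C ∧ ∀ t, |deriv cutoff t| ≤ C := by
  obtain ⟨C, hC⟩ := (isCompact_Icc (a := (0 : ℝ)) (b := 2)).exists_bound_of_continuousOn
    continuous_deriv_cutoff.continuousOn
  have hC0 : 0 ≤ C := (norm_nonneg _).trans (hC 0 ⟨le_rfl, by norm_num⟩)
  refine ⟨C, hC0, fun t => ?_⟩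
  by_cases h : t ∈ Set.Icc (0 : ℝ) 2
  · exact hC t h
  · rw [Set.mem_Icc, not_and_or, not_le, not_le] at h
    rcases h with h | h
    · rw [deriv_cutoff_of_lt (by linarith)]; simpa
    · rw [deriv_cutoff_of_gt (by linarith)]; simpa

/-- The area of the unit sphere in `ℝᵏ`. -/
def sphereArea (k : ℕ) : ℝ := k * (volume : Measure (Dom k)).real (Metric.ball 0 1)

lemma sphereArea_pos [NeZero k] : 0 < sphereArea k := by
  have h1 : 0 < (k : ℝ) := Nat.cast_pos.mpr (Nat.pos_of_ne_zero (NeZero.ne k))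
  have h2 : 0 < (volume : Measure (Dom k)).real (Metric.ball 0 1) :=
    ENNReal.toReal_pos (Metric.measure_ball_pos _ _ one_pos).ne' measure_ball_lt_top.ne
  exact mul_pos h1 h2

/-- The range of `A` is identified with `ℝᵏ` by an orthonormal basis. The Gram matrices coincide,
and that of an endomorphism of `ℝᵏ` has determinant `det²`. -/
lemma exists_isometric_model (A : Dom k →L[ℝ] G) (hA : Function.Injective A) :
    ∃ T : Dom k →L[ℝ] Dom k, (∀ w, ‖T w‖ = ‖A w‖) ∧ |T.det| = volDens A := by
  let S := LinearMap.range A.toLinearMap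
  have hfr : Module.finrank ℝ S = k := by
    rw [LinearMap.finrank_range_of_inj hA]; simp
  let b := (stdOrthonormalBasis ℝ S).reindex (finCongr hfr)
  let T0 : Dom k →ₗ[ℝ] Dom k := b.repr.toLinearEquiv.toLinearMap ∘ₗ A.toLinearMap.rangeRestrict
  let T : Dom k →L[ℝ] Dom k := T0.toContinuousLinearMap
  have hTi : ∀ v w, ⟪T v, T w⟫ = ⟪A v, A w⟫ := fun v w => by
    change ⟪b.repr (A.toLinearMap.rangeRestrict v), b.repr (A.toLinearMap.rangeRestrict w)⟫ = _
    rw [LinearIsometryEquiv.inner_map_map]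
    rfl
  refine ⟨T, fun w => ?_, ?_⟩
  · rw [← sq_eq_sq₀ (norm_nonneg _) (norm_nonneg _), ← real_inner_self_eq_norm_sq,
      ← real_inner_self_eq_norm_sq, hTi]
  · have h1 : gramMat A = gramMat T := by
      ext i j; exact (hTi _ _).symm
    have h2 : gramMat (ContinuousLinearMap.id ℝ (Dom k)) = 1 := by
      ext i j
      simp [gramMat, Matrix.one_apply, PiLp.inner_apply, eq_comm]
    have h3 := det_gramMat_comp (ContinuousLinearMap.id ℝ (Dom k)) T
    rw [ContinuousLinearMap.id_comp, h2, Matrix.det_one, one_mul] at h3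
    rw [volDens, h1, h3, Real.sqrt_sq_eq_abs]

/-- A linear substitution: `volDens A` cancels the Jacobian of the isometric model of `A`. No
integrability of `f` is needed, since the substitution rule holds for all functions. -/
lemma integral_volDens_mul_norm (A : Dom k →L[ℝ] G) (hA : Function.Injective A) (f : ℝ → ℝ) :
    ∫ w, volDens A * f ‖A w‖ = ∫ z : Dom k, f ‖z‖ := by
  obtain ⟨T, hT, hdet⟩ := exists_isometric_model A hA
  have hv := volDens_pos A hA
  have hd : LinearMap.det T.toLinearMap ≠ 0 := by
    intro h
    have : T.det = 0 := h
    rw [this, abs_zero] at hdet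
    exact hv.ne hdet
  have hmap := Measure.map_linearMap_addHaar_eq_smul_addHaar volume hd
  have hTe : MeasurableEmbedding T :=
    ((ContinuousLinearEquiv.ofBijective T
      (LinearMap.ker_eq_bot.mpr (by
        intro v w hvw
        apply hA
        rw [← sub_eq_zero, ← map_sub, ← norm_eq_zero, ← hT, map_sub]
        simpa [sub_eq_zero] using hvw))
      (LinearMap.range_eq_top.mpr (LinearMap.surjective_of_injective (f := T.toLinearMap) (by
        intro v w hvw
        apply hA
        rw [← sub_eq_zero, ← map_sub, ← norm_eq_zero, ← hT, map_sub]
        simpa [sub_eq_zero] using hvw)))).toHomeomorph.measurableEmbedding)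
  have h1 : ∫ w, f ‖T w‖ = ∫ z, f ‖z‖ ∂(Measure.map T volume) :=
    (hTe.integral_map (μ := volume) fun z => f ‖z‖).symm
  have h2 : Measure.map T volume = ENNReal.ofReal |(LinearMap.det T.toLinearMap)⁻¹| •
      (volume : Measure (Dom k)) := hmap
  simp only [← hT]
  rw [integral_const_mul, h1, h2, integral_smul_measure, ← hdet, smul_eq_mul,
    ENNReal.toReal_ofReal (abs_nonneg _), abs_inv, ← mul_assoc]
  have h3 : |T.det| * |LinearMap.det T.toLinearMap|⁻¹ = 1 :=
    mul_inv_cancel₀ (abs_ne_zero.mpr hd)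
  rw [h3, one_mul]

/-- In polar coordinates `r^(k-1)` cancels the singular power and leaves `2 r cutoff'(r²)`, the
derivative of `cutoff (r²)`, which rises from `0` to `1`. The limit of the flux therefore does not
depend on the shape of the cutoff. -/
lemma integral_cutoff_radial [NeZero k] :
    ∫ z : Dom k, 2 * deriv cutoff (‖z‖ ^ 2) * (‖z‖ ^ (-(k : ℤ)) * ‖z‖ ^ 2) = sphereArea k := by
  rw [integral_fun_norm_addHaar volume
    (fun r => 2 * deriv cutoff (r ^ 2) * (r ^ (-(k : ℤ)) * r ^ 2))]
  have h1 : ∫ y in Set.Ioi (0 : ℝ), y ^ (Module.finrank ℝ (Dom k) - 1) •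
      (2 * deriv cutoff (y ^ 2) * (y ^ (-(k : ℤ)) * y ^ 2)) = 1 := by
    have h2 : ∀ y ∈ Set.Ioi (0 : ℝ), y ^ (Module.finrank ℝ (Dom k) - 1) •
        (2 * deriv cutoff (y ^ 2) * (y ^ (-(k : ℤ)) * y ^ 2)) =
        (Set.Ioc (0 : ℝ) 2).indicator (fun y => deriv cutoff (y ^ 2) * (2 * y)) y := by
      intro y hy
      have hy0 : (0 : ℝ) < y := hy
      have hk : 1 ≤ k := Nat.pos_of_ne_zero (NeZero.ne k)
      have hpow : y ^ (k - 1) * (y ^ (-(k : ℤ)) * y ^ 2) = y := by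
        have h3 : y ^ k = y ^ (k - 1) * y := by rw [← pow_succ, Nat.sub_add_cancel hk]
        rw [zpow_neg, zpow_natCast, h3]
        field_simp
      have hmain : y ^ (Module.finrank ℝ (Dom k) - 1) •
        (2 * deriv cutoff (y ^ 2) * (y ^ (-(k : ℤ)) * y ^ 2)) = deriv cutoff (y ^ 2) * (2 * y) := by
        rw [finrank_euclideanSpace_fin, smul_eq_mul]
        linear_combination (2 * deriv cutoff (y ^ 2)) * hpow
      rw [hmain]
      by_cases h : y ≤ 2
      · rw [Set.indicator_of_mem (Set.mem_Ioc.mpr ⟨hy0, h⟩)]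
      · rw [Set.indicator_of_notMem fun h' => h h'.2, deriv_cutoff_of_gt (by nlinarith), zero_mul]
    rw [setIntegral_congr_fun measurableSet_Ioi h2, setIntegral_indicator measurableSet_Ioc,
      Set.inter_eq_right.mpr fun y hy => hy.1, ← intervalIntegral.integral_of_le (by norm_num)]
    rw [intervalIntegral.integral_eq_sub_of_hasDerivAt (f := fun y => cutoff (y ^ 2))]
    · rw [cutoff_of_ge (by norm_num), cutoff_of_le (by norm_num)]; norm_num
    · intro y _
      have := (hasDerivAt_cutoff (y ^ 2)).comp y (hasDerivAt_pow 2 y)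
      simp only [Nat.cast_ofNat, Nat.add_one_sub_one, pow_one] at this
      exact this
    · exact ((continuous_deriv_cutoff.comp (by fun_prop)).mul (by fun_prop)).intervalIntegrable _ _
  rw [h1]
  simp [sphereArea]

lemma integral_half_of_even [NeZero k] {f : Dom k → ℝ} (hf : Integrable f)
    (hev : ∀ w, f (-w) = f w) : ∫ w in {w : Dom k | 0 < w 0}, f w = (1 / 2) * ∫ w, f w := by
  have hm1 : MeasurableSet {w : Dom k | 0 < w 0} := by
    rw [← interior_halfSp]; exact isOpen_interior.measurableSet
  have h1 : ∫ w in {w : Dom k | 0 < w 0}ᶜ, f w = ∫ w in {w : Dom k | w 0 < 0}, f w := by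
    refine setIntegral_congr_set ?_
    have hfr : ∀ᵐ z : Dom k, z ∉ frontier (halfSp k) :=
      measure_eq_zero_iff_ae_notMem.mp volume_frontier_halfSp
    filter_upwards [hfr] with z hz
    have hz0 : ¬ (0 = z 0) := by
      intro h
      apply hz
      rw [frontier_range_modelWithCornersEuclideanHalfSpace]
      exact h
    apply propext
    change ¬ (0 < z 0) ↔ z 0 < 0
    constructor
    · intro h; exact lt_of_le_of_ne (not_lt.mp h) (Ne.symm hz0)
    · intro h; exact not_lt.mpr h.le
  have h2 : ∫ w in {w : Dom k | w 0 < 0}, f w = ∫ w in {w : Dom k | 0 < w 0}, f w := by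
    have hneg := (Measure.measurePreserving_neg (volume : Measure (Dom k))).setIntegral_preimage_emb
      (MeasurableEquiv.neg (Dom k)).measurableEmbedding f {w : Dom k | 0 < w 0}
    rw [← hneg]
    simp only [hev]
    congr 2
    ext w
    simp
  have h3 := integral_add_compl hm1 hf
  rw [h1, h2] at h3
  linarith

end RadialIntegrals

end SphereBall

end

noncomputable section

namespace SphereBall

/-! ### The flux at a singular point, in a chart -/

section LocalFlux

open MeasureTheory Filter Asymptotics

variable {k : ℕ} {G : Type*} [NormedAddCommGroup G] [InnerProductSpace ℝ G]

/-- The trace is the product of `b` with the tangential projection of `x`, which is no longer than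
`x`. -/
lemma abs_gramTrace_inner_mul_inner_le (A : Dom k →L[ℝ] G) (hA : Function.Injective A) (b x : G) :
    |gramTrace A (fun i j => ⟪b, A (bv i)⟫ * ⟪x, A (bv j)⟫)| ≤ ‖b‖ * ‖x‖ := by
  have h1 : gramTrace A (fun i j => ⟪b, A (bv i)⟫ * ⟪x, A (bv j)⟫) = ⟪b, A (tanCoord A x)⟫ := by
    rw [gramTrace_mul_inner, inner_clm_eq_sum]
    exact Finset.sum_congr rfl fun i _ => mul_comm _ _
  have h2 : ‖A (tanCoord A x)‖ ≤ ‖x‖ := by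
    have h3 : ‖A (tanCoord A x)‖ * ‖A (tanCoord A x)‖ ≤ ‖x‖ * ‖A (tanCoord A x)‖ := by
      rw [← real_inner_self_eq_norm_mul_norm, inner_map_tanCoord A hA]
      exact real_inner_le_norm _ _
    by_contra hcon
    push Not at hcon
    have : 0 < ‖A (tanCoord A x)‖ := (norm_nonneg x).trans_lt hcon
    exact absurd (le_of_mul_le_mul_right h3 this) (not_le.mpr hcon)
  rw [h1]
  exact (abs_real_inner_le_norm _ _).trans (by gcongr)

/-- The function whose integral is the flux of `x` through the transition region of the cutoff
function `z ↦ cutoff (‖u z - q‖² / ε²)`, where `b = u z - q`. -/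
def fluxDens (A : Dom k →L[ℝ] G) (b x : G) (ε : ℝ) : ℝ :=
  2 * deriv cutoff (‖b‖ ^ 2 / ε ^ 2) / ε ^ 2 *
    gramTrace A (fun i j => ⟪b, A (bv i)⟫ * ⟪x, A (bv j)⟫)

lemma gramTrace_smul_left (A : Dom k →L[ℝ] G) (s t : ℝ) (b x : G) :
    gramTrace A (fun i j => ⟪s • b, A (bv i)⟫ * ⟪t • x, A (bv j)⟫) =
      s * t * gramTrace A (fun i j => ⟪b, A (bv i)⟫ * ⟪x, A (bv j)⟫) := by
  rw [← gramTrace_smul]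
  congr 1
  ext i j
  rw [real_inner_smul_left, real_inner_smul_left]; ring

lemma tendsto_gramTrace_inner {ι : Type*} {l : Filter ι} {A : ι → Dom k →L[ℝ] G}
    {b x : ι → G} {A₀ : Dom k →L[ℝ] G} {b₀ x₀ : G} (hA : Tendsto A l (𝓝 A₀))
    (hb : Tendsto b l (𝓝 b₀)) (hx : Tendsto x l (𝓝 x₀)) (hi : Function.Injective A₀) :
    Tendsto (fun t => gramTrace (A t) (fun i j => ⟪b t, A t (bv i)⟫ * ⟪x t, A t (bv j)⟫)) l
      (𝓝 (gramTrace A₀ (fun i j => ⟪b₀, A₀ (bv i)⟫ * ⟪x₀, A₀ (bv j)⟫))) := by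
  have happ : ∀ v, Tendsto (fun t => A t v) l (𝓝 (A₀ v)) := fun v =>
    ((ContinuousLinearMap.apply ℝ G v).continuous.tendsto A₀).comp hA
  refine tendsto_finsetSum _ fun i _ => tendsto_finsetSum _ fun j _ => Tendsto.mul ?_
    ((hb.inner (happ _)).mul (hx.inner (happ _)))
  have h : ContDiffWithinAt ℝ 0 (fun P : Dom k →L[ℝ] G => (gramMat P)⁻¹ i j) Set.univ A₀ :=
    contDiffWithinAt_gramMat_inv contDiffWithinAt_id hi i j
  have hc : ContinuousAt _ _ := continuousWithinAt_univ _ _ |>.mp h.continuousWithinAt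
  exact hc.tendsto.comp hA

lemma tendsto_volDens {ι : Type*} {l : Filter ι} {A : ι → Dom k →L[ℝ] G}
    {A₀ : Dom k →L[ℝ] G} (hA : Tendsto A l (𝓝 A₀)) (hi : Function.Injective A₀) :
    Tendsto (fun t => volDens (A t)) l (𝓝 (volDens A₀)) := by
  have h : ContDiffWithinAt ℝ 0 (fun P : Dom k →L[ℝ] G => volDens P) Set.univ A₀ :=
    contDiffWithinAt_volDens contDiffWithinAt_id hi
  have hc : ContinuousAt _ _ := continuousWithinAt_univ _ _ |>.mp h.continuousWithinAt
  exact hc.tendsto.comp hA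

lemma exists_lower_bound (A : Dom k →L[ℝ] G) (hA : Function.Injective A) :
    ∃ m : ℝ, 0 < m ∧ ∀ w, m * ‖w‖ ≤ ‖A w‖ := by
  obtain ⟨K, hK, h⟩ := A.toLinearMap.exists_antilipschitzWith (LinearMap.ker_eq_bot.mpr hA)
  refine ⟨(K : ℝ)⁻¹, inv_pos.mpr (by exact_mod_cast hK), fun w => ?_⟩
  have := h.le_mul_dist w 0
  simp only [dist_zero_right, map_zero] at this
  rw [inv_mul_le_iff₀ (by exact_mod_cast hK)]
  exact this

/-- The differential expands lengths by at least `m`, and the remainder consumes at most half of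
this. Distances in the chart are thus controlled by distances in the image. -/
lemma eventually_lower_bound [NeZero k] {u : Dom k → G} {A : Dom k →L[ℝ] G} {z₀ : Dom k}
    {s : Set (Dom k)} (hu : HasFDerivWithinAt u A s z₀) (hi : Function.Injective A) :
    ∃ m : ℝ, 0 < m ∧ ∀ᶠ a in 𝓝[s] z₀, m * ‖a - z₀‖ ≤ ‖u a - u z₀‖ := by
  obtain ⟨m, hm, hmA⟩ := exists_lower_bound A hi
  refine ⟨m / 2, by positivity, ?_⟩
  filter_upwards [hu.isLittleO.def (half_pos hm)] with a ha
  have h1 := hmA (a - z₀)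
  have h2 : ‖A (a - z₀)‖ ≤ ‖u a - u z₀‖ + ‖u a - u z₀ - A (a - z₀)‖ := by
    have := norm_sub_le (u a - u z₀) (u a - u z₀ - A (a - z₀))
    simpa using this
  linarith

variable [NeZero k]

/-- Convergence of the rescaled flux density. -/
lemma tendsto_rescaled_fluxDens {u X : Dom k → G} {A : Dom k → Dom k →L[ℝ] G} {q : G}
    {z₀ : Dom k} {β : ℝ} (hu : HasFDerivWithinAt u (A z₀) (halfSp k) z₀) (hq : u z₀ = q)
    (hA : ContinuousWithinAt A (halfSp k) z₀) (hi : Function.Injective (A z₀))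
    (hX : (fun a => X a + (β * ‖u a - q‖ ^ (-(k : ℤ))) • (u a - q))
      =o[𝓝[halfSp k \ {z₀}] z₀] fun a => ‖u a - q‖ ^ (1 - (k : ℤ)))
    {w : Dom k} (hw : w ≠ 0) (hmem : ∀ᶠ ε : ℝ in 𝓝[>] 0, z₀ + ε • w ∈ halfSp k) :
    Tendsto (fun ε : ℝ => ε ^ k * (volDens (A (z₀ + ε • w)) *
      fluxDens (A (z₀ + ε • w)) (u (z₀ + ε • w) - q) (X (z₀ + ε • w)) ε)) (𝓝[>] 0)
      (𝓝 (-β * (volDens (A z₀) * (2 * deriv cutoff (‖A z₀ w‖ ^ 2) *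
        (‖A z₀ w‖ ^ (-(k : ℤ)) * ‖A z₀ w‖ ^ 2))))) := by
  have hpos : ∀ᶠ ε : ℝ in 𝓝[>] 0, 0 < ε := eventually_mem_nhdsWithin
  have hb0 : A z₀ w ≠ 0 := fun h => hw (hi (h.trans (map_zero _).symm))
  -- The displacement from `q` at scale `ε`; it converges to `A z₀ w`.
  set b : ℝ → G := fun ε => ε⁻¹ • (u (z₀ + ε • w) - q)
  have hb : Tendsto b (𝓝[>] 0) (𝓝 (A z₀ w)) := by
    have h0 : Tendsto (fun ε : ℝ => ε • w) (𝓝[>] 0) (𝓝 0) := by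
      have : Tendsto (fun ε : ℝ => ε • w) (𝓝 0) (𝓝 ((0 : ℝ) • w)) :=
        Continuous.tendsto (by fun_prop) 0
      rw [zero_smul] at this
      exact this.mono_left nhdsWithin_le_nhds
    have h1 : Tendsto (fun ε : ℝ => ε⁻¹ • ε • w) (𝓝[>] 0) (𝓝 w) := by
      refine tendsto_const_nhds.congr' ?_
      filter_upwards [hpos] with ε hε
      rw [smul_smul, inv_mul_cancel₀ hε.ne', one_smul]
    have := hu.lim h0 hmem h1
    rwa [hq] at this
  have ha : Tendsto (fun ε : ℝ => z₀ + ε • w) (𝓝[>] 0) (𝓝[halfSp k \ {z₀}] z₀) := by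
    refine tendsto_nhdsWithin_iff.mpr ⟨?_, ?_⟩
    · have : Tendsto (fun ε : ℝ => z₀ + ε • w) (𝓝 0) (𝓝 (z₀ + (0 : ℝ) • w)) :=
        (Continuous.tendsto (by fun_prop) 0)
      rw [zero_smul, add_zero] at this
      exact this.mono_left nhdsWithin_le_nhds
    · filter_upwards [hmem, hpos] with ε h1 h2
      refine ⟨h1, fun h3 => hw ?_⟩
      have h4 : ε • w = 0 := by simpa using h3
      exact (smul_eq_zero.mp h4).resolve_left h2.ne'
  have haH : Tendsto (fun ε : ℝ => z₀ + ε • w) (𝓝[>] 0) (𝓝[halfSp k] z₀) :=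
    ha.mono_right (nhdsWithin_mono _ Set.sdiff_subset)
  have hAt : Tendsto (fun ε : ℝ => A (z₀ + ε • w)) (𝓝[>] 0) (𝓝 (A z₀)) := hA.tendsto.comp haH
  have hub : ∀ ε : ℝ, 0 < ε → u (z₀ + ε • w) - q = ε • b ε := fun ε hε => by
    simp only [b]; rw [smul_smul, mul_inv_cancel₀ hε.ne', one_smul]
  have hnb : ∀ ε : ℝ, 0 < ε → ‖u (z₀ + ε • w) - q‖ = ε * ‖b ε‖ := fun ε hε => by
    rw [hub ε hε, norm_smul, Real.norm_of_nonneg hε.le]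
  have hb0n : ‖A z₀ w‖ ≠ 0 := norm_ne_zero_iff.mpr hb0
  -- The field blows up like the power `1 - k` of the distance, so the factor `ε^(k-1)` gives it a
  -- finite limit. Of the `ε^k` in the statement one power remains; with the power of `ε` in `u - q`
  -- it cancels the `ε²` in the denominator of the flux density.
  have hx : Tendsto (fun ε : ℝ => ε ^ ((k : ℤ) - 1) • X (z₀ + ε • w)) (𝓝[>] 0)
      (𝓝 (-(β * ‖A z₀ w‖ ^ (-(k : ℤ))) • A z₀ w)) := by
    have h1 : Tendsto (fun ε : ℝ => ε ^ ((k : ℤ) - 1) • (X (z₀ + ε • w) +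
        (β * ‖u (z₀ + ε • w) - q‖ ^ (-(k : ℤ))) • (u (z₀ + ε • w) - q))) (𝓝[>] 0) (𝓝 0) := by
      have h2 := hX.comp_tendsto ha
      have h3 : (fun ε : ℝ => ε ^ ((k : ℤ) - 1) • (X (z₀ + ε • w) +
        (β * ‖u (z₀ + ε • w) - q‖ ^ (-(k : ℤ))) • (u (z₀ + ε • w) - q))) =o[𝓝[>] 0]
          fun ε => ε ^ ((k : ℤ) - 1) • ‖u (z₀ + ε • w) - q‖ ^ (1 - (k : ℤ)) :=
        (isBigO_refl _ _).smul_isLittleO h2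
      rw [← isLittleO_one_iff ℝ]
      refine h3.trans_isBigO ?_
      have h4 : Tendsto (fun ε => ‖b ε‖ ^ (1 - (k : ℤ))) (𝓝[>] 0)
          (𝓝 (‖A z₀ w‖ ^ (1 - (k : ℤ)))) := hb.norm.zpow₀ _ (Or.inl hb0n)
      refine (h4.isBigO_one ℝ).congr' ?_ EventuallyEq.rfl
      filter_upwards [hpos] with ε hε
      rw [hnb ε hε, mul_zpow, smul_eq_mul, ← mul_assoc, ← zpow_add₀ hε.ne']
      simp
    have h5 : Tendsto (fun ε => (β * ‖b ε‖ ^ (-(k : ℤ))) • b ε) (𝓝[>] 0)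
        (𝓝 ((β * ‖A z₀ w‖ ^ (-(k : ℤ))) • A z₀ w)) :=
      ((hb.norm.zpow₀ _ (Or.inl hb0n)).const_mul β).smul hb
    have h6 := h1.sub h5
    rw [zero_sub, ← neg_smul] at h6
    refine h6.congr' ?_
    filter_upwards [hpos] with ε hε
    rw [smul_add, hnb ε hε, hub ε hε, smul_smul, smul_smul, mul_zpow]
    have h7 : ε ^ ((k : ℤ) - 1) * (β * (ε ^ (-(k : ℤ)) * ‖b ε‖ ^ (-(k : ℤ)))) * ε
        = β * ‖b ε‖ ^ (-(k : ℤ)) := by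
      have h8 : ε ^ ((k : ℤ) - 1) * ε ^ (-(k : ℤ)) * ε = 1 := by
        rw [← zpow_add₀ hε.ne', ← zpow_add_one₀ hε.ne',
          show (k : ℤ) - 1 + -k + 1 = 0 by ring, zpow_zero]
      linear_combination (β * ‖b ε‖ ^ (-(k : ℤ))) * h8
    rw [h7, add_sub_cancel_right]
  have hcut : Tendsto (fun ε => deriv cutoff (‖b ε‖ ^ 2)) (𝓝[>] 0)
      (𝓝 (deriv cutoff (‖A z₀ w‖ ^ 2))) :=
    (continuous_deriv_cutoff.tendsto _).comp (hb.norm.pow 2)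
  have hmain := (tendsto_volDens hAt hi).mul ((hcut.const_mul 2).mul
    (tendsto_gramTrace_inner hAt hb hx hi))
  have hlim : gramTrace (A z₀) (fun i j => ⟪A z₀ w, A z₀ (bv i)⟫ *
      ⟪-(β * ‖A z₀ w‖ ^ (-(k : ℤ))) • A z₀ w, A z₀ (bv j)⟫) =
      -(β * ‖A z₀ w‖ ^ (-(k : ℤ))) * ‖A z₀ w‖ ^ 2 := by
    have := gramTrace_smul_left (A z₀) 1 (-(β * ‖A z₀ w‖ ^ (-(k : ℤ)))) (A z₀ w) (A z₀ w)
    rw [one_smul, one_mul, gramTrace_inner_mul_inner_self _ hi, real_inner_self_eq_norm_sq] at this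
    exact this
  rw [hlim] at hmain
  have heq : -β * (volDens (A z₀) * (2 * deriv cutoff (‖A z₀ w‖ ^ 2) *
        (‖A z₀ w‖ ^ (-(k : ℤ)) * ‖A z₀ w‖ ^ 2))) =
      volDens (A z₀) * (2 * deriv cutoff (‖A z₀ w‖ ^ 2) *
        (-(β * ‖A z₀ w‖ ^ (-(k : ℤ))) * ‖A z₀ w‖ ^ 2)) := by ring
  rw [heq]
  refine hmain.congr' ?_
  filter_upwards [hpos] with ε hε
  have h1 : ‖u (z₀ + ε • w) - q‖ ^ 2 / ε ^ 2 = ‖b ε‖ ^ 2 := by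
    rw [hnb ε hε, mul_pow, mul_div_cancel_left₀ _ (pow_ne_zero 2 hε.ne')]
  rw [fluxDens, h1, hub ε hε]
  have h2 := gramTrace_smul_left (A (z₀ + ε • w)) ε 1 (b ε) (X (z₀ + ε • w))
  have h3 := gramTrace_smul_left (A (z₀ + ε • w)) 1 (ε ^ ((k : ℤ) - 1)) (b ε) (X (z₀ + ε • w))
  rw [one_smul] at h2 h3
  rw [h2, h3, zpow_sub₀ hε.ne', zpow_natCast, zpow_one]
  field_simp

/-- Substituting `a = z₀ + ε w` makes the integrand converge pointwise to a radial function of `A z₀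
w`, over the whole space at an interior point and over a half-space at a boundary point. The
neighborhood `D` is arbitrary inside `D₀`, so that it can later be shrunk to separate the points of
a fiber. -/
theorem tendsto_local_flux {u X : Dom k → G} {A : Dom k → Dom k →L[ℝ] G} {q : G}
    {z₀ : Dom k} {β : ℝ} (hz₀ : z₀ ∈ halfSp k)
    (hu : HasFDerivWithinAt u (A z₀) (halfSp k) z₀) (hq : u z₀ = q)
    (hA : ContinuousWithinAt A (halfSp k) z₀) (hi : Function.Injective (A z₀))
    (hX : (fun a => X a + (β * ‖u a - q‖ ^ (-(k : ℤ))) • (u a - q))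
      =o[𝓝[halfSp k \ {z₀}] z₀] fun a => ‖u a - q‖ ^ (1 - (k : ℤ))) :
    ∃ D₀ ∈ 𝓝[halfSp k] z₀, ∀ D ⊆ D₀, D ⊆ halfSp k → D ∈ 𝓝[halfSp k] z₀ → MeasurableSet D →
      (∀ a ∈ D, Function.Injective (A a)) →
      (∀ ε : ℝ, 0 < ε → Measurable
        (D.indicator fun a => volDens (A a) * fluxDens (A a) (u a - q) (X a) ε)) →
      Tendsto (fun ε : ℝ => ∫ a in D, volDens (A a) * fluxDens (A a) (u a - q) (X a) ε)
        (𝓝[>] 0) (𝓝 (-β * sphereArea k * (if z₀ 0 = 0 then 1 / 2 else 1))) := by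
  obtain ⟨m, hm, hlow⟩ := eventually_lower_bound hu hi
  obtain ⟨C, hC0, hC⟩ := exists_deriv_cutoff_bound
  have hvol : ∀ᶠ a in 𝓝[halfSp k] z₀, volDens (A a) ≤ volDens (A z₀) + 1 :=
    (tendsto_volDens hA.tendsto hi).eventually_le_const (by linarith)
  have hXb : ∀ᶠ a in 𝓝[halfSp k] z₀, a ≠ z₀ → ‖X a‖ ≤ (|β| + 1) * ‖u a - q‖ ^ (1 - (k : ℤ)) := by
    have h1 := hX.def one_pos
    have hdiff : halfSp k \ {z₀} = halfSp k ∩ {z₀}ᶜ := rfl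
    have h2 : 𝓝[halfSp k \ {z₀}] z₀ = 𝓝[halfSp k] z₀ ⊓ 𝓟 {z₀}ᶜ := by
      rw [hdiff, nhdsWithin_inter']
    rw [h2, eventually_inf_principal] at h1
    filter_upwards [h1, hlow] with a ha hla hne
    have h3 := ha hne
    have hapos : 0 < ‖u a - q‖ := by
      rw [← hq]
      exact lt_of_lt_of_le (mul_pos hm (norm_pos_iff.mpr (sub_ne_zero.mpr hne))) hla
    have h4 : ‖(β * ‖u a - q‖ ^ (-(k : ℤ))) • (u a - q)‖ = |β| * ‖u a - q‖ ^ (1 - (k : ℤ)) := by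
      rw [norm_smul, norm_mul, Real.norm_eq_abs, Real.norm_of_nonneg (zpow_nonneg (norm_nonneg _) _),
        mul_assoc, ← zpow_add_one₀ hapos.ne', neg_add_eq_sub]
    have h5 := norm_sub_le (X a + (β * ‖u a - q‖ ^ (-(k : ℤ))) • (u a - q))
      ((β * ‖u a - q‖ ^ (-(k : ℤ))) • (u a - q))
    rw [add_sub_cancel_right, h4] at h5
    rw [Real.norm_of_nonneg (zpow_nonneg (norm_nonneg _) _)] at h3
    linarith
  refine ⟨_, hlow.and (hvol.and hXb), fun D hD hDH hDn hDm hDi hmeas => ?_⟩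
  set g : ℝ → Dom k → ℝ := fun ε =>
    D.indicator fun a => volDens (A a) * fluxDens (A a) (u a - q) (X a) ε
  -- The factor `ε ^ k` is the Jacobian of the dilation.
  set h : ℝ → Dom k → ℝ := fun ε w => ε ^ k * g ε (z₀ + ε • w)
  have hscale : ∀ ε : ℝ, 0 < ε →
      ∫ a in D, volDens (A a) * fluxDens (A a) (u a - q) (X a) ε = ∫ w, h ε w := by
    intro ε hε
    rw [← integral_indicator hDm]
    change ∫ a, g ε a = _
    rw [integral_const_mul, Measure.integral_comp_smul volume (fun v => g ε (z₀ + v)) ε,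
      integral_add_left_eq_self (g ε) z₀, finrank_euclideanSpace_fin, smul_eq_mul, abs_inv,
      abs_of_pos (pow_pos hε k), mul_inv_cancel_left₀ (pow_pos hε k).ne']
  set ℓ : Dom k → ℝ := fun w => volDens (A z₀) * (2 * deriv cutoff (‖A z₀ w‖ ^ 2) *
        (‖A z₀ w‖ ^ (-(k : ℤ)) * ‖A z₀ w‖ ^ 2))
  have hℓint : ∫ w, ℓ w = sphereArea k := by
    rw [← integral_cutoff_radial]
    exact integral_volDens_mul_norm (A z₀) hi
      (fun r => 2 * deriv cutoff (r ^ 2) * (r ^ (-(k : ℤ)) * r ^ 2))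
  -- The integral of a function that is not integrable is `0` by convention, while this one is
  -- positive.
  have hℓi : Integrable ℓ := by
    by_contra hcon
    rw [integral_undef hcon] at hℓint
    exact sphereArea_pos.ne hℓint
  -- The limit of the rescaled domains, up to a null set.
  set Θ : Set (Dom k) := if z₀ 0 = 0 then {w | 0 < w 0} else Set.univ
  have hΘint : ∫ w, Θ.indicator (fun w => -β * ℓ w) w =
      -β * sphereArea k * (if z₀ 0 = 0 then 1 / 2 else 1) := by
    simp only [Θ]
    split_ifs with h0
    · have hm1 : MeasurableSet {w : Dom k | 0 < w 0} := by
        rw [← interior_halfSp]; exact isOpen_interior.measurableSet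
      rw [integral_indicator hm1, integral_const_mul, integral_half_of_even hℓi, hℓint]
      · ring
      · intro w; simp only [ℓ, map_neg, norm_neg]
    · simp only [Set.indicator_univ]
      rw [integral_const_mul, hℓint, mul_one]
  have hconv : Tendsto (fun ε => ∫ w, h ε w) (𝓝[>] 0)
      (𝓝 (∫ w, Θ.indicator (fun w => -β * ℓ w) w)) := by
    -- The dominating constant: bounds for the density, for the derivative of the cutoff and for the
    -- field, and `2 ^ k` from `ε / 2 ≤ s` on the transition region.
    set B : ℝ := (volDens (A z₀) + 1) * (2 * C * ((|β| + 1) * 2 ^ k))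
    have hv0 : 0 < volDens (A z₀) := volDens_pos _ hi
    have hB0 : 0 ≤ B := by positivity
    refine tendsto_integral_filter_of_dominated_convergence
      ((Metric.closedBall (0 : Dom k) (1 / m)).indicator fun _ => B) ?_ ?_ ?_ ?_
    · filter_upwards [self_mem_nhdsWithin] with ε hε
      exact (((hmeas ε hε).comp (by fun_prop : Measurable fun w : Dom k => z₀ + ε • w)).const_mul
        _).aestronglyMeasurable
    · filter_upwards [self_mem_nhdsWithin] with ε hε
      have hε : 0 < ε := hε
      refine Eventually.of_forall fun w => ?_
      by_cases hwD : z₀ + ε • w ∈ D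
      swap
      · have : h ε w = 0 := by simp only [h, g]; rw [Set.indicator_of_notMem hwD, mul_zero]
        rw [this, norm_zero]
        exact Set.indicator_nonneg (fun _ _ => hB0) _
      have hval : h ε w = ε ^ k * (volDens (A (z₀ + ε • w)) *
          fluxDens (A (z₀ + ε • w)) (u (z₀ + ε • w) - q) (X (z₀ + ε • w)) ε) := by
        simp only [h, g]; rw [Set.indicator_of_mem hwD]
      set a := z₀ + ε • w
      obtain ⟨hl, hv, hxb⟩ := hD hwD
      set s := ‖u a - q‖
      have hs0 : 0 ≤ s := norm_nonneg _
      -- Only points with `1/2 ≤ s² / ε² ≤ 1` matter. There `s` is comparable to `ε`, which bounds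
      -- the negative power of `s`, and `m ‖a - z₀‖ ≤ s ≤ ε` confines `w` to the ball of radius `1 /
      -- m`.
      by_cases hzero : deriv cutoff (s ^ 2 / ε ^ 2) = 0
      · have : h ε w = 0 := by rw [hval, fluxDens]; simp only [s] at hzero; rw [hzero]; simp
        rw [this, norm_zero]
        exact Set.indicator_nonneg (fun _ _ => hB0) _
      have hs1 : s ≤ ε := by
        by_contra hcon
        push Not at hcon
        refine hzero (deriv_cutoff_of_gt ?_)
        rw [lt_div_iff₀ (by positivity)]
        nlinarith
      have hs2 : ε / 2 ≤ s := by
        by_contra hcon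
        push Not at hcon
        refine hzero (deriv_cutoff_of_lt ?_)
        rw [div_lt_iff₀ (by positivity)]
        nlinarith
      have hspos : 0 < s := lt_of_lt_of_le (by positivity) hs2
      have hane : a ≠ z₀ := by
        intro h
        have : s = 0 := by simp only [s]; rw [h, hq, sub_self, norm_zero]
        exact hspos.ne' this
      have hwb : w ∈ Metric.closedBall (0 : Dom k) (1 / m) := by
        rw [mem_closedBall_zero_iff, le_div_iff₀ hm]
        have h1 : ‖a - z₀‖ = ε * ‖w‖ := by
          simp only [a]; rw [add_sub_cancel_left, norm_smul, Real.norm_of_nonneg hε.le]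
        rw [h1, hq] at hl
        have h2 : ε * (‖w‖ * m) ≤ ε * 1 := by linarith
        exact le_of_mul_le_mul_left h2 hε
      rw [Set.indicator_of_mem hwb, hval]
      have hv1 : 0 ≤ volDens (A a) := Real.sqrt_nonneg _
      have hflux : |fluxDens (A a) (u a - q) (X a) ε| ≤
          2 * C / ε ^ 2 * (s * ((|β| + 1) * s ^ (1 - (k : ℤ)))) := by
        rw [fluxDens, abs_mul, abs_div, abs_mul, abs_two, abs_of_pos (by positivity : 0 < ε ^ 2)]
        have h1 := (abs_gramTrace_inner_mul_inner_le (A a) (hDi a hwD) (u a - q) (X a)).trans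
          (mul_le_mul_of_nonneg_left (hxb hane) hs0)
        gcongr
        exact hC _
      have hzs : s * s ^ (1 - (k : ℤ)) ≤ ε ^ 2 * (2 ^ k / ε ^ k) := by
        have h1 : s * s ^ (1 - (k : ℤ)) = s ^ 2 * (s ^ k)⁻¹ := by
          rw [zpow_sub₀ hspos.ne', zpow_one, zpow_natCast]; field_simp
        rw [h1]
        have h2 : (s ^ k)⁻¹ ≤ 2 ^ k / ε ^ k := by
          rw [← div_pow, ← inv_pow]
          refine pow_le_pow_left₀ (by positivity) ?_ k
          rw [inv_le_comm₀ hspos (by positivity), inv_div]; exact hs2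
        gcongr
      rw [Real.norm_eq_abs, abs_mul, abs_mul, abs_of_pos (pow_pos hε k), abs_of_nonneg hv1]
      calc ε ^ k * (volDens (A a) * |fluxDens (A a) (u a - q) (X a) ε|)
          ≤ ε ^ k * ((volDens (A z₀) + 1) *
            (2 * C / ε ^ 2 * ((|β| + 1) * (ε ^ 2 * (2 ^ k / ε ^ k))))) := by
            have h3 : s * ((|β| + 1) * s ^ (1 - (k : ℤ))) ≤
                (|β| + 1) * (ε ^ 2 * (2 ^ k / ε ^ k)) := by
              calc s * ((|β| + 1) * s ^ (1 - (k : ℤ))) = (|β| + 1) * (s * s ^ (1 - (k : ℤ))) := by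
                    ring
                _ ≤ _ := by gcongr
            have h4 := hflux.trans (mul_le_mul_of_nonneg_left h3 (by positivity))
            gcongr
        _ = B := by simp only [B]; field_simp
    · exact (integrable_indicator_iff Metric.isClosed_closedBall.measurableSet).mpr
        (integrableOn_const (isCompact_closedBall _ _).measure_lt_top.ne)
    · have hfr : ∀ᵐ z : Dom k, z ∉ frontier (halfSp k) :=
        measure_eq_zero_iff_ae_notMem.mp volume_frontier_halfSp
      filter_upwards [hfr] with w hwf
      have hw0 : w 0 ≠ 0 := by
        intro h0
        apply hwf
        rw [frontier_range_modelWithCornersEuclideanHalfSpace]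
        exact h0.symm
      have hw : w ≠ 0 := fun h0 => hw0 (by rw [h0]; rfl)
      by_cases hcase : w ∈ Θ
      · rw [Set.indicator_of_mem hcase]
        have hmem : ∀ᶠ ε : ℝ in 𝓝[>] 0, z₀ + ε • w ∈ halfSp k := by
          have hz := mem_halfSp.mp hz₀
          simp only [mem_halfSp, PiLp.add_apply, PiLp.smul_apply, smul_eq_mul]
          by_cases h0 : z₀ 0 = 0
          · have hwp : 0 < w 0 := by simpa [Θ, h0] using hcase
            filter_upwards [self_mem_nhdsWithin] with ε hε
            have : 0 < ε := hε
            rw [h0]; positivity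
          · have hzp : 0 < z₀ 0 := lt_of_le_of_ne hz (Ne.symm h0)
            have ht : Tendsto (fun ε : ℝ => z₀ 0 + ε * w 0) (𝓝 0) (𝓝 (z₀ 0 + 0 * w 0)) :=
              Continuous.tendsto (by fun_prop) 0
            rw [zero_mul, add_zero] at ht
            exact ((ht.eventually_const_lt hzp).filter_mono nhdsWithin_le_nhds).mono
              fun _ h => h.le
        refine (tendsto_rescaled_fluxDens hu hq hA hi hX hw hmem).congr' ?_
        have ht : Tendsto (fun ε : ℝ => z₀ + ε • w) (𝓝[>] 0) (𝓝[halfSp k] z₀) := by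
          refine tendsto_nhdsWithin_iff.mpr ⟨?_, hmem⟩
          have : Tendsto (fun ε : ℝ => z₀ + ε • w) (𝓝 0) (𝓝 (z₀ + (0 : ℝ) • w)) :=
            (Continuous.tendsto (by fun_prop) 0)
          rw [zero_smul, add_zero] at this
          exact this.mono_left nhdsWithin_le_nhds
        filter_upwards [ht hDn] with ε hε
        simp only [h, g]
        rw [Set.indicator_of_mem (show z₀ + ε • w ∈ D from hε)]
      -- Here `z₀` is on the boundary and `w` points out of the half-space, so the rescaled
      -- integrand is zero.
      · rw [Set.indicator_of_notMem hcase]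
        refine tendsto_const_nhds.congr' ?_
        filter_upwards [self_mem_nhdsWithin] with ε hε
        have hε : 0 < ε := hε
        have h0 : z₀ 0 = 0 := by
          by_contra h0; exact hcase (by simp [Θ, h0])
        have hwn : w 0 < 0 := by
          have : ¬ 0 < w 0 := by simpa [Θ, h0] using hcase
          exact lt_of_le_of_ne (not_lt.mp this) hw0
        have hnot : z₀ + ε • w ∉ D := by
          intro hmem
          have := mem_halfSp.mp (hDH hmem)
          simp only [PiLp.add_apply, PiLp.smul_apply, smul_eq_mul, h0, zero_add] at this
          nlinarith
        simp only [h, g]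
        rw [Set.indicator_of_notMem hnot, mul_zero]
  rw [← hΘint]
  refine hconv.congr' ?_
  filter_upwards [self_mem_nhdsWithin] with ε hε
  exact (hscale ε hε).symm

end LocalFlux

end SphereBall

end

noncomputable section

namespace SphereBall

/-! ### The flux into the fiber over a singular point -/

section GlobalFlux

open MeasureTheory Filter Asymptotics

variable {n k : ℕ} [NeZero k] {M : Type*} [TopologicalSpace M]
  [ChartedSpace (EuclideanHalfSpace k) M] [IsManifold (𝓡∂ k) ∞ M]
  {F X : M → Amb n} {p q : Amb n} {c β ε : ℝ}

/-- A cutoff function that vanishes near `q` and is `1` at distance at least `ε` from `q`. -/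
def radialCutoff (q : Amb n) (ε : ℝ) (z : Amb n) : ℝ := cutoff (‖z - q‖ ^ 2 / ε ^ 2)

lemma contDiff_radialCutoff : ContDiff ℝ ∞ (radialCutoff q ε) :=
  contDiff_cutoff.comp (((contDiff_id.sub contDiff_const).norm_sq ℝ).div_const _)

lemma radialCutoff_eventually_zero : ∀ᶠ z in 𝓝 q, radialCutoff q ε z = 0 := by
  have h : Tendsto (fun z : Amb n => ‖z - q‖ ^ 2 / ε ^ 2) (𝓝 q) (𝓝 (‖q - q‖ ^ 2 / ε ^ 2)) :=
    Continuous.tendsto (by fun_prop) q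
  have h0 : ‖q - q‖ ^ 2 / ε ^ 2 = 0 := by simp
  rw [h0] at h
  exact (h.eventually_le_const (by norm_num : (0 : ℝ) < 1 / 2)).mono fun z hz => cutoff_of_le hz

lemma hasFDerivAt_radialCutoff (z : Amb n) :
    HasFDerivAt (radialCutoff q ε)
      ((2 * deriv cutoff (‖z - q‖ ^ 2 / ε ^ 2) / ε ^ 2) • innerSL ℝ (z - q)) z := by
  have h1 : HasFDerivAt (fun z : Amb n => ‖z - q‖ ^ 2) (2 • innerSL ℝ (z - q)) z := by
    have := ((hasFDerivAt_id z).sub_const q).norm_sq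
    simpa using this
  have h2 := (hasDerivAt_cutoff (‖z - q‖ ^ 2 / ε ^ 2)).comp_hasFDerivAt z
    (h1.mul_const (ε ^ 2)⁻¹)
  refine h2.congr_fderiv ?_
  ext v
  simp
  ring

lemma surfDiv_eq_zero_of_eventuallyEq {x : M} (h : X =ᶠ[𝓝 x] fun _ => 0) :
    surfDiv (k := k) F X x = 0 := by
  have h1 : (surfDer X x : Dom k →L[ℝ] Amb n) = 0 := by
    have h2 := h.mfderiv_eq (I := 𝓡∂ k) (I' := 𝓘(ℝ, Amb n))
    rw [surfDer, h2, mfderiv_const]; rfl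
  rw [surfDiv_def, h1]
  simp [gramTrace]

/-- An immersion moves nearby points by at least a multiple of their distance in the chart. -/
lemma eventually_ne_of_injective (hF : ContMDiff (𝓡∂ k) 𝓘(ℝ, Amb n) 1 F) {x₀ : M}
    (hi : Function.Injective (surfDer (k := k) F x₀)) : ∀ᶠ x in 𝓝[≠] x₀, F x ≠ F x₀ := by
  have h1 := hasFDerivWithinAt_locDer (chart_mem_atlas (EuclideanHalfSpace k) x₀)
    (mem_extChartAt_target (I := 𝓡∂ k) x₀) (X := F) (hF _)
  have h2 : Function.Injective (locDer (chartAt (EuclideanHalfSpace k) x₀) F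
      (extChartAt (𝓡∂ k) x₀ x₀)) := by rwa [← surfDer_eq_locDer (hF x₀)]
  obtain ⟨m, hm, h3⟩ := eventually_lower_bound h1 h2
  have h4 : Tendsto (extChartAt (𝓡∂ k) x₀) (𝓝 x₀) (𝓝[halfSp k] (extChartAt (𝓡∂ k) x₀ x₀)) :=
    tendsto_nhdsWithin_iff.mpr ⟨continuousAt_extChartAt x₀, Eventually.of_forall fun x => ⟨_, rfl⟩⟩
  rw [eventually_nhdsWithin_iff]
  filter_upwards [h4 h3, extChartAt_source_mem_nhds (I := 𝓡∂ k) x₀] with x hx hxs hne heq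
  have h5 : m * ‖extChartAt (𝓡∂ k) x₀ x - extChartAt (𝓡∂ k) x₀ x₀‖ ≤
    ‖F ((extChartAt (𝓡∂ k) x₀).symm (extChartAt (𝓡∂ k) x₀ x)) -
      F ((extChartAt (𝓡∂ k) x₀).symm (extChartAt (𝓡∂ k) x₀ x₀))‖ := hx
  rw [(extChartAt (𝓡∂ k) x₀).left_inv hxs, extChartAt_to_inv, heq, sub_self, norm_zero] at h5
  have h6 : ‖extChartAt (𝓡∂ k) x₀ x - extChartAt (𝓡∂ k) x₀ x₀‖ ≤ 0 := by
    by_contra hcon; push Not at hcon; nlinarith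
  rw [norm_le_zero_iff, sub_eq_zero] at h6
  exact hne ((extChartAt (𝓡∂ k) x₀).injOn hxs (mem_extChartAt_source x₀) h6)

/-- An infinite fiber would accumulate at one of its own points, where the immersion separates it
from all nearby points. -/
lemma finite_fiber [CompactSpace M] (hF : ContMDiff (𝓡∂ k) 𝓘(ℝ, Amb n) 1 F)
    (hi : ∀ x, Function.Injective (surfDer (k := k) F x)) (q : Amb n) : (F ⁻¹' {q}).Finite := by
  by_contra hinf
  have hcl : IsClosed (F ⁻¹' {q}) := isClosed_singleton.preimage hF.continuous
  obtain ⟨x, hx, hacc⟩ := Set.Infinite.exists_accPt_of_subset_isCompact hinf hcl.isCompact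
    subset_rfl
  have hx : F x = q := hx
  rw [accPt_iff_frequently_nhdsNE] at hacc
  refine hacc ((eventually_ne_of_injective hF (hi x)).mono fun y hy h => hy ?_)
  rw [hx]; exact h

/-- The chart-independent version of `fluxDens`. -/
def surfFlux (F X : M → Amb n) (q : Amb n) (ε : ℝ) (x : M) : ℝ :=
  fluxDens (surfDer (k := k) F x) (F x - q) (X x) ε

lemma surfFlux_eq_locDer {e : OpenPartialHomeomorph M (EuclideanHalfSpace k)}
    (he : e ∈ atlas (EuclideanHalfSpace k) M) (hF : ContMDiff (𝓡∂ k) 𝓘(ℝ, Amb n) 1 F)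
    {x : M} (hx : x ∈ e.source) :
    surfFlux (k := k) F X q ε x =
      fluxDens (locDer e F (e.extend (𝓡∂ k) x)) (F x - q) (X x) ε := by
  rw [surfFlux, fluxDens, fluxDens, locDer_eq_comp he hx (hF x)]
  congr 1
  refine (gramTrace_comp (surfDer F x) _ (fderivWithin_toChart_det_ne_zero he hx)
    (((innerSL ℝ (F x - q)).toLinearMap.smulRight (innerSL ℝ (X x)).toLinearMap).compl₁₂
      (surfDer F x).toLinearMap (surfDer F x).toLinearMap)).symm

lemma surfFlux_of_lt (hε : 0 < ε) {x : M} (hx : ε < ‖F x - q‖) :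
    surfFlux (k := k) F X q ε x = 0 := by
  have : deriv cutoff (‖F x - q‖ ^ 2 / ε ^ 2) = 0 := by
    refine deriv_cutoff_of_gt ?_
    rw [lt_div_iff₀ (by positivity)]
    nlinarith
  rw [surfFlux, fluxDens, this]; simp

/-- The product rule for the divergence of the field `X`, cut off near `q`. -/
lemma surfDiv_radialCutoff_smul (hF : ContMDiff (𝓡∂ k) 𝓘(ℝ, Amb n) 1 F)
    (hX : ∀ x, F x ≠ q → ContMDiffAt (𝓡∂ k) 𝓘(ℝ, Amb n) 1 X x) (x : M) :
    surfDiv (k := k) F (fun x => radialCutoff q ε (F x) • X x) x =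
      radialCutoff q ε (F x) * surfDiv (k := k) F X x + surfFlux (k := k) F X q ε x := by
  by_cases hx : F x = q
  · have h1 : ∀ᶠ y in 𝓝 x, radialCutoff q ε (F y) = 0 := by
      have := radialCutoff_eventually_zero (q := q) (ε := ε)
      rw [← hx] at this ⊢
      exact hF.continuous.continuousAt.eventually this
    rw [surfDiv_eq_zero_of_eventuallyEq (h1.mono fun y hy => by simp only [hy, zero_smul]),
      h1.self_of_nhds, zero_mul, zero_add, surfFlux, fluxDens, hx]
    have : deriv cutoff (‖q - q‖ ^ 2 / ε ^ 2) = 0 := deriv_cutoff_of_lt (by simp)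
    rw [this]; simp
  · have hY : ContMDiffAt (𝓡∂ k) 𝓘(ℝ, Amb n) 1 (fun x => radialCutoff q ε (F x) • X x) x :=
      ((contDiff_radialCutoff.of_le (by exact_mod_cast le_top)).contMDiff.contMDiffAt.comp x
        (hF x)).smul (hX x hx)
    have hder : ∀ {Z : M → Amb n}, ContMDiffAt (𝓡∂ k) 𝓘(ℝ, Amb n) 1 Z x →
        HasFDerivWithinAt (Z ∘ (extChartAt (𝓡∂ k) x).symm) (surfDer Z x) (halfSp k)
          (extChartAt (𝓡∂ k) x x) := fun {Z} hZ => by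
      rw [surfDer_eq_locDer hZ]
      refine hasFDerivWithinAt_locDer (chart_mem_atlas (EuclideanHalfSpace k) x)
        (mem_extChartAt_target (I := 𝓡∂ k) x) ?_
      have : (extChartAt (𝓡∂ k) x).symm (extChartAt (𝓡∂ k) x x) = x := extChartAt_to_inv x
      exact (congrArg (ContMDiffAt (𝓡∂ k) 𝓘(ℝ, Amb n) 1 Z) this).mpr hZ
    have hb : (F ∘ (extChartAt (𝓡∂ k) x).symm) (extChartAt (𝓡∂ k) x x) = F x :=
      congrArg F (extChartAt_to_inv x)
    have hXb : (X ∘ (extChartAt (𝓡∂ k) x).symm) (extChartAt (𝓡∂ k) x x) = X x :=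
      congrArg X (extChartAt_to_inv x)
    have h1 := ((hasFDerivAt_radialCutoff (q := q) (ε := ε) _).comp_hasFDerivWithinAt _
      (hder (hF x))).smul (hder (hX x hx))
    have h2 := (uniqueDiffOn_halfSp _ ⟨_, rfl⟩).eq (hder hY) h1
    simp only [Function.comp_apply] at h2 hb hXb
    rw [hb, hXb] at h2
    rw [surfDiv_def, h2, surfDiv_def, surfFlux, fluxDens, ← gramTrace_smul, ← gramTrace_smul,
      ← gramTrace_add]
    congr 1
    ext i j
    generalize F x - q = b
    simp [inner_add_left, real_inner_smul_left]
    ring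

lemma continuous_radialCutoff_mul {g : M → ℝ} (hF : Continuous F)
    (hg : ∀ x, F x ≠ q → ContinuousAt g x) (ε : ℝ) :
    Continuous fun x => radialCutoff q ε (F x) * g x := by
  rw [continuous_iff_continuousAt]
  intro x
  by_cases hx : F x = q
  · have h1 : ∀ᶠ y in 𝓝 x, radialCutoff q ε (F y) = 0 := by
      have := radialCutoff_eventually_zero (q := q) (ε := ε)
      rw [← hx] at this ⊢
      exact hF.continuousAt.eventually this
    exact (continuousAt_const (y := (0 : ℝ))).congr (h1.mono fun y hy => by simp only [hy, zero_mul])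
  · exact (contDiff_radialCutoff.continuous.comp hF).continuousAt.mul (hg x hx)

lemma continuous_radialCutoff_mul_surfDiv (hF : ContMDiff (𝓡∂ k) 𝓘(ℝ, Amb n) ∞ F)
    (hi : ∀ x, Function.Injective (surfDer (k := k) F x))
    (hX : ∀ x, F x ≠ q → ContMDiffAt (𝓡∂ k) 𝓘(ℝ, Amb n) 1 X x) :
    Continuous fun x => radialCutoff q ε (F x) * surfDiv (k := k) F X x :=
  continuous_radialCutoff_mul hF.continuous (fun x hx => continuousAt_surfDiv hF (hi x)
    ((hF.continuous.continuousAt.eventually_ne hx).mono fun y hy => hX y hy)) ε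

lemma contMDiff_radialCutoff_smul (hF : ContMDiff (𝓡∂ k) 𝓘(ℝ, Amb n) 1 F)
    (hX : ∀ x, F x ≠ q → ContMDiffAt (𝓡∂ k) 𝓘(ℝ, Amb n) 1 X x) :
    ContMDiff (𝓡∂ k) 𝓘(ℝ, Amb n) 1 fun x => radialCutoff q ε (F x) • X x := by
  intro x
  by_cases hx : F x = q
  · have h1 : ∀ᶠ y in 𝓝 x, radialCutoff q ε (F y) = 0 := by
      have := radialCutoff_eventually_zero (q := q) (ε := ε)
      rw [← hx] at this ⊢
      exact hF.continuous.continuousAt.eventually this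
    exact (contMDiffAt_const (c := (0 : Amb n))).congr_of_eventuallyEq
      (h1.mono fun y hy => by simp only [hy, zero_smul])
  · exact ((contDiff_radialCutoff.of_le (by exact_mod_cast le_top)).contMDiff.contMDiffAt.comp x
        (hF x)).smul (hX x hx)

/-- The angular proportion of the tangent space at `x` into which the manifold extends: `1/2` at a
boundary point, `1` at an interior point. -/
def pointWeight (k : ℕ) [NeZero k] {M : Type*} [TopologicalSpace M]
    [ChartedSpace (EuclideanHalfSpace k) M] (x : M) : ℝ :=
  if (extChartAt (𝓡∂ k) x x) 0 = 0 then 1 / 2 else 1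

lemma half_le_pointWeight (x : M) : 1 / 2 ≤ pointWeight k x := by
  rw [pointWeight]; split_ifs <;> norm_num

lemma pointWeight_of_notMem_boundary {x : M} (hx : x ∉ (𝓡∂ k).boundary M) :
    pointWeight k x = 1 := by
  rw [pointWeight, if_neg]
  intro h
  have := boundary_of_mem_target (chart_mem_atlas (EuclideanHalfSpace k) x)
    (mem_extChartAt_target (I := 𝓡∂ k) x) h
  exact hx (by rwa [show ((chartAt (EuclideanHalfSpace k) x).extend (𝓡∂ k)).symm
    (extChartAt (𝓡∂ k) x x) = x from extChartAt_to_inv x] at this)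

variable [T2Space M] [CompactSpace M] [MeasurableSpace M] [BorelSpace M]

/-- This is the divergence theorem for the cut off field, which is regular on all of `M`. Continuity
of the flux density comes along: by the product rule it is a difference of two continuous functions.
-/
lemma integral_radialCutoff_mul_surfDiv (hF : IsMinimalOrthogonal k p c F)
    (hX : ∀ x, F x ≠ q → ContMDiffAt (𝓡∂ k) 𝓘(ℝ, Amb n) 1 X x)
    (hXF : ∀ x, F x ≠ q → ⟪X x, F x⟫ = 0)
    (hXb : ∀ x ∈ (𝓡∂ k).boundary M, F x ≠ q → ⟪X x, p⟫ = 0) :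
    Continuous (surfFlux (k := k) F X q ε) ∧
    ∫ x, radialCutoff q ε (F x) * surfDiv (k := k) F X x ∂(areaMeasure k F) =
      - ∫ x, surfFlux (k := k) F X q ε x ∂(areaMeasure k F) := by
  have := isFiniteMeasure_areaMeasure hF.smooth
  have hz : radialCutoff q ε q = 0 := radialCutoff_eventually_zero.self_of_nhds
  have hY := contMDiff_radialCutoff_smul (ε := ε) hF.smooth_one hX
  have h1 := integral_surfDiv_eq_zero hF hY
    (fun x => by
      rw [real_inner_smul_left]
      by_cases hx : F x = q
      · rw [hx, hz, zero_mul]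
      · rw [hXF x hx, mul_zero])
    (fun x hb => by
      rw [real_inner_smul_left]
      by_cases hx : F x = q
      · rw [hx, hz, zero_mul]
      · rw [hXb x hb hx, mul_zero])
  have h2 := continuous_surfDiv hF hY
  have h3 := continuous_radialCutoff_mul_surfDiv (ε := ε) hF.smooth hF.injective hX
  have h4 : surfFlux (k := k) F X q ε = fun x =>
      surfDiv (k := k) F (fun x => radialCutoff q ε (F x) • X x) x -
        radialCutoff q ε (F x) * surfDiv (k := k) F X x := by
    ext x
    rw [surfDiv_radialCutoff_smul hF.smooth_one hX]; ring
  have hint : ∀ {f : M → ℝ}, Continuous f → Integrable f (areaMeasure k F) := fun {f} hf =>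
    hf.integrable_of_hasCompactSupport (HasCompactSupport.of_compactSpace f)
  refine ⟨?_, ?_⟩
  · rw [h4]; exact h2.sub h3
  · rw [h4, integral_sub (hint h2) (hint h3), h1]; ring

/-- The local flux limit, carried to `M` by the preferred chart at `x₀`. It holds for all small open
`V`, so that the neighborhoods of several points of a fiber can be chosen disjoint. -/
lemma tendsto_integral_indicator_surfFlux (hF : IsMinimalOrthogonal k p c F) {x₀ : M}
    (hq : F x₀ = q) (hc : ∀ ε : ℝ, Continuous (surfFlux (k := k) F X q ε))
    (hX : (fun x => X x + (β * ‖F x - q‖ ^ (-(k : ℤ))) • (F x - q))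
      =o[𝓝[≠] x₀] fun x => ‖F x - q‖ ^ (1 - (k : ℤ))) :
    ∃ U ∈ 𝓝 x₀, ∀ V ⊆ U, IsOpen V → x₀ ∈ V →
      Tendsto (fun ε : ℝ => ∫ x, V.indicator (surfFlux (k := k) F X q ε) x ∂(areaMeasure k F))
        (𝓝[>] 0) (𝓝 (-β * sphereArea k * pointWeight k x₀)) := by
  set e := chartAt (EuclideanHalfSpace k) x₀
  have he : e ∈ atlas (EuclideanHalfSpace k) M := chart_mem_atlas _ x₀
  set z₀ : Dom k := e.extend (𝓡∂ k) x₀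
  have hxe : x₀ ∈ e.source := mem_chart_source _ x₀
  have hzt : z₀ ∈ (e.extend (𝓡∂ k)).target := mem_extChartAt_target (I := 𝓡∂ k) x₀
  have hzs : (e.extend (𝓡∂ k)).symm z₀ = x₀ := extChartAt_to_inv x₀
  have hright : ∀ a ∈ (e.extend (𝓡∂ k)).target,
      e.extend (𝓡∂ k) ((e.extend (𝓡∂ k)).symm a) = a := fun a ha =>
    (e.extend (𝓡∂ k)).right_inv ha
  have hu := hasFDerivWithinAt_locDer he hzt (hF.smooth_one _)
  have hA : ∀ a ∈ (e.extend (𝓡∂ k)).target, ContinuousWithinAt (locDer e F) (halfSp k) a :=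
    fun a ha => (contDiffWithinAt_locDer (m := 0) (m' := 1) (by exact_mod_cast le_top) (by simp)
      he ha (hF.smooth_one _)).continuousWithinAt
  have htend : Tendsto (e.extend (𝓡∂ k)).symm (𝓝[halfSp k \ {z₀}] z₀) (𝓝[≠] x₀) := by
    refine tendsto_nhdsWithin_iff.mpr ⟨?_, ?_⟩
    · have := (continuousWithinAt_extend_symm hzt).tendsto
      rw [hzs] at this
      exact this.mono_left (nhdsWithin_mono _ Set.sdiff_subset)
    · filter_upwards [nhdsWithin_mono _ Set.sdiff_subset (extend_target_mem_nhdsWithin hzt),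
        self_mem_nhdsWithin] with a ha hne heq
      refine hne.2 ?_
      have heq : (e.extend (𝓡∂ k)).symm a = x₀ := heq
      have := hright a ha
      rw [heq] at this
      exact this.symm
  obtain ⟨D₀, hD₀, h⟩ := tendsto_local_flux (u := F ∘ (e.extend (𝓡∂ k)).symm)
    (X := X ∘ (e.extend (𝓡∂ k)).symm) (A := locDer e F) (q := q) (z₀ := z₀) (β := β)
    ⟨_, rfl⟩ hu (by rw [Function.comp_apply, hzs, hq]) (hA z₀ hzt)
    (injective_locDer' he hF hzt) (hX.comp_tendsto htend)
  have htend' : Tendsto (e.extend (𝓡∂ k)) (𝓝 x₀) (𝓝[halfSp k] z₀) :=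
    tendsto_nhdsWithin_iff.mpr ⟨continuousAt_extChartAt x₀, Eventually.of_forall fun x => ⟨_, rfl⟩⟩
  refine ⟨e.source ∩ e.extend (𝓡∂ k) ⁻¹' D₀,
    inter_mem (e.open_source.mem_nhds hxe) (htend' hD₀), fun V hV hVo hxV => ?_⟩
  set D := (e.extend (𝓡∂ k)).target ∩ (e.extend (𝓡∂ k)).symm ⁻¹' V
  have hDm : MeasurableSet D := measurableSet_target_inter_preimage hVo.measurableSet
  have hval : ∀ ε : ℝ, ∀ a ∈ (e.extend (𝓡∂ k)).target,
      surfFlux (k := k) F X q ε ((e.extend (𝓡∂ k)).symm a) =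
      fluxDens (locDer e F a) ((F ∘ (e.extend (𝓡∂ k)).symm) a - q)
        ((X ∘ (e.extend (𝓡∂ k)).symm) a) ε := fun ε a ha => by
    rw [surfFlux_eq_locDer he hF.smooth_one (extend_symm_mem_source ha), hright a ha]
    rfl
  have hdens : ∀ ε : ℝ, ContinuousOn (fun a => volDens (locDer e F a) *
      fluxDens (locDer e F a) ((F ∘ (e.extend (𝓡∂ k)).symm) a - q)
        ((X ∘ (e.extend (𝓡∂ k)).symm) a) ε) (e.extend (𝓡∂ k)).target := fun ε => by
    refine ContinuousOn.mul (continuousOn_areaDensity he hF.smooth) ?_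
    refine ContinuousOn.congr (f := fun a => surfFlux (k := k) F X q ε
      ((e.extend (𝓡∂ k)).symm a)) ?_ fun a ha => (hval ε a ha).symm
    exact (hc ε).comp_continuousOn fun a ha =>
      (continuousWithinAt_extend_symm ha).mono extend_target_subset
  have hlim := h D (fun a ha => by
      have := (hV ha.2).2
      rwa [Set.mem_preimage, hright a ha.1] at this)
    (fun a ha => extend_target_subset ha.1)
    (target_inter_preimage_mem_nhdsWithin hVo hxe hxV) hDm
    (fun a ha => injective_locDer' he hF ha.1) (fun ε _ => by
      classical
      rw [← Set.piecewise_eq_indicator]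
      exact ContinuousOn.measurable_piecewise ((hdens ε).mono Set.inter_subset_left)
        continuousOn_const hDm)
  refine Tendsto.congr (fun ε => ?_) hlim
  rw [integral_areaMeasure_of_support he hF.smooth
    ((hc ε).measurable.indicator hVo.measurableSet)
    (fun x hx => Set.indicator_of_notMem (fun hxV => hx (hV hxV).1) _),
    ← integral_indicator hDm, ← integral_indicator measurableSet_extend_target]
  congr 1
  ext a
  by_cases ha : a ∈ (e.extend (𝓡∂ k)).target
  · rw [Set.indicator_of_mem ha]
    by_cases haV : (e.extend (𝓡∂ k)).symm a ∈ V
    · rw [Set.indicator_of_mem (show a ∈ D from ⟨ha, haV⟩), Set.indicator_of_mem haV,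
        hval ε a ha]; rfl
    · rw [Set.indicator_of_notMem (fun h : a ∈ D => haV h.2), Set.indicator_of_notMem haV,
        mul_zero]
  · rw [Set.indicator_of_notMem ha, Set.indicator_of_notMem (fun h : a ∈ D => ha h.1)]

/-- The fiber over `q` is finite. For small `ε` the flux density lives in disjoint neighborhoods of
its points, each of which contributes its own local limit; integration by parts reverses the sign.
-/
theorem tendsto_integral_radialCutoff_mul_surfDiv (hF : IsMinimalOrthogonal k p c F)
    (hX : ∀ x, F x ≠ q → ContMDiffAt (𝓡∂ k) 𝓘(ℝ, Amb n) 1 X x)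
    (hXF : ∀ x, F x ≠ q → ⟪X x, F x⟫ = 0)
    (hXb : ∀ x ∈ (𝓡∂ k).boundary M, F x ≠ q → ⟪X x, p⟫ = 0)
    (hXq : ∀ x₀, F x₀ = q → (fun x => X x + (β * ‖F x - q‖ ^ (-(k : ℤ))) • (F x - q))
      =o[𝓝[≠] x₀] fun x => ‖F x - q‖ ^ (1 - (k : ℤ))) :
    Tendsto (fun ε : ℝ => ∫ x, radialCutoff q ε (F x) * surfDiv (k := k) F X x ∂(areaMeasure k F))
      (𝓝[>] 0) (𝓝 (β * sphereArea k *
        ∑ x ∈ (finite_fiber hF.smooth_one hF.injective q).toFinset, pointWeight k x)) := by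
  have := isFiniteMeasure_areaMeasure hF.smooth
  set S := (finite_fiber hF.smooth_one hF.injective q).toFinset
  have hS : ∀ x, x ∈ S ↔ F x = q := fun x => by
    simp [S]
  have hc : ∀ ε : ℝ, Continuous (surfFlux (k := k) F X q ε) := fun ε =>
    (integral_radialCutoff_mul_surfDiv hF hX hXF hXb).1
  have hloc : ∀ x₀ : M, ∃ U ∈ 𝓝 x₀, x₀ ∈ S → ∀ V ⊆ U, IsOpen V → x₀ ∈ V →
      Tendsto (fun ε : ℝ => ∫ x, V.indicator (surfFlux (k := k) F X q ε) x ∂(areaMeasure k F))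
        (𝓝[>] 0) (𝓝 (-β * sphereArea k * pointWeight k x₀)) := fun x₀ => by
    by_cases hx : x₀ ∈ S
    · obtain ⟨U, hU, h⟩ := tendsto_integral_indicator_surfFlux hF ((hS x₀).mp hx) hc
        (hXq x₀ ((hS x₀).mp hx))
      exact ⟨U, hU, fun _ => h⟩
    · exact ⟨Set.univ, univ_mem, fun h => absurd h hx⟩
  choose U hU hUlim using hloc
  obtain ⟨T, hT, hTd⟩ := (S.finite_toSet).t2_separation
  set V : M → Set M := fun x => T x ∩ interior (U x)
  have hVo : ∀ x, IsOpen (V x) := fun x => (hT x).2.inter isOpen_interior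
  have hxV : ∀ x, x ∈ V x := fun x => ⟨(hT x).1, mem_interior_iff_mem_nhds.mpr (hU x)⟩
  have hVd : (S : Set M).PairwiseDisjoint V := hTd.mono fun x => Set.inter_subset_left
  have hsum := tendsto_finsetSum S fun x hx => hUlim x hx (V x)
    (Set.inter_subset_right.trans interior_subset) (hVo x) (hxV x)
  -- On the compact complement of the neighborhoods the distance of `F` from `q` has a positive
  -- minimum.
  have hδ : ∃ δ > 0, ∀ x, ‖F x - q‖ < δ → ∃ y ∈ S, x ∈ V y := by
    set K : Set M := (⋃ y ∈ S, V y)ᶜ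
    have hK : IsCompact K := (isOpen_biUnion fun y _ => hVo y).isClosed_compl.isCompact
    obtain ⟨δ, hδ, h⟩ := hK.exists_forall_le' (f := fun x => ‖F x - q‖) (a := 0)
      (hF.smooth.continuous.sub continuous_const).norm.continuousOn fun x hx => by
        refine norm_pos_iff.mpr (sub_ne_zero.mpr fun hxq => hx ?_)
        exact Set.mem_biUnion (show x ∈ (S : Set M) from (hS x).mpr hxq) (hxV x)
    refine ⟨δ, hδ, fun x hx => ?_⟩
    by_contra hcon
    push Not at hcon
    exact absurd (h x (by simpa [K] using hcon)) (not_le.mpr hx)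
  obtain ⟨δ, hδ, hcov⟩ := hδ
  have hgoal : β * sphereArea k * ∑ x ∈ S, pointWeight k x =
      -∑ x ∈ S, -β * sphereArea k * pointWeight k x := by
    rw [Finset.mul_sum, ← Finset.sum_neg_distrib]
    exact Finset.sum_congr rfl fun x _ => by ring
  rw [hgoal]
  refine hsum.neg.congr' ?_
  filter_upwards [Ioo_mem_nhdsGT hδ] with ε hε
  rw [(integral_radialCutoff_mul_surfDiv hF hX hXF hXb).2, ← integral_finsetSum]
  · congr 2
    ext x
    by_cases hx : surfFlux (k := k) F X q ε x = 0
    · rw [hx]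
      refine Finset.sum_eq_zero fun y _ => ?_
      by_cases hxy : x ∈ V y
      · rw [Set.indicator_of_mem hxy, hx]
      · rw [Set.indicator_of_notMem hxy]
    · obtain ⟨y, hy, hxy⟩ := hcov x (by
        by_contra hcon
        exact hx (surfFlux_of_lt hε.1 (hε.2.trans_le (not_lt.mp hcon))))
      rw [Finset.sum_eq_single_of_mem y hy, Set.indicator_of_mem hxy]
      intro y' hy' hne
      refine Set.indicator_of_notMem (fun hxy' => ?_) _
      exact Set.disjoint_left.mp (hVd hy' hy hne) hxy' hxy
  · intro y _
    exact (((hc ε).integrable_of_hasCompactSupport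
      (HasCompactSupport.of_compactSpace _))).indicator (hVo y).measurableSet

end GlobalFlux

end SphereBall

end

noncomputable section

namespace SphereBall

/-! ### The volume of a geodesic ball of the `k`-sphere -/

section BallVolume

open MeasureTheory

lemma geodDist_eq_arccos {n : ℕ} {p q : Amb n} (hp : ‖p‖ = 1) (hq : ‖q‖ = 1) :
    geodDist p q = Real.arccos ⟪p, q⟫ := by
  rw [geodDist, InnerProductGeometry.angle, hp, hq, mul_one, div_one]

lemma geodDist_le_iff {n : ℕ} {p q : Amb n} (hp : ‖p‖ = 1) (hq : ‖q‖ = 1) {R : ℝ} (hR0 : 0 ≤ R)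
    (hR : R ≤ Real.pi) : geodDist p q ≤ R ↔ Real.cos R ≤ ⟪p, q⟫ := by
  have h := abs_le.mp (abs_real_inner_le_norm p q)
  rw [hp, hq, mul_one] at h
  rw [geodDist_eq_arccos hp hq]
  constructor
  · intro h1
    have := Real.cos_le_cos_of_nonneg_of_le_pi (Real.arccos_nonneg _) hR h1
    rwa [Real.cos_arccos h.1 h.2] at this
  · intro h1
    have := Real.arccos_le_arccos h1
    rwa [Real.arccos_cos hR0 hR] at this

lemma lintegral_Ioo_ofReal {f : ℝ → ℝ} {a b : ℝ} (hab : a ≤ b) (hf : Continuous f)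
    (h0 : ∀ t ∈ Set.Ioo a b, 0 ≤ f t) :
    ∫⁻ t in Set.Ioo a b, ENNReal.ofReal (f t) = ENNReal.ofReal (∫ t in a..b, f t) := by
  rw [intervalIntegral.integral_of_le hab, integral_Ioc_eq_integral_Ioo,
    ofReal_integral_eq_lintegral_ofReal]
  · exact (hf.integrableOn_Icc).mono_set Set.Ioo_subset_Icc_self
  · exact (ae_restrict_iff' measurableSet_Ioo).mpr (Filter.Eventually.of_forall h0)

variable {k : ℕ}

/-- The first coordinate and the remaining coordinates of a point of `ℝᵏ⁺¹`. -/
def splitFirst (x : Amb k) : ℝ × Dom k := (x 0, WithLp.toLp 2 fun i => x i.succ)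

lemma measurePreserving_splitFirst : MeasurePreserving (splitFirst (k := k)) := by
  have h1 := PiLp.volume_preserving_ofLp (Fin (k + 1))
  have h2 := volume_preserving_piFinSuccAbove (fun _ : Fin (k + 1) => ℝ) 0
  have h3 := (MeasurePreserving.id (volume : Measure ℝ)).prod (PiLp.volume_preserving_toLp (Fin k))
  exact h3.comp (h2.comp h1)

lemma norm_sq_splitFirst (x : Amb k) : ‖x‖ ^ 2 = (splitFirst x).1 ^ 2 + ‖(splitFirst x).2‖ ^ 2 := by
  rw [EuclideanSpace.norm_sq_eq, EuclideanSpace.norm_sq_eq, Fin.sum_univ_succ]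
  simp [splitFirst]

/-- The truncated cone over a geodesic ball, in split coordinates. -/
def truncCone (k : ℕ) (c : ℝ) : Set (ℝ × Dom k) :=
  {P | 0 < P.1 ^ 2 + ‖P.2‖ ^ 2 ∧ P.1 ^ 2 + ‖P.2‖ ^ 2 < 1 ∧ c * √(P.1 ^ 2 + ‖P.2‖ ^ 2) ≤ P.1}

lemma measurableSet_truncCone (c : ℝ) : MeasurableSet (truncCone k c) := by
  have h : Measurable fun P : ℝ × Dom k => P.1 ^ 2 + ‖P.2‖ ^ 2 := by fun_prop
  exact (measurableSet_lt measurable_const h).inter ((measurableSet_lt h measurable_const).inter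
    (measurableSet_le (h.sqrt.const_mul c) measurable_fst))

/-- The surface measure of a subset of the sphere is `k + 1` times the volume of the cone over it in
the unit ball, without the apex. -/
lemma ballVolume_eq_truncCone {R : ℝ} (hR0 : 0 ≤ R) (hR : R ≤ Real.pi) :
    ballVolume k R = (k + 1 : ℕ) * volume (truncCone k (Real.cos R)) := by
  set E : Amb k := EuclideanSpace.single 0 1
  have hE : ‖E‖ = 1 := by simp [E]
  have hin : ∀ x : Amb k, ⟪E, x⟫ = x 0 := fun x => by
    simp [E, EuclideanSpace.inner_single_left]
  have hset : {q : Metric.sphere (0 : Amb k) 1 | geodDist (EuclideanSpace.single 0 1 : Amb k)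
      (q : Amb k) ≤ R} = {q : Metric.sphere (0 : Amb k) 1 | Real.cos R ≤ (q : Amb k) 0} := by
    ext q
    change q ∈ {q : Metric.sphere (0 : Amb k) 1 | geodDist E (q : Amb k) ≤ R} ↔ _
    rw [Set.mem_ofPred_eq, geodDist_le_iff hE (norm_eq_of_mem_sphere q) hR0 hR, hin]; rfl
  rw [ballVolume, hset, Measure.toSphere_apply', finrank_euclideanSpace_fin]
  · congr 1
    rw [← measurePreserving_splitFirst.measure_preimage
      (measurableSet_truncCone _).nullMeasurableSet]
    congr 1
    ext x
    rw [Set.mem_smul, Set.mem_preimage, truncCone, Set.mem_ofPred_eq, ← norm_sq_splitFirst,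
      Real.sqrt_sq (norm_nonneg x)]
    constructor
    · rintro ⟨t, ht, _, ⟨q, hq, rfl⟩, rfl⟩
      have hq : Real.cos R ≤ (q : Amb k) 0 := hq
      rw [norm_smul, norm_eq_of_mem_sphere, mul_one, Real.norm_of_nonneg ht.1.le]
      refine ⟨pow_pos ht.1 2, pow_lt_one₀ ht.1.le ht.2 two_ne_zero, ?_⟩
      rw [mul_comm]
      exact mul_le_mul_of_nonneg_left hq ht.1.le
    · rintro ⟨h1, h2, h3⟩
      have hx : 0 < ‖x‖ := by
        by_contra hcon
        have : ‖x‖ = 0 := le_antisymm (not_lt.mp hcon) (norm_nonneg _)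
        rw [this] at h1; simp at h1
      refine ⟨‖x‖, ⟨hx, by nlinarith⟩, ‖x‖⁻¹ • x,
        ⟨⟨‖x‖⁻¹ • x, by simp [norm_smul, hx.ne']⟩, ?_, rfl⟩, ?_⟩
      · change Real.cos R ≤ ‖x‖⁻¹ * x 0
        rw [← div_eq_inv_mul, le_div_iff₀ hx]; exact h3
      · rw [smul_smul, mul_inv_cancel₀ hx.ne', one_smul]
  · refine measurableSet_le measurable_const ?_
    fun_prop

/-- Below the height `cos R` the lateral side of the cone is reached before the unit sphere, so the
condition `‖x‖ < 1` is automatic. -/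
lemma truncCone_slice_low {R t : ℝ} (hR0 : 0 < R) (hR : R ≤ Real.pi / 2) (ht0 : 0 < t)
    (ht : t < Real.cos R) :
    Prod.mk t ⁻¹' truncCone k (Real.cos R) = Metric.closedBall 0 (t * Real.tan R) := by
  have hc : 0 < Real.cos R := ht0.trans ht
  have hs : 0 < Real.sin R := Real.sin_pos_of_pos_of_lt_pi hR0 (by linarith [Real.pi_pos])
  have hcs := Real.sin_sq_add_cos_sq R
  ext y
  rw [Set.mem_preimage, truncCone, Set.mem_ofPred_eq, mem_closedBall_zero_iff, Real.tan_eq_sin_div_cos,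
    ← mul_div_assoc, le_div_iff₀ hc]
  dsimp only
  have hy := norm_nonneg y
  have hkey : Real.cos R * √(t ^ 2 + ‖y‖ ^ 2) ≤ t ↔ ‖y‖ * Real.cos R ≤ t * Real.sin R := by
    rw [← sq_le_sq₀ (a := Real.cos R * √(t ^ 2 + ‖y‖ ^ 2)) (by positivity) ht0.le,
      ← sq_le_sq₀ (a := ‖y‖ * Real.cos R) (by positivity) (by positivity),
      mul_pow, Real.sq_sqrt (by positivity), mul_pow, mul_pow]
    have hs2 : Real.sin R ^ 2 = 1 - Real.cos R ^ 2 := by linarith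
    rw [hs2]
    constructor <;> intro h <;> linarith
  rw [hkey]
  refine ⟨fun h => h.2.2, fun h => ⟨by positivity, ?_, h⟩⟩
  have h1 := hkey.mpr h
  have h2 : √(t ^ 2 + ‖y‖ ^ 2) < 1 := by
    by_contra hcon
    push Not at hcon
    nlinarith
  rwa [Real.sqrt_lt' one_pos, one_pow] at h2

lemma truncCone_slice_high {R t : ℝ} (hR : 0 ≤ Real.cos R) (ht0 : 0 < t) (ht : Real.cos R ≤ t) :
    Prod.mk t ⁻¹' truncCone k (Real.cos R) = Metric.ball 0 (√(1 - t ^ 2)) := by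
  ext y
  rw [Set.mem_preimage, truncCone, Set.mem_ofPred_eq, mem_ball_zero_iff,
    Real.lt_sqrt (norm_nonneg _)]
  dsimp only
  refine ⟨fun h => by linarith [h.2.1], fun h => ⟨by positivity, by linarith, ?_⟩⟩
  have h2 : √(t ^ 2 + ‖y‖ ^ 2) ≤ 1 := by
    rw [Real.sqrt_le_one]; linarith
  nlinarith

lemma truncCone_slice_empty {R t : ℝ} (hR : 0 ≤ Real.cos R) (ht : t < 0 ∨ 1 ≤ t) :
    Prod.mk t ⁻¹' truncCone k (Real.cos R) = ∅ := by
  ext y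
  rw [Set.mem_preimage, truncCone, Set.mem_ofPred_eq]
  dsimp only
  simp only [Set.mem_empty_iff_false, iff_false]
  rintro ⟨_, h2, h3⟩
  rcases ht with ht | ht
  · have := mul_nonneg hR (Real.sqrt_nonneg (t ^ 2 + ‖y‖ ^ 2))
    linarith
  · nlinarith [sq_nonneg ‖y‖]

/-- With `t = cos s` the second integral becomes that of `sin^(k+1)`. The boundary term of the
reduction formula for powers of the sine cancels the first integral. -/
lemma integral_min_radius [NeZero k] {R : ℝ} (hR0 : 0 < R) (hR : R ≤ Real.pi / 2) :
    (∫ t in (0 : ℝ)..Real.cos R, (t * Real.tan R) ^ k) + ∫ t in Real.cos R..1, √(1 - t ^ 2) ^ k =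
      k / (k + 1) * radialInt k R := by
  obtain ⟨m, rfl⟩ := Nat.exists_eq_succ_of_ne_zero (NeZero.ne k)
  have hc : 0 ≤ Real.cos R := Real.cos_nonneg_of_mem_Icc ⟨by linarith, hR⟩
  have h1 : ∫ t in (0 : ℝ)..Real.cos R, (t * Real.tan R) ^ (m + 1) =
      Real.sin R ^ (m + 1) * Real.cos R / (m + 2) := by
    simp_rw [mul_pow]
    rw [intervalIntegral.integral_mul_const, integral_pow]
    -- For `R = π / 2` the tangent carries no information, but the interval has length zero and both
    -- sides vanish.
    rcases hc.eq_or_lt with h | h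
    · rw [← h]; simp
    · rw [Real.tan_eq_sin_div_cos, div_pow]
      push_cast
      field_simp
      ring
  have h2 : ∫ t in Real.cos R..1, √(1 - t ^ 2) ^ (m + 1) = ∫ s in (0 : ℝ)..R, Real.sin s ^ (m + 2) := by
    have h3 := intervalIntegral.integral_comp_mul_deriv (a := 0) (b := R) (f := Real.cos)
      (f' := fun s => -Real.sin s) (g := fun t => √(1 - t ^ 2) ^ (m + 1))
      (fun s _ => Real.hasDerivAt_cos s) (by fun_prop) (by fun_prop)
    rw [Real.cos_zero] at h3
    rw [intervalIntegral.integral_symm, ← h3, ← intervalIntegral.integral_neg]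
    refine intervalIntegral.integral_congr fun s hs => ?_
    rw [Set.uIcc_of_le hR0.le] at hs
    have hs0 : 0 ≤ Real.sin s := Real.sin_nonneg_of_nonneg_of_le_pi hs.1
      (by linarith [hs.2, Real.pi_pos])
    simp only [Function.comp_apply]
    rw [← Real.sin_sq, Real.sqrt_sq hs0]
    ring
  rw [h1, h2, integral_sin_pow, radialInt]
  simp
  field_simp
  ring

/-- Slicing the cone perpendicularly to its axis gives balls of `ℝᵏ`, whose radius changes its
formula at height `cos R`. The factor `k + 1` of the cone cancels the denominator of
`integral_min_radius` and leaves `k` times the volume of the unit ball. -/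
theorem ballVolume_eq [NeZero k] {R : ℝ} (hR0 : 0 < R) (hR : R ≤ Real.pi / 2) :
    ballVolume k R = ENNReal.ofReal (sphereArea k * radialInt k R) := by
  have hc : 0 ≤ Real.cos R := Real.cos_nonneg_of_mem_Icc ⟨by linarith, hR⟩
  have hc1 : Real.cos R ≤ 1 := Real.cos_le_one R
  have hs : 0 ≤ Real.sin R := Real.sin_nonneg_of_nonneg_of_le_pi hR0.le (by linarith)
  set w : ℝ := (volume : Measure (Dom k)).real (Metric.ball 0 1)
  have hw : volume (Metric.ball (0 : Dom k) 1) = ENNReal.ofReal w :=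
    (ENNReal.ofReal_toReal measure_ball_lt_top.ne).symm
  have hw0 : 0 ≤ w := measureReal_nonneg
  have htan : 0 ≤ Real.tan R := by rw [Real.tan_eq_sin_div_cos]; positivity
  have hslice : (fun t => volume (Prod.mk t ⁻¹' truncCone k (Real.cos R))) =ᵐ[volume] fun t =>
      (Set.Ioo 0 (Real.cos R)).indicator (fun t => ENNReal.ofReal ((t * Real.tan R) ^ k * w)) t +
      (Set.Ioo (Real.cos R) 1).indicator (fun t => ENNReal.ofReal (√(1 - t ^ 2) ^ k * w)) t := by
    filter_upwards [(volume : Measure ℝ).ae_ne 0, (volume : Measure ℝ).ae_ne (Real.cos R)]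
      with t ht0 htc
    by_cases h1 : t < 0 ∨ 1 ≤ t
    · rw [truncCone_slice_empty hc h1, measure_empty, Set.indicator_of_notMem,
        Set.indicator_of_notMem, add_zero]
      · rintro ⟨h2, h3⟩
        rcases h1 with h1 | h1 <;> linarith
      · rintro ⟨h2, h3⟩
        rcases h1 with h1 | h1 <;> linarith
    · push Not at h1
      have htp : 0 < t := lt_of_le_of_ne h1.1 (Ne.symm ht0)
      rcases lt_or_gt_of_ne htc with h2 | h2
      · rw [truncCone_slice_low hR0 hR htp h2, Measure.addHaar_closedBall _ _ (by positivity),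
          Set.indicator_of_mem (show t ∈ Set.Ioo 0 (Real.cos R) from ⟨htp, h2⟩),
          Set.indicator_of_notMem (fun h => h2.not_gt h.1),
          add_zero, finrank_euclideanSpace_fin, hw, ← ENNReal.ofReal_mul (by positivity)]
      · rw [truncCone_slice_high hc htp h2.le, Measure.addHaar_ball _ _ (Real.sqrt_nonneg _),
          Set.indicator_of_mem (show t ∈ Set.Ioo (Real.cos R) 1 from ⟨h2, h1.2⟩),
          Set.indicator_of_notMem (fun h => h2.not_gt h.2), zero_add,
          finrank_euclideanSpace_fin, hw, ← ENNReal.ofReal_mul (by positivity)]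
  rw [ballVolume_eq_truncCone hR0.le (by linarith), Measure.volume_eq_prod,
    Measure.prod_apply (measurableSet_truncCone _), lintegral_congr_ae hslice,
    lintegral_add_left ((by fun_prop : Measurable fun t : ℝ =>
      ENNReal.ofReal ((t * Real.tan R) ^ k * w)).indicator measurableSet_Ioo), lintegral_indicator measurableSet_Ioo,
    lintegral_indicator measurableSet_Ioo,
    lintegral_Ioo_ofReal hc (by fun_prop) (fun t ht => by have := ht.1; positivity),
    lintegral_Ioo_ofReal hc1 (by fun_prop) (fun t ht => by positivity),
    ← ENNReal.ofReal_add, ← ENNReal.ofReal_natCast, ← ENNReal.ofReal_mul (by positivity),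
    intervalIntegral.integral_mul_const, intervalIntegral.integral_mul_const, ← add_mul,
    integral_min_radius hR0 hR]
  · congr 1
    rw [sphereArea]
    push_cast
    field_simp
    rfl
  · exact intervalIntegral.integral_nonneg hc fun t ht => by have := ht.1; positivity
  · exact intervalIntegral.integral_nonneg hc1 fun t _ => by positivity

end BallVolume

end SphereBall

end

noncomputable section

namespace SphereBall

/-! ### Distance functions of the sphere and asymptotics near a point -/

section Formulas

open Filter Asymptotics

variable {n k : ℕ} {p q y : Amb n} {R : ℝ}

lemma hasGradientAt_geodDist (hp : ‖p‖ = 1) (hq : ‖q‖ = 1) (h : ⟪p, q⟫ ^ 2 < 1) :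
    HasGradientAt (fun z => geodDist p z)
      (-(√(1 - ⟪p, q⟫ ^ 2))⁻¹ • (p - ⟪p, q⟫ • q)) q := by
  have hq0 : q ≠ 0 := by rintro rfl; simp at hq
  have h1 : HasFDerivAt (fun z : Amb n => ‖z‖ ^ 2) (2 • innerSL ℝ q) q := by
    simpa using (hasFDerivAt_id q).norm_sq
  have h2 : HasFDerivAt (fun z : Amb n => ‖z‖) (innerSL ℝ q) q := by
    have h3 := h1.sqrt (by rw [hq]; norm_num)
    simp only [Real.sqrt_sq (norm_nonneg _)] at h3
    refine h3.congr_fderiv ?_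
    ext v
    simp [hq]
  have h4 : HasFDerivAt (fun z : Amb n => ⟪p, z⟫ / (‖p‖ * ‖z‖))
      (innerSL ℝ (p - ⟪p, q⟫ • q)) q := by
    have h5 := ((innerSL ℝ p).hasFDerivAt (x := q)).mul
      ((hasDerivAt_inv (by rw [hq]; norm_num)).comp_hasFDerivAt q h2)
    simp only [hp, one_mul, div_eq_mul_inv]
    refine h5.congr_fderiv ?_
    ext v
    simp [hq]
    ring
  have hval : ⟪p, q⟫ / (‖p‖ * ‖q‖) = ⟪p, q⟫ := by rw [hp, hq, mul_one, div_one]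
  have h5 := (Real.hasDerivAt_arccos (x := ⟪p, q⟫ / (‖p‖ * ‖q‖))
    (by rw [hval]; nlinarith) (by rw [hval]; nlinarith)).comp_hasFDerivAt q h4
  rw [hasGradientAt_iff_hasFDerivAt]
  refine h5.congr_fderiv ?_
  rw [hval]
  ext v
  simp

lemma gradDist_eq (hp : ‖p‖ = 1) (hq : ‖q‖ = 1) (h : ⟪p, q⟫ ^ 2 < 1) :
    gradDist p q = -(√(1 - ⟪p, q⟫ ^ 2))⁻¹ • (p - ⟪p, q⟫ • q) :=
  (hasGradientAt_geodDist hp hq h).gradient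

lemma smul_gradDist_eq (hp : ‖p‖ = 1) (hq : ‖q‖ = 1) (h : ⟪p, q⟫ ^ 2 < 1) :
    (-√(1 - ⟪p, q⟫ ^ 2)) • gradDist p q = p - ⟪p, q⟫ • q := by
  rw [gradDist_eq hp hq h, smul_smul, neg_mul_neg, mul_inv_cancel₀, one_smul]
  exact (Real.sqrt_pos.mpr (by linarith)).ne'

lemma inner_eq_norm_sub (hp : ‖p‖ = 1) (hq : ‖q‖ = 1) : ⟪p, q⟫ = 1 - ‖q - p‖ ^ 2 / 2 := by
  rw [norm_sub_sq_real, hp, hq, real_inner_comm]; ring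

lemma inner_lt_one_of_ne (hp : ‖p‖ = 1) (hq : ‖q‖ = 1) (h : q ≠ p) : ⟪p, q⟫ < 1 := by
  rw [inner_eq_norm_sub hp hq]
  have : 0 < ‖q - p‖ := norm_pos_iff.mpr (sub_ne_zero.mpr h)
  have := pow_pos this 2
  linarith

lemma mem_geodBall_iff (hp : ‖p‖ = 1) (hR0 : 0 ≤ R) (hR : R ≤ Real.pi) :
    q ∈ geodBall p R ↔ ‖q‖ = 1 ∧ Real.cos R ≤ ⟪p, q⟫ :=
  and_congr_right fun hq => geodDist_le_iff hp hq hR0 hR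

lemma mem_geodSphere_iff (hp : ‖p‖ = 1) (hR0 : 0 ≤ R) (hR : R ≤ Real.pi) :
    q ∈ geodSphere p R ↔ ‖q‖ = 1 ∧ ⟪p, q⟫ = Real.cos R := by
  refine and_congr_right fun hq => ?_
  have h := abs_le.mp (abs_real_inner_le_norm p q)
  rw [hp, hq, mul_one] at h
  rw [geodDist_eq_arccos hp hq]
  constructor
  · rintro rfl; exact (Real.cos_arccos h.1 h.2).symm
  · intro h1; rw [h1, Real.arccos_cos hR0 hR]

/-- A chord of length `s` subtends the angle `2 arcsin (s / 2)`. Geodesic and chordal distance are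
therefore interchangeable in the leading term. -/
lemma tendsto_geodDist_div :
    Tendsto (fun s : ℝ => Real.arccos (1 - s ^ 2 / 2) / s) (𝓝[>] 0) (𝓝 1) := by
  have h1 : HasDerivAt (fun s : ℝ => 2 * Real.arcsin (s / 2)) 1 0 := by
    have h2 := (Real.hasDerivAt_arcsin (x := (0 : ℝ) / 2) (by norm_num) (by norm_num)).comp (0 : ℝ)
      ((hasDerivAt_id (0 : ℝ)).div_const 2)
    have h3 := h2.const_mul 2
    refine h3.congr_deriv ?_
    norm_num
  have h2 := (hasDerivAt_iff_tendsto_slope_zero.mp h1).mono_left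
    (nhdsWithin_mono _ fun s (hs : (0 : ℝ) < s) => hs.ne')
  refine h2.congr' ?_
  filter_upwards [Ioo_mem_nhdsGT (show (0 : ℝ) < 1 by norm_num)] with s hs
  have h3 : Real.arccos (1 - s ^ 2 / 2) = 2 * Real.arcsin (s / 2) := by
    have h4 : 1 - s ^ 2 / 2 = Real.cos (2 * Real.arcsin (s / 2)) := by
      rw [Real.cos_two_mul', Real.cos_sq', Real.sin_arcsin (by linarith [hs.1]) (by linarith [hs.2])]
      ring
    rw [h4, Real.arccos_cos]
    · have := Real.arcsin_nonneg.mpr (by linarith [hs.1] : 0 ≤ s / 2); linarith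
    · have := Real.arcsin_le_pi_div_two (s / 2); linarith
  rw [h3]
  simp only [zero_add, zero_div, Real.arcsin_zero, mul_zero, sub_zero, smul_eq_mul]
  exact (div_eq_inv_mul _ _).symm

lemma one_sub_inner_sq (hp : ‖p‖ = 1) (hq : ‖q‖ = 1) :
    1 - ⟪p, q⟫ ^ 2 = ‖q - p‖ ^ 2 * (1 - ‖q - p‖ ^ 2 / 4) := by
  rw [inner_eq_norm_sub hp hq]; ring

/-- To first order `p - ⟪p, f⟫ f` is `-(f - p)`. The error `(s² / 2) f` has one more power of the
distance `s`, which is what a coefficient of order `s^(-k)` requires. -/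
lemma isLittleO_smul_sub {ι : Type*} {l : Filter ι} {f : ι → Amb n} {H : ι → ℝ} {β : ℝ}
    (hp : ‖p‖ = 1) (hf : Tendsto f l (𝓝[≠] p)) (hf1 : ∀ᶠ x in l, ‖f x‖ = 1)
    (hH : Tendsto (fun x => ‖f x - p‖ ^ k * H x) l (𝓝 β)) :
    (fun x => H x • (p - ⟪p, f x⟫ • f x) + (β * ‖f x - p‖ ^ (-(k : ℤ))) • (f x - p))
      =o[l] fun x => ‖f x - p‖ ^ (1 - (k : ℤ)) := by
  have hs : Tendsto (fun x => ‖f x - p‖) l (𝓝 0) := by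
    have := ((tendsto_nhdsWithin_iff.mp hf).1.sub_const p).norm
    simpa using this
  have hne : ∀ᶠ x in l, f x ≠ p := (tendsto_nhdsWithin_iff.mp hf).2
  have hc : Tendsto (fun x => |‖f x - p‖ ^ k * H x - β| +
      |‖f x - p‖ ^ k * H x| * (‖f x - p‖ / 2)) l (𝓝 0) := by
    have := ((hH.sub_const β).abs).add (hH.abs.mul (hs.div_const 2))
    simpa using this
  rw [isLittleO_iff]
  intro δ hδ
  filter_upwards [hf1, hne, hc.eventually_le_const hδ] with x h1 h2 h3
  set s := ‖f x - p‖
  have hs0 : 0 < s := norm_pos_iff.mpr (sub_ne_zero.mpr h2)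
  have hu : ⟪p, f x⟫ = 1 - s ^ 2 / 2 := inner_eq_norm_sub hp h1
  have h4 : H x • (p - ⟪p, f x⟫ • f x) + (β * s ^ (-(k : ℤ))) • (f x - p) =
      (-(H x - β * s ^ (-(k : ℤ)))) • (f x - p) + (H x * (s ^ 2 / 2)) • f x := by
    rw [hu]; module
  have h5 : s ^ (1 - (k : ℤ)) = s * (s ^ k)⁻¹ := by
    rw [zpow_sub₀ hs0.ne', zpow_one, zpow_natCast, div_eq_mul_inv]
  have h6 : s ^ (-(k : ℤ)) = (s ^ k)⁻¹ := by rw [zpow_neg, zpow_natCast]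
  rw [h4, Real.norm_of_nonneg (zpow_nonneg hs0.le _)]
  calc _ ≤ |H x - β * s ^ (-(k : ℤ))| * s + |H x| * (s ^ 2 / 2) := by
        refine (norm_add_le _ _).trans ?_
        rw [norm_smul, norm_smul, norm_neg, Real.norm_eq_abs, Real.norm_eq_abs, h1, mul_one,
          abs_mul, abs_of_nonneg (by positivity : 0 ≤ s ^ 2 / 2)]
    _ = (|s ^ k * H x - β| + |s ^ k * H x| * (s / 2)) * s ^ (1 - (k : ℤ)) := by
        have h7 : s ^ k * H x - β = s ^ k * (H x - β * s ^ (-(k : ℤ))) := by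
          rw [h6]; field_simp
        rw [h7, abs_mul, abs_mul, abs_of_pos (pow_pos hs0 k), h5]
        field_simp
    _ ≤ δ * s ^ (1 - (k : ℤ)) := by
        exact mul_le_mul_of_nonneg_right h3 (zpow_nonneg hs0.le _)

/-- Asymptotics near `y` in terms of the geodesic distance, expressed by the chordal distance. -/
lemma isLittleO_of_geodDist {ι : Type*} {l : Filter ι} {f X : ι → Amb n} {b : ℝ}
    (hy : ‖y‖ = 1) (hf : Tendsto f l (𝓝[≠] y)) (hf1 : ∀ᶠ x in l, ‖f x‖ = 1)
    (h : (fun x => X x - (-b * geodDist y (f x) ^ (1 - (k : ℤ))) • gradDist y (f x))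
      =o[l] fun x => geodDist y (f x) ^ (1 - (k : ℤ))) :
    (fun x => X x + (b * ‖f x - y‖ ^ (-(k : ℤ))) • (f x - y))
      =o[l] fun x => ‖f x - y‖ ^ (1 - (k : ℤ)) := by
  have hne : ∀ᶠ x in l, f x ≠ y := (tendsto_nhdsWithin_iff.mp hf).2
  have hs0 : Tendsto (fun x => ‖f x - y‖) l (𝓝 0) := by
    have := ((tendsto_nhdsWithin_iff.mp hf).1.sub_const y).norm
    simpa using this
  have hs : Tendsto (fun x => ‖f x - y‖) l (𝓝[>] 0) :=
    tendsto_nhdsWithin_iff.mpr ⟨hs0, hne.mono fun x hx => norm_pos_iff.mpr (sub_ne_zero.mpr hx)⟩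
  have hratio : Tendsto (fun x => geodDist y (f x) / ‖f x - y‖) l (𝓝 1) := by
    refine (tendsto_geodDist_div.comp hs).congr' ?_
    filter_upwards [hf1] with x hx
    rw [Function.comp_apply, geodDist_eq_arccos hy hx, inner_eq_norm_sub hy hx]
  have hzr : Tendsto (fun x => (geodDist y (f x) / ‖f x - y‖) ^ (1 - (k : ℤ))) l (𝓝 1) := by
    have := hratio.zpow₀ (1 - (k : ℤ)) (Or.inl one_ne_zero)
    rwa [one_zpow] at this
  have hO : (fun x => geodDist y (f x) ^ (1 - (k : ℤ))) =O[l]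
      fun x => ‖f x - y‖ ^ (1 - (k : ℤ)) := by
    have h1 := (hzr.isBigO_one ℝ).mul (isBigO_refl (fun x => ‖f x - y‖ ^ (1 - (k : ℤ))) l)
    refine (h1.congr' ?_ ?_)
    · filter_upwards [hne] with x hx
      have : ‖f x - y‖ ≠ 0 := norm_ne_zero_iff.mpr (sub_ne_zero.mpr hx)
      rw [← mul_zpow, div_mul_cancel₀ _ this]
    · exact Eventually.of_forall fun x => one_mul _
  set H : ι → ℝ := fun x => b * geodDist y (f x) ^ (1 - (k : ℤ)) * (√(1 - ⟪y, f x⟫ ^ 2))⁻¹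
  have hH : Tendsto (fun x => ‖f x - y‖ ^ k * H x) l (𝓝 b) := by
    have h1 : Tendsto (fun x => (√(1 - ‖f x - y‖ ^ 2 / 4))⁻¹) l (𝓝 1) := by
      have h2 : Tendsto (fun s : ℝ => √(1 - s ^ 2 / 4)) (𝓝 0) (𝓝 (√(1 - 0 ^ 2 / 4))) :=
        Continuous.tendsto (by fun_prop) 0
      have h3 : √(1 - (0 : ℝ) ^ 2 / 4) = 1 := by norm_num
      rw [h3] at h2
      have := (h2.comp hs0).inv₀ one_ne_zero
      rwa [inv_one] at this
    have h2 := (hzr.const_mul b).mul h1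
    rw [mul_one, mul_one] at h2
    refine h2.congr' ?_
    filter_upwards [hf1, hne] with x h1 hx
    have hs1 : 0 < ‖f x - y‖ := norm_pos_iff.mpr (sub_ne_zero.mpr hx)
    simp only [H]
    rw [one_sub_inner_sq hy h1, Real.sqrt_mul (by positivity), Real.sqrt_sq hs1.le, div_zpow,
      zpow_sub₀ hs1.ne', zpow_one, zpow_natCast, mul_inv]
    field_simp
  have hmain := isLittleO_smul_sub hy hf hf1 hH
  refine ((h.trans_isBigO hO).add hmain).congr' ?_ EventuallyEq.rfl
  have hlt : ∀ᶠ x in l, ‖f x - y‖ < 1 := hs0.eventually_lt_const one_pos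
  filter_upwards [hf1, hne, hlt] with x h1 hx h2
  have hs1 : 0 < ‖f x - y‖ := norm_pos_iff.mpr (sub_ne_zero.mpr hx)
  have h3 : ⟪y, f x⟫ ^ 2 < 1 := by
    have := one_sub_inner_sq hy h1
    have h4 : 0 < ‖f x - y‖ ^ 2 * (1 - ‖f x - y‖ ^ 2 / 4) := by
      have : ‖f x - y‖ ^ 2 < 1 := pow_lt_one₀ hs1.le h2 two_ne_zero
      have : 0 < 1 - ‖f x - y‖ ^ 2 / 4 := by linarith
      positivity
    linarith
  rw [gradDist_eq hy h1 h3, smul_smul]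
  simp only [H]
  module

end Formulas

/-! ### Divergence of multiples of the radial field -/

section Divergence

variable {n k : ℕ} [NeZero k] {M : Type*} [TopologicalSpace M]
  [ChartedSpace (EuclideanHalfSpace k) M] [IsManifold (𝓡∂ k) ∞ M]
  {F : M → Amb n} {p : Amb n} {c : ℝ}

lemma surfDer_comp {G : Type*} [NormedAddCommGroup G] [NormedSpace ℝ G] {Y : Amb n → G}
    {Y' : Amb n →L[ℝ] G} {x : M}
    (hF : ContMDiff (𝓡∂ k) 𝓘(ℝ, Amb n) 1 F) (hY : HasFDerivAt Y Y' (F x)) :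
    surfDer (k := k) (Y ∘ F) x = Y'.comp (surfDer F x) := by
  have h1 : HasMFDerivAt 𝓘(ℝ, Amb n) 𝓘(ℝ, G) Y (F x) Y' := hY.hasMFDerivAt
  have h2 := ((hF x).mdifferentiableAt one_ne_zero).hasMFDerivAt
  exact (h1.comp x h2).mfderiv

/-- The divergence of a multiple of the tangential part `p - ⟪p, F⟫ F` of a constant vector `p`. -/
lemma surfDiv_smul_radial_eq (hF : ContMDiff (𝓡∂ k) 𝓘(ℝ, Amb n) 1 F) (hn : ∀ x, ‖F x‖ = 1) {x : M}
    (hi : Function.Injective (surfDer (k := k) F x)) {H : Amb n → ℝ} {H' : Amb n →L[ℝ] ℝ}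
    (hH : HasFDerivAt H H' (F x)) :
    surfDiv (k := k) F (fun x => H (F x) • (p - ⟪p, F x⟫ • F x)) x =
      gramTrace (surfDer (k := k) F x)
        (fun i j => H' (surfDer F x (bv i)) * ⟪p - ⟪p, F x⟫ • F x, surfDer F x (bv j)⟫)
      - k * ⟪p, F x⟫ * H (F x) := by
  have h1 : HasFDerivAt (fun z : Amb n => H z • (p - ⟪p, z⟫ • z)) _ (F x) :=
    hH.smul ((((innerSL ℝ p).hasFDerivAt (x := F x)).smul (hasFDerivAt_id (F x))).const_sub p)
  have h2 := surfDer_comp hF h1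
  have h3 : (fun x => H (F x) • (p - ⟪p, F x⟫ • F x)) =
    (fun z : Amb n => H z • (p - ⟪p, z⟫ • z)) ∘ F := rfl
  rw [h3, surfDiv_def, h2]
  have h6 := gramTrace_smul (surfDer (k := k) F x) (⟪p, F x⟫ * H (F x))
    (fun i j => ⟪surfDer F x (bv i), surfDer F x (bv j)⟫)
  rw [gramTrace_gramMat _ hi] at h6
  rw [mul_assoc, mul_comm (k : ℝ), ← h6, ← gramTrace_sub]
  congr 1
  ext i j
  -- In the derivative of `-⟪p, F⟫ F` the part along `F` drops out; the other part is `-⟪p, F⟫ dF`,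
  -- with trace `-k ⟪p, F⟫`.
  have h7 : ⟪F x, surfDer F x (bv j)⟫ = 0 := inner_surfDer_self hF hn x (bv j)
  simp [inner_add_left, inner_sub_left, inner_neg_left, real_inner_smul_left, h7]
  ring

/-- If the radial vector is tangent, the trace of the form of rank one is the derivative of `H` in
its direction. The divergence is then given by an ordinary differential operator in `⟪p, F⟫` when
`H` is a function of it. -/
lemma surfDiv_smul_radial (hF : ContMDiff (𝓡∂ k) 𝓘(ℝ, Amb n) 1 F) (hn : ∀ x, ‖F x‖ = 1) {x : M}
    (hi : Function.Injective (surfDer (k := k) F x)) {H : Amb n → ℝ} {H' : Amb n →L[ℝ] ℝ}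
    (hH : HasFDerivAt H H' (F x)) (hT : p - ⟪p, F x⟫ • F x ∈ tangentPlane (k := k) F x) :
    surfDiv (k := k) F (fun x => H (F x) • (p - ⟪p, F x⟫ • F x)) x =
      H' (p - ⟪p, F x⟫ • F x) - k * ⟪p, F x⟫ * H (F x) := by
  rw [surfDiv_smul_radial_eq hF hn hi hH]
  congr 1
  obtain ⟨v, hv⟩ := (mem_tangentPlane_iff F x _).mp hT
  rw [← hv, gramTrace_mul_inner, tanCoord_map _ hi, clm_eq_sum _ v, map_sum]
  exact Finset.sum_congr rfl fun i _ => by rw [map_smul, smul_eq_mul, mul_comm]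

/-- Membership in the tangent plane, in terms of the squared length of the projection. -/
lemma mem_tangentPlane_iff_gramTrace {x : M} (hi : Function.Injective (surfDer (k := k) F x))
    (b : Amb n) : b ∈ tangentPlane (k := k) F x ↔
      gramTrace (surfDer (k := k) F x)
        (fun i j => ⟪b, surfDer F x (bv i)⟫ * ⟪b, surfDer F x (bv j)⟫) = ⟪b, b⟫ := by
  rw [mem_tangentPlane_iff]
  constructor
  · rintro ⟨v, rfl⟩
    exact gramTrace_inner_mul_inner_self _ hi v _
  · intro h
    refine ⟨tanCoord (surfDer (k := k) F x) b, ?_⟩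
    have h1 : ⟪b, surfDer F x (tanCoord (surfDer (k := k) F x) b)⟫ = ⟪b, b⟫ := by
      rw [← h, gramTrace_mul_inner, inner_clm_eq_sum]
      exact Finset.sum_congr rfl fun i _ => mul_comm _ _
    have h2 := inner_map_tanCoord _ hi b (tanCoord (surfDer (k := k) F x) b)
    rw [← sub_eq_zero, ← inner_self_eq_zero (𝕜 := ℝ), inner_sub_left, inner_sub_right,
      inner_sub_right, h2, real_inner_comm b, h1]
    ring

end Divergence

end SphereBall

end

noncomputable section

namespace SphereBall

/-! ### The area bound and first consequences of the divergence theorem -/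

section Limits

open MeasureTheory Filter Asymptotics

variable {n k : ℕ} [NeZero k] {M : Type*} [TopologicalSpace M]
  [ChartedSpace (EuclideanHalfSpace k) M] [IsManifold (𝓡∂ k) ∞ M]
  {F X : M → Amb n} {p q : Amb n} {c R : ℝ}

lemma radialCutoff_nonneg {ε : ℝ} {z : Amb n} : 0 ≤ radialCutoff q ε z := cutoff_nonneg _

lemma radialCutoff_le_one {ε : ℝ} {z : Amb n} : radialCutoff q ε z ≤ 1 := cutoff_le_one _

lemma radialCutoff_of_le {ε : ℝ} {z : Amb n} (hε : 0 < ε) (h : ε ≤ ‖z - q‖) :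
    radialCutoff q ε z = 1 := by
  refine cutoff_of_ge ?_
  rw [le_div_iff₀ (by positivity), one_mul]
  gcongr

lemma eventually_radialCutoff_eq_one {z : Amb n} (hz : z ≠ q) :
    ∀ᶠ ε in 𝓝[>] (0 : ℝ), radialCutoff q ε z = 1 := by
  filter_upwards [Ioo_mem_nhdsGT (norm_pos_iff.mpr (sub_ne_zero.mpr hz))] with ε hε
  exact radialCutoff_of_le hε.1 hε.2.le

variable [MeasurableSpace M] [BorelSpace M]

lemma areaMeasure_singleton [T1Space M] (hF : ContMDiff (𝓡∂ k) 𝓘(ℝ, Amb n) ∞ F) (x : M) :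
    areaMeasure k F {x} = 0 := by
  rw [areaMeasure_apply_of_subset (chart_mem_atlas (EuclideanHalfSpace k) x) hF
    (measurableSet_singleton x) (by simp)]
  refine setLIntegral_measure_zero _ _ (measure_mono_null (t := {extChartAt (𝓡∂ k) x x}) ?_ ?_)
  · rintro a ⟨ha, hax⟩
    have hax : (extChartAt (𝓡∂ k) x).symm a = x := hax
    have := (extChartAt (𝓡∂ k) x).right_inv ha
    rw [hax] at this
    exact this.symm
  · exact measure_singleton _

/-- An isolated point would be an open set of area zero. -/
lemma nhdsNE_neBot [T1Space M] (hF : ContMDiff (𝓡∂ k) 𝓘(ℝ, Amb n) ∞ F)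
    (hi : ∀ x, Function.Injective (surfDer (k := k) F x)) (x : M) : (𝓝[≠] x).NeBot := by
  rw [neBot_iff]
  intro h
  have h1 : IsOpen ({x} : Set M) := isOpen_singleton_iff_nhds_eq_pure x |>.mpr (by
    rw [← nhdsNE_sup_pure, h, bot_sup_eq])
  exact (areaMeasure_pos_of_isOpen hF hi h1 (Set.singleton_nonempty x)).ne'
    (areaMeasure_singleton hF x)

variable [T2Space M] [CompactSpace M]

lemma tendsto_integral_radialCutoff (hF : ContMDiff (𝓡∂ k) 𝓘(ℝ, Amb n) ∞ F)
    (hi : ∀ x, Function.Injective (surfDer (k := k) F x)) (q : Amb n) :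
    Tendsto (fun ε : ℝ => ∫ x, radialCutoff q ε (F x) ∂(areaMeasure k F)) (𝓝[>] 0)
      (𝓝 (area k F).toReal) := by
  have := isFiniteMeasure_areaMeasure hF
  have h1 : (area k F).toReal = ∫ _, (1 : ℝ) ∂(areaMeasure k F) := by
    rw [integral_const, smul_eq_mul, mul_one]; rfl
  rw [h1]
  refine tendsto_integral_filter_of_dominated_convergence (fun _ => 1)
    (Eventually.of_forall fun ε =>
      (contDiff_radialCutoff.continuous.comp hF.continuous).aestronglyMeasurable)
    (Eventually.of_forall fun ε => Eventually.of_forall fun x => ?_) (integrable_const _) ?_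
  · rw [Real.norm_of_nonneg radialCutoff_nonneg]; exact radialCutoff_le_one
  · have hfin := finite_fiber (hF.of_le (by exact_mod_cast le_top)) hi q
    have hnull : areaMeasure k F (F ⁻¹' {q}) = 0 := by
      rw [← Set.biUnion_of_singleton (F ⁻¹' {q}), measure_biUnion_null_iff hfin.countable]
      exact fun x _ => areaMeasure_singleton hF x
    filter_upwards [measure_eq_zero_iff_ae_notMem.mp hnull] with x hx
    exact tendsto_const_nhds.congr' ((eventually_radialCutoff_eq_one hx).mono fun ε h => h.symm)

/-- A positive value of `g` persists on an open set away from `q`, which has positive area and on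
which the cutoff is eventually `1`. This bounds the integrals below by a fixed positive number. -/
lemma eq_zero_of_tendsto_integral_radialCutoff_mul (hF : ContMDiff (𝓡∂ k) 𝓘(ℝ, Amb n) ∞ F)
    (hi : ∀ x, Function.Injective (surfDer (k := k) F x)) {g : M → ℝ}
    (hg0 : ∀ x, F x ≠ q → 0 ≤ g x) (hg : ∀ x, F x ≠ q → ContinuousAt g x)
    (hlim : Tendsto (fun ε : ℝ => ∫ x, radialCutoff q ε (F x) * g x ∂(areaMeasure k F)) (𝓝[>] 0)
      (𝓝 0)) : ∀ x, F x ≠ q → g x = 0 := by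
  have := isFiniteMeasure_areaMeasure hF
  intro x hx
  by_contra hne
  have hpos : 0 < g x := lt_of_le_of_ne (hg0 x hx) (Ne.symm hne)
  have hd : 0 < ‖F x - q‖ := norm_pos_iff.mpr (sub_ne_zero.mpr hx)
  set δ := ‖F x - q‖ / 2
  have hδ : 0 < δ := half_pos hd
  have hU : ∀ᶠ x' in 𝓝 x, g x / 2 < g x' ∧ δ < ‖F x' - q‖ :=
    ((hg x hx).eventually_const_lt (half_lt_self hpos)).and
      ((hF.continuous.sub continuous_const).norm.continuousAt.eventually_const_lt (half_lt_self hd))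
  obtain ⟨U, hUs, hUo, hxU⟩ := eventually_nhds_iff.mp hU
  have hm := areaMeasure_pos_of_isOpen hF hi hUo ⟨x, hxU⟩
  have hm' : 0 < (areaMeasure k F).real U := ENNReal.toReal_pos hm.ne' (measure_ne_top _ _)
  have hlow : ∀ᶠ ε in 𝓝[>] (0 : ℝ), (areaMeasure k F).real U * (g x / 2) ≤
      ∫ x, radialCutoff q ε (F x) * g x ∂(areaMeasure k F) := by
    filter_upwards [Ioo_mem_nhdsGT hδ] with ε hε
    rw [← smul_eq_mul, ← setIntegral_const, ← integral_indicator hUo.measurableSet]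
    refine integral_mono ((integrable_const _).indicator hUo.measurableSet)
      ((continuous_radialCutoff_mul hF.continuous hg ε).integrable_of_hasCompactSupport
        (HasCompactSupport.of_compactSpace _)) fun x' => ?_
    dsimp only
    by_cases hx' : x' ∈ U
    · rw [Set.indicator_of_mem hx', radialCutoff_of_le hε.1 (hε.2.le.trans (hUs x' hx').2.le),
        one_mul]
      exact (hUs x' hx').1.le
    · rw [Set.indicator_of_notMem hx']
      by_cases hq : F x' = q
      · rw [hq, radialCutoff_eventually_zero.self_of_nhds, zero_mul]
      · exact mul_nonneg radialCutoff_nonneg (hg0 x' hq)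
  have h1 := ge_of_tendsto hlim hlow
  have h2 : 0 < (areaMeasure k F).real U * (g x / 2) := by positivity
  linarith

/-- A field with divergence at most `1` and a singularity at `q` bounds the area from below. -/
theorem le_area_of_surfDiv_le_one (hF : IsMinimalOrthogonal k p c F) {β : ℝ} (hβ : 0 ≤ β)
    (hq : ∃ x, F x = q)
    (hX : ∀ x, F x ≠ q → ContMDiffAt (𝓡∂ k) 𝓘(ℝ, Amb n) 1 X x)
    (hXF : ∀ x, F x ≠ q → ⟪X x, F x⟫ = 0)
    (hXb : ∀ x ∈ (𝓡∂ k).boundary M, F x ≠ q → ⟪X x, p⟫ = 0)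
    (hXq : ∀ x₀, F x₀ = q → (fun x => X x + (2 * β * ‖F x - q‖ ^ (-(k : ℤ))) • (F x - q))
      =o[𝓝[≠] x₀] fun x => ‖F x - q‖ ^ (1 - (k : ℤ)))
    (hdiv : ∀ x, F x ≠ q → surfDiv (k := k) F X x ≤ 1) :
    sphereArea k * β ≤ (area k F).toReal ∧ ((area k F).toReal = sphereArea k * β →
      ∀ x, F x ≠ q → surfDiv (k := k) F X x = 1) := by
  have := isFiniteMeasure_areaMeasure hF.smooth
  have h1 := tendsto_integral_radialCutoff_mul_surfDiv hF hX hXF hXb hXq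
  have h2 := tendsto_integral_radialCutoff hF.smooth hF.injective q
  have hdc : ∀ x, F x ≠ q → ContinuousAt (surfDiv (k := k) F X) x := fun x hx =>
    continuousAt_surfDiv hF.smooth (hF.injective x)
      ((hF.smooth.continuous.continuousAt.eventually_ne hx).mono fun y hy => hX y hy)
  have hint : ∀ {f : M → ℝ}, Continuous f → Integrable f (areaMeasure k F) := fun {f} hf =>
    hf.integrable_of_hasCompactSupport (HasCompactSupport.of_compactSpace f)
  have hi1 : ∀ ε : ℝ, Integrable (fun x => radialCutoff q ε (F x)) (areaMeasure k F) := fun ε =>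
    hint (contDiff_radialCutoff.continuous.comp hF.smooth.continuous)
  have hi2 : ∀ ε : ℝ, Integrable (fun x => radialCutoff q ε (F x) * surfDiv (k := k) F X x)
    (areaMeasure k F) := fun ε => hint (continuous_radialCutoff_mul hF.smooth.continuous hdc ε)
  have hle := le_of_tendsto_of_tendsto' h1 h2 fun ε => integral_mono (hi2 ε) (hi1 ε) fun x => by
    dsimp only
    by_cases hx : F x = q
    · rw [hx, radialCutoff_eventually_zero.self_of_nhds, zero_mul]
    · exact mul_le_of_le_one_right radialCutoff_nonneg (hdiv x hx)
  -- The worst case is a single boundary point over `q`; its weight `1/2` absorbs the `2` in the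
  -- strength `2 β` of the singularity. Interior points over `q` need not be excluded, as they only
  -- increase the flux.
  have hsum : 1 / 2 ≤ ∑ x ∈ (finite_fiber hF.smooth_one hF.injective q).toFinset,
      pointWeight k x := by
    obtain ⟨x, hx⟩ := hq
    refine (half_le_pointWeight (k := k) x).trans
      (Finset.single_le_sum (f := fun x => pointWeight k x)
        (fun y _ => le_trans (by norm_num) (half_le_pointWeight (k := k) y)) ?_)
    simpa using hx
  have hlow : sphereArea k * β ≤ 2 * β * sphereArea k *
      ∑ x ∈ (finite_fiber hF.smooth_one hF.injective q).toFinset, pointWeight k x := by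
    have := mul_le_mul_of_nonneg_left hsum
      (mul_nonneg (mul_nonneg zero_le_two hβ) (sphereArea_pos (k := k)).le)
    linarith
  refine ⟨hlow.trans hle, fun heq x hx => ?_⟩
  -- Equality of the outer terms makes the limit of `∫ div X` equal to the area, so the integral of
  -- the nonnegative defect `1 - div X` tends to zero.
  have hL := le_antisymm hle (heq.trans_le hlow)
  have h3 : Tendsto (fun ε : ℝ => ∫ x, radialCutoff q ε (F x) * (1 - surfDiv (k := k) F X x)
      ∂(areaMeasure k F)) (𝓝[>] 0) (𝓝 0) := by
    have := h2.sub h1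
    rw [hL, sub_self] at this
    refine this.congr fun ε => ?_
    rw [← integral_sub (hi1 ε) (hi2 ε)]
    congr 1; ext x; ring
  have := eq_zero_of_tendsto_integral_radialCutoff_mul hF.smooth hF.injective
    (fun x hx => sub_nonneg.mpr (hdiv x hx)) (fun x hx => continuousAt_const.sub (hdc x hx)) h3 x hx
  linarith

/-- If the level `c` is avoided, there is no boundary, and `⟪p, F⟫ > c ≥ 0` everywhere. The radial
field then has negative divergence with integral zero, which is impossible. -/
lemma exists_inner_eq [Nonempty M] (hF : IsMinimalOrthogonal k p c F) (hc : 0 ≤ c)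
    (hball : ∀ x, c ≤ ⟪p, F x⟫) : ∃ x, ⟪p, F x⟫ = c := by
  by_contra hcon
  push Not at hcon
  have := isFiniteMeasure_areaMeasure hF.smooth
  have hu : ∀ x, 0 < ⟪p, F x⟫ := fun x => hc.trans_lt (lt_of_le_of_ne (hball x) (hcon x).symm)
  have hX : ContMDiff (𝓡∂ k) 𝓘(ℝ, Amb n) 1 fun x => (1 : ℝ) • (p - ⟪p, F x⟫ • F x) := by
    have h1 : ContDiff ℝ 1 fun z : Amb n => (1 : ℝ) • (p - ⟪p, z⟫ • z) :=
      (contDiff_const (c := (1 : ℝ))).smul (contDiff_const.sub ((innerSL ℝ p).contDiff.smul contDiff_id))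
    exact h1.contMDiff.comp hF.smooth_one
  have h1 := integral_surfDiv_eq_zero hF hX (fun x => by
    rw [one_smul, inner_sub_left, real_inner_smul_left, real_inner_self_eq_norm_sq, hF.norm_eq]
    ring) fun x hx => absurd (hF.boundary_inner x hx) (hcon x)
  have h2 : ∀ x, surfDiv (k := k) F (fun x => (1 : ℝ) • (p - ⟪p, F x⟫ • F x)) x =
      -(k * ⟪p, F x⟫) := fun x => by
    have := surfDiv_smul_radial_eq (p := p) hF.smooth_one hF.norm_eq (hF.injective x)
      (hasFDerivAt_const (1 : ℝ) (F x))
    rw [this]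
    simp [gramTrace]
  simp_rw [h2] at h1
  rw [integral_neg, neg_eq_zero] at h1
  have hk : (0 : ℝ) < k := Nat.cast_pos.mpr (NeZero.pos k)
  have hpos : ∀ x, 0 < k * ⟪p, F x⟫ := fun x => mul_pos hk (hu x)
  have hcont : Continuous fun x => k * ⟪p, F x⟫ :=
    continuous_const.mul (continuous_const.inner hF.smooth.continuous)
  have h3 := (integral_pos_iff_support_of_nonneg (μ := areaMeasure k F) (fun x => (hpos x).le)
    (hcont.integrable_of_hasCompactSupport (HasCompactSupport.of_compactSpace _))).mpr (by
      rw [Function.support_eq_univ (fun x => (hpos x).ne')]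
      exact areaMeasure_pos_of_isOpen hF.smooth hF.injective isOpen_univ Set.univ_nonempty)
  exact h3.ne' h1

/-- Tangency of `∇ d_p` extends from the complement of a fiber to the whole surface. -/
lemma mem_tangentPlane_of_ne (hF : IsMinimalOrthogonal k p c F) {y : Amb n}
    (h : ∀ x, F x ≠ y → p - ⟪p, F x⟫ • F x ∈ tangentPlane (k := k) F x) (x : M) :
    p - ⟪p, F x⟫ • F x ∈ tangentPlane (k := k) F x := by
  by_cases hx : F x = y
  swap
  · exact h x hx
  have hX : ContMDiff (𝓡∂ k) 𝓘(ℝ, Amb n) 1 fun x => ⟪p, F x⟫ • (p - ⟪p, F x⟫ • F x) := by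
    have h1 : ContDiff ℝ 1 fun z : Amb n => ⟪p, z⟫ • (p - ⟪p, z⟫ • z) :=
      (innerSL ℝ p).contDiff.smul (contDiff_const.sub ((innerSL ℝ p).contDiff.smul contDiff_id))
    exact h1.contMDiff.comp hF.smooth_one
  -- The squared length of the tangential part of the radial vector is expressed by the divergence
  -- of a field of class `C¹`. Tangency thus becomes the vanishing of a continuous function.
  have key : ∀ x, p - ⟪p, F x⟫ • F x ∈ tangentPlane (k := k) F x ↔
      surfDiv (k := k) F (fun x => ⟪p, F x⟫ • (p - ⟪p, F x⟫ • F x)) x +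
        k * ⟪p, F x⟫ * ⟪p, F x⟫ - ⟪p - ⟪p, F x⟫ • F x, p - ⟪p, F x⟫ • F x⟫ = 0 := fun x => by
    rw [mem_tangentPlane_iff_gramTrace (hF.injective x), surfDiv_smul_radial_eq (p := p)
      (H := fun z => ⟪p, z⟫) hF.smooth_one hF.norm_eq (hF.injective x) (innerSL ℝ p).hasFDerivAt,
      sub_add_cancel, sub_eq_zero]
    refine Eq.congr_left (congrArg _ ?_)
    ext i j
    have h7 : ⟪F x, surfDer F x (bv i)⟫ = 0 :=
      inner_surfDer_self hF.smooth_one hF.norm_eq x (bv i)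
    rw [inner_sub_left, real_inner_smul_left, h7, mul_zero, sub_zero, innerSL_apply_apply]
  have hcont : Continuous fun x =>
      surfDiv (k := k) F (fun x => ⟪p, F x⟫ • (p - ⟪p, F x⟫ • F x)) x +
        k * ⟪p, F x⟫ * ⟪p, F x⟫ - ⟪p - ⟪p, F x⟫ • F x, p - ⟪p, F x⟫ • F x⟫ := by
    have h1 := continuous_surfDiv hF hX
    have h2 := hF.smooth.continuous
    fun_prop
  rw [key]
  -- The point is not isolated and nearby points avoid the fiber over `y`, so the vanishing passes
  -- to the limit.
  have hne := nhdsNE_neBot hF.smooth hF.injective x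
  refine tendsto_nhds_unique (hcont.continuousAt.mono_left nhdsWithin_le_nhds)
    (tendsto_const_nhds.congr' ?_) (l := 𝓝[≠] x)
  filter_upwards [eventually_ne_of_injective hF.smooth_one (hF.injective x)] with x' hx'
  exact ((key x').mp (h x' (by rwa [hx] at hx'))).symm

end Limits

end SphereBall

end

noncomputable section

namespace SphereBall

/-! ### The radial field of divergence one -/

section Profile

open Filter

variable {k : ℕ} {R u : ℝ}

lemma hasDerivAt_radialInt (r : ℝ) : HasDerivAt (radialInt k) (Real.sin r ^ (k - 1)) r :=
  ((by fun_prop : Continuous fun s => Real.sin s ^ (k - 1)).integral_hasStrictDerivAt 0 r).hasDerivAt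

lemma contDiff_radialInt : ContDiff ℝ 1 (radialInt k) := by
  rw [contDiff_one_iff_deriv]
  refine ⟨fun r => (hasDerivAt_radialInt r).differentiableAt, ?_⟩
  rw [show deriv (radialInt k) = fun r => Real.sin r ^ (k - 1) from
    funext fun r => (hasDerivAt_radialInt r).deriv]
  fun_prop

/-- The coefficient of the radial field of divergence `1` that vanishes at distance `R`, as a
function of the cosine of the distance. -/
def profile (k : ℕ) (R u : ℝ) : ℝ :=
  (radialInt k R - radialInt k (Real.arccos u)) * ((√(1 - u ^ 2))⁻¹) ^ k

lemma profile_cos (h0 : 0 ≤ R) (h : R ≤ Real.pi) : profile k R (Real.cos R) = 0 := by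
  rw [profile, Real.arccos_cos h0 h, sub_self, zero_mul]

lemma contDiffAt_profile (hu : u ^ 2 < 1) : ContDiffAt ℝ 1 (profile k R) u := by
  have h1 : u ≠ -1 := by rintro rfl; norm_num at hu
  have h2 : u ≠ 1 := by rintro rfl; norm_num at hu
  have h3 : (0 : ℝ) < 1 - u ^ 2 := by linarith
  have h4 : ContDiffAt ℝ 1 (fun u : ℝ => √(1 - u ^ 2)) u :=
    (by fun_prop : ContDiffAt ℝ 1 (fun u : ℝ => 1 - u ^ 2) u).sqrt h3.ne'
  exact (contDiffAt_const.sub (contDiff_radialInt.contDiffAt.comp u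
    (Real.contDiffAt_arccos h1 h2))).mul ((h4.inv (Real.sqrt_pos.mpr h3).ne').pow k)

/-- For `u = ⟪p, F⟫` the radial vector has squared length `1 - u²`, so by `surfDiv_smul_radial` this
equation says that the field with coefficient `profile` has divergence `1` wherever the radial
vector is tangent. -/
lemma deriv_profile [NeZero k] (hu : u ^ 2 < 1) :
    deriv (profile k R) u * (1 - u ^ 2) - k * u * profile k R u = 1 := by
  obtain ⟨m, rfl⟩ := Nat.exists_eq_succ_of_ne_zero (NeZero.ne k)
  have h1 : u ≠ -1 := by rintro rfl; norm_num at hu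
  have h2 : u ≠ 1 := by rintro rfl; norm_num at hu
  have h3 : (0 : ℝ) < 1 - u ^ 2 := by linarith
  have hw : 0 < √(1 - u ^ 2) := Real.sqrt_pos.mpr h3
  have h4 : HasDerivAt (fun u : ℝ => √(1 - u ^ 2)) (-u / √(1 - u ^ 2)) u := by
    have := ((hasDerivAt_pow 2 u).const_sub 1).sqrt h3.ne'
    refine this.congr_deriv ?_
    field_simp
    simp
  have h5 := (((hasDerivAt_radialInt (k := m + 1) (Real.arccos u)).comp u
    (Real.hasDerivAt_arccos h1 h2)).const_sub (radialInt (m + 1) R)).mul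
      ((h4.inv hw.ne').pow (m + 1))
  have h6 : deriv (profile (m + 1) R) u = _ := h5.deriv
  rw [h6, profile, Real.sin_arccos]
  simp only [Function.comp_apply, Nat.add_sub_cancel, Pi.inv_apply, Pi.pow_apply,
    Nat.succ_eq_add_one, inv_pow]
  have hsq : √(1 - u ^ 2) ^ 2 = 1 - u ^ 2 := Real.sq_sqrt h3.le
  generalize √(1 - u ^ 2) = w at *
  rw [← hsq]
  push_cast
  field_simp
  ring

/-- At chordal distance `s` from `p` one has `u = 1 - s² / 2` and `√(1 - u²) = s √(1 - s² / 4)`. The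
singularity at `p` thus has strength `I(R)`. -/
lemma tendsto_profile :
    Tendsto (fun s : ℝ => s ^ k * profile k R (1 - s ^ 2 / 2)) (𝓝[>] 0) (𝓝 (radialInt k R)) := by
  have h0 : radialInt k 0 = 0 := intervalIntegral.integral_same
  have h1 : Tendsto (fun s : ℝ => (radialInt k R - radialInt k (Real.arccos (1 - s ^ 2 / 2))) *
      ((√(1 - s ^ 2 / 4))⁻¹) ^ k) (𝓝 0)
      (𝓝 ((radialInt k R - radialInt k (Real.arccos (1 - 0 ^ 2 / 2))) *
        ((√(1 - 0 ^ 2 / 4))⁻¹) ^ k)) := by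
    refine Tendsto.mul ?_ (Tendsto.pow (Tendsto.inv₀ ?_ (by norm_num)) k)
    · have : Continuous fun s : ℝ => radialInt k R - radialInt k (Real.arccos (1 - s ^ 2 / 2)) :=
        continuous_const.sub (contDiff_radialInt.continuous.comp
          (Real.continuous_arccos.comp (by fun_prop)))
      exact this.tendsto 0
    · exact Continuous.tendsto (by fun_prop) 0
  norm_num [h0] at h1
  refine (h1.mono_left nhdsWithin_le_nhds).congr' ?_
  filter_upwards [self_mem_nhdsWithin] with s hs
  have hs : 0 < s := hs
  rw [profile, show 1 - (1 - s ^ 2 / 2) ^ 2 = s ^ 2 * (1 - s ^ 2 / 4) by ring,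
    Real.sqrt_mul (by positivity), Real.sqrt_sq hs.le, mul_inv, mul_pow, inv_pow s, mul_left_comm,
    mul_inv_cancel_left₀ (pow_pos hs k).ne', inv_pow]

end Profile

/-! ### Surfaces tangent to the radial direction -/

section RadialFields

open MeasureTheory Filter Asymptotics

variable {n k : ℕ} [NeZero k] {M : Type*} [TopologicalSpace M]
  [ChartedSpace (EuclideanHalfSpace k) M] [IsManifold (𝓡∂ k) ∞ M]
  {F : M → Amb n} {p : Amb n} {c R β : ℝ}

lemma tendsto_nhdsNE_of_injective (hF : ContMDiff (𝓡∂ k) 𝓘(ℝ, Amb n) 1 F) {x₀ : M} {q : Amb n}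
    (hi : Function.Injective (surfDer (k := k) F x₀)) (hq : F x₀ = q) :
    Tendsto F (𝓝[≠] x₀) (𝓝[≠] q) := by
  subst hq
  exact tendsto_nhdsWithin_iff.mpr ⟨hF.continuous.continuousAt.mono_left nhdsWithin_le_nhds,
    eventually_ne_of_injective hF hi⟩

/-- The first order term of `⟪a, F⟫` at `x₀` vanishes, and distances in the chart are bounded by
distances in the image. -/
lemma isLittleO_inner_of_orthogonal (hF : ContMDiff (𝓡∂ k) 𝓘(ℝ, Amb n) 1 F) {x₀ : M}
    (hi : Function.Injective (surfDer (k := k) F x₀)) {a : Amb n}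
    (ha : ∀ v, ⟪a, surfDer (k := k) F x₀ v⟫ = 0) :
    (fun x => ⟪a, F x - F x₀⟫) =o[𝓝 x₀] fun x => ‖F x - F x₀‖ := by
  have h1 := hasFDerivWithinAt_locDer (chart_mem_atlas (EuclideanHalfSpace k) x₀)
    (mem_extChartAt_target (I := 𝓡∂ k) x₀) (X := F) (hF _)
  have hder : locDer (chartAt (EuclideanHalfSpace k) x₀) F (extChartAt (𝓡∂ k) x₀ x₀) =
    surfDer F x₀ := (surfDer_eq_locDer (hF x₀)).symm
  obtain ⟨m, hm, h3⟩ := eventually_lower_bound h1 (by rwa [hder])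
  have h4 : Tendsto (extChartAt (𝓡∂ k) x₀) (𝓝 x₀) (𝓝[halfSp k] (extChartAt (𝓡∂ k) x₀ x₀)) :=
    tendsto_nhdsWithin_iff.mpr ⟨continuousAt_extChartAt x₀, Eventually.of_forall fun x => ⟨_, rfl⟩⟩
  have h5 := h1.isLittleO.comp_tendsto h4
  have hinv : (extChartAt (𝓡∂ k) x₀).symm (extChartAt (𝓡∂ k) x₀ x₀) = x₀ := extChartAt_to_inv x₀
  have hO : (fun x => extChartAt (𝓡∂ k) x₀ x - extChartAt (𝓡∂ k) x₀ x₀) =O[𝓝 x₀]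
      fun x => ‖F x - F x₀‖ := by
    refine IsBigO.of_bound m⁻¹ ?_
    filter_upwards [h4 h3, extChartAt_source_mem_nhds (I := 𝓡∂ k) x₀] with x hx hxs
    have h5 : m * ‖extChartAt (𝓡∂ k) x₀ x - extChartAt (𝓡∂ k) x₀ x₀‖ ≤
      ‖F ((extChartAt (𝓡∂ k) x₀).symm (extChartAt (𝓡∂ k) x₀ x)) -
        F ((extChartAt (𝓡∂ k) x₀).symm (extChartAt (𝓡∂ k) x₀ x₀))‖ := hx
    rw [(extChartAt (𝓡∂ k) x₀).left_inv hxs, hinv] at h5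
    rw [norm_norm, ← div_eq_inv_mul, le_div_iff₀ hm, mul_comm]
    exact h5
  have h6 := ((innerSL ℝ a).isBigO_comp _ (𝓝 x₀)).trans_isLittleO (h5.trans_isBigO hO)
  refine h6.congr' ?_ EventuallyEq.rfl
  filter_upwards [extChartAt_source_mem_nhds (I := 𝓡∂ k) x₀] with x hxs
  change ⟪a, F ((extChartAt (𝓡∂ k) x₀).symm (extChartAt (𝓡∂ k) x₀ x)) -
        F ((extChartAt (𝓡∂ k) x₀).symm (extChartAt (𝓡∂ k) x₀ x₀)) - locDer _ F
          (extChartAt (𝓡∂ k) x₀ x₀) _⟫ = _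
  rw [hder, inner_sub_right, ha, sub_zero, (extChartAt (𝓡∂ k) x₀).left_inv hxs, hinv]

variable [T2Space M] [CompactSpace M] [MeasurableSpace M] [BorelSpace M]

/-- The flux of a field that is a multiple of `p - ⟪p, F⟫ F`. -/
lemma tendsto_integral_radial (hF : IsMinimalOrthogonal k p c F)
    {H : Amb n → ℝ} (hH : ∀ x, F x ≠ p → ContDiffAt ℝ 1 H (F x))
    (hHb : ∀ x ∈ (𝓡∂ k).boundary M, H (F x) = 0)
    (hHp : ∀ x₀, F x₀ = p → Tendsto (fun x => ‖F x - p‖ ^ k * H (F x)) (𝓝[≠] x₀) (𝓝 β)) :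
    Tendsto (fun ε : ℝ => ∫ x, radialCutoff p ε (F x) *
        surfDiv (k := k) F (fun x => H (F x) • (p - ⟪p, F x⟫ • F x)) x ∂(areaMeasure k F))
      (𝓝[>] 0) (𝓝 (β * sphereArea k *
        (finite_fiber hF.smooth_one hF.injective p).toFinset.card)) := by
  have h1 := tendsto_integral_radialCutoff_mul_surfDiv (q := p) (β := β)
    (X := fun x => H (F x) • (p - ⟪p, F x⟫ • F x)) hF
    (fun x hx => by
      have h2 : ContDiffAt ℝ 1 (fun z : Amb n => H z • (p - ⟪p, z⟫ • z)) (F x) :=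
        (hH x hx).smul (contDiff_const.sub ((innerSL ℝ p).contDiff.smul contDiff_id)).contDiffAt
      exact h2.contMDiffAt.comp x (hF.smooth_one x))
    (fun x _ => by
      rw [real_inner_smul_left, inner_sub_left, real_inner_smul_left, real_inner_self_eq_norm_sq,
        hF.norm_eq]
      ring)
    (fun x hb _ => by rw [hHb x hb, zero_smul, inner_zero_left])
    (fun x₀ hx₀ => isLittleO_smul_sub hF.norm_p
      (tendsto_nhdsNE_of_injective hF.smooth_one (hF.injective x₀) hx₀)
      (Eventually.of_forall hF.norm_eq) (hHp x₀ hx₀))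
  -- All points over `p` are interior points, because `⟪p, F⟫ = c` on the boundary and `c² < 1`.
  have h2 : ∑ x ∈ (finite_fiber hF.smooth_one hF.injective p).toFinset, pointWeight k x =
      (finite_fiber hF.smooth_one hF.injective p).toFinset.card := by
    rw [Finset.cast_card]
    refine Finset.sum_congr rfl fun x hx => pointWeight_of_notMem_boundary fun hb => ?_
    have hx : F x = p := by simpa using hx
    have h3 := hF.boundary_inner x hb
    rw [hx, real_inner_self_eq_norm_sq, hF.norm_p] at h3
    have := hF.sq_lt
    rw [← h3] at this
    norm_num at this
  rwa [h2] at h1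

lemma tendsto_pow_mul_profile (hF : IsMinimalOrthogonal k p c F) {x₀ : M} (hx₀ : F x₀ = p) :
    Tendsto (fun x => ‖F x - p‖ ^ k * profile k R ⟪p, F x⟫) (𝓝[≠] x₀) (𝓝 (radialInt k R)) := by
  have h1 := tendsto_nhdsNE_of_injective hF.smooth_one (hF.injective x₀) hx₀
  have h2 : Tendsto (fun x => ‖F x - p‖) (𝓝[≠] x₀) (𝓝[>] 0) := by
    refine tendsto_nhdsWithin_iff.mpr ⟨?_, ?_⟩
    · simpa using ((tendsto_nhdsWithin_iff.mp h1).1.sub_const p).norm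
    · exact (tendsto_nhdsWithin_iff.mp h1).2.mono fun x hx =>
        norm_pos_iff.mpr (sub_ne_zero.mpr hx)
  refine (tendsto_profile.comp h2).congr fun x => ?_
  rw [Function.comp_apply, inner_eq_norm_sub hF.norm_p (hF.norm_eq x)]

lemma inner_sq_lt_one (hF : IsMinimalOrthogonal k p c F) (hc : 0 ≤ c)
    (hball : ∀ x, c ≤ ⟪p, F x⟫) {x : M} (hx : F x ≠ p) : ⟪p, F x⟫ ^ 2 < 1 := by
  have h1 := inner_lt_one_of_ne hF.norm_p (hF.norm_eq x) hx
  have h2 := hc.trans (hball x)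
  nlinarith

/-- If `∇ d_p` is tangent to the surface, the area is a multiple of the area of the geodesic
ball. -/
lemma area_eq_card_mul (hR0 : 0 < R) (hR : R ≤ Real.pi / 2)
    (hF : IsMinimalOrthogonal k p (Real.cos R) F) (hball : ∀ x, Real.cos R ≤ ⟪p, F x⟫)
    (hT : ∀ x, p - ⟪p, F x⟫ • F x ∈ tangentPlane (k := k) F x) :
    (area k F).toReal = radialInt k R * sphereArea k *
      (finite_fiber hF.smooth_one hF.injective p).toFinset.card := by
  have hc : 0 ≤ Real.cos R := Real.cos_nonneg_of_mem_Icc ⟨by linarith, hR⟩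
  -- The profile vanishes at `cos R`, so nothing is lost at the boundary, and the flux over `p` is
  -- the integral of the constant `1`.
  have h1 := tendsto_integral_radial (H := fun z => profile k R ⟪p, z⟫) (β := radialInt k R) hF
    (fun x hx => (contDiffAt_profile (inner_sq_lt_one hF hc hball hx)).comp (F x)
      (innerSL ℝ p).contDiff.contDiffAt)
    (fun x hb => by rw [hF.boundary_inner x hb, profile_cos hR0.le (by linarith)])
    (fun x₀ hx₀ => tendsto_pow_mul_profile hF hx₀)
  refine tendsto_nhds_unique (tendsto_integral_radialCutoff hF.smooth hF.injective p)
    (h1.congr fun ε => ?_)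
  congr 1
  ext x
  by_cases hx : F x = p
  · rw [hx, radialCutoff_eventually_zero.self_of_nhds, zero_mul]
  · have hu := inner_sq_lt_one hF hc hball hx
    have hd : HasFDerivAt (fun z : Amb n => profile k R ⟪p, z⟫)
        (deriv (profile k R) ⟪p, F x⟫ • innerSL ℝ p) (F x) :=
      ((contDiffAt_profile hu).differentiableAt one_ne_zero).hasDerivAt.comp_hasFDerivAt (F x)
        (innerSL ℝ p).hasFDerivAt
    rw [surfDiv_smul_radial hF.smooth_one hF.norm_eq (hF.injective x) hd (hT x)]
    have h2 : ⟪p, p - ⟪p, F x⟫ • F x⟫ = 1 - ⟪p, F x⟫ ^ 2 := by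
      rw [inner_sub_right, real_inner_smul_right, real_inner_self_eq_norm_sq, hF.norm_p]; ring
    rw [smul_apply, innerSL_apply_apply, h2, smul_eq_mul, deriv_profile hu,
      mul_one]

/-- If `∇ d_p` is tangent to the surface and `x₀` is the only point over `p`, the surface lies in
the linear span of `p` and the tangent plane at `x₀`. -/
lemma inner_eq_zero_of_orthogonal (hR0 : 0 < R) (hR : R ≤ Real.pi / 2)
    (hF : IsMinimalOrthogonal k p (Real.cos R) F) (hball : ∀ x, Real.cos R ≤ ⟪p, F x⟫)
    (hT : ∀ x, p - ⟪p, F x⟫ • F x ∈ tangentPlane (k := k) F x) {x₀ : M}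
    (hx₀ : ∀ x, F x = p → x = x₀) {a : Amb n} (hap : ⟪a, p⟫ = 0)
    (ha : ∀ v, ⟪a, surfDer (k := k) F x₀ v⟫ = 0) (x : M) : ⟪a, F x⟫ = 0 := by
  have hc : 0 ≤ Real.cos R := Real.cos_nonneg_of_mem_Icc ⟨by linarith, hR⟩
  have hcd : ∀ x, F x ≠ p →
      ContDiffAt ℝ 1 (fun z : Amb n => ⟪a, z⟫ ^ 2 * (1 - ⟪p, z⟫ ^ 2)⁻¹) (F x) := fun x hx => by
    have hu := inner_sq_lt_one hF hc hball hx
    exact ((innerSL ℝ a).contDiff.contDiffAt.pow 2).mul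
      ((contDiffAt_const.sub ((innerSL ℝ p).contDiff.contDiffAt.pow 2)).inv
        (sub_pos.mpr hu).ne')
  -- The factor `⟪a, F⟫² / (1 - ⟪p, F⟫²)` depends only on the direction in which the point is seen
  -- from `p`. It tends to `0` at `x₀`, as `⟪a, F⟫` is of smaller order than the distance from `p`,
  -- so the product has strength `0`.
  have h1 := tendsto_integral_radial (β := 0)
    (H := fun z => (⟪a, z⟫ ^ 2 * (1 - ⟪p, z⟫ ^ 2)⁻¹) * profile k R ⟪p, z⟫) hF
    (fun x hx => (hcd x hx).mul
      ((contDiffAt_profile (inner_sq_lt_one hF hc hball hx)).comp (F x)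
        (innerSL ℝ p).contDiff.contDiffAt))
    (fun x hb => by
      rw [hF.boundary_inner x hb, profile_cos hR0.le (by linarith), mul_zero])
    (fun x₁ hx₁ => by
      obtain rfl := hx₀ x₁ hx₁
      have h2 := isLittleO_inner_of_orthogonal hF.smooth_one (hF.injective x₁) ha
      have h3 : Tendsto (fun x => ⟪a, F x - p⟫ / ‖F x - p‖) (𝓝[≠] x₁) (𝓝 0) := by
        rw [hx₁] at h2
        exact h2.tendsto_div_nhds_zero.mono_left nhdsWithin_le_nhds
      have hs : Tendsto (fun x => ‖F x - p‖) (𝓝[≠] x₁) (𝓝 0) := by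
        have h4 := tendsto_nhdsNE_of_injective hF.smooth_one (hF.injective x₁) hx₁
        simpa using ((tendsto_nhdsWithin_iff.mp h4).1.sub_const p).norm
      have h5 : Tendsto (fun x => (1 - ‖F x - p‖ ^ 2 / 4)⁻¹) (𝓝[≠] x₁) (𝓝 1) := by
        have := (((hs.pow 2).div_const 4).const_sub 1).inv₀ (by norm_num)
        simpa using this
      have h6 := ((h3.pow 2).mul h5).mul (tendsto_pow_mul_profile (R := R) hF hx₁)
      norm_num at h6
      refine h6.congr' ?_
      filter_upwards [eventually_ne_of_injective hF.smooth_one (hF.injective x₁)] with x hx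
      rw [hx₁] at hx
      have hs0 : ‖F x - p‖ ≠ 0 := norm_ne_zero_iff.mpr (sub_ne_zero.mpr hx)
      rw [one_sub_inner_sq hF.norm_p (hF.norm_eq x), inner_sub_right, hap, sub_zero]
      field_simp)
  rw [zero_mul, zero_mul] at h1
  have hzero := eq_zero_of_tendsto_integral_radialCutoff_mul (q := p)
    (g := fun x => ⟪a, F x⟫ ^ 2 * (1 - ⟪p, F x⟫ ^ 2)⁻¹) hF.smooth hF.injective
    (fun x hx => mul_nonneg (sq_nonneg _)
      (inv_nonneg.mpr (sub_pos.mpr (inner_sq_lt_one hF hc hball hx)).le))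
    (fun x hx => (hcd x hx).continuousAt.comp hF.smooth.continuous.continuousAt)
    (h1.congr fun ε => by
      congr 1
      ext x
      by_cases hx : F x = p
      · rw [hx, radialCutoff_eventually_zero.self_of_nhds, zero_mul, zero_mul]
      congr 1
      have hu := inner_sq_lt_one hF hc hball hx
      have hd : HasFDerivAt (fun z : Amb n => profile k R ⟪p, z⟫)
          (deriv (profile k R) ⟪p, F x⟫ • innerSL ℝ p) (F x) :=
        ((contDiffAt_profile hu).differentiableAt one_ne_zero).hasDerivAt.comp_hasFDerivAt (F x)
          (innerSL ℝ p).hasFDerivAt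
      have hw : (1 - ⟪p, F x⟫ ^ 2) ≠ 0 := (sub_pos.mpr hu).ne'
      have hf : HasFDerivAt (fun z : Amb n => ⟪a, z⟫ ^ 2 * (1 - ⟪p, z⟫ ^ 2)⁻¹)
          ((2 * ⟪a, F x⟫ * (1 - ⟪p, F x⟫ ^ 2)⁻¹) • innerSL ℝ a +
            (⟪a, F x⟫ ^ 2 * (2 * ⟪p, F x⟫) * ((1 - ⟪p, F x⟫ ^ 2)⁻¹) ^ 2) • innerSL ℝ p) (F x) := by
        have e1 := ((hasDerivAt_pow 2 ⟪a, F x⟫).comp_hasFDerivAt (F x)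
          (innerSL ℝ a).hasFDerivAt)
        have e2 := (((hasDerivAt_pow 2 ⟪p, F x⟫).const_sub 1).inv hw).comp_hasFDerivAt (F x)
          (innerSL ℝ p).hasFDerivAt
        refine (e1.mul e2).congr_fderiv ?_
        ext v
        simp
        ring
      refine (surfDiv_smul_radial
        (H := fun z => (⟪a, z⟫ ^ 2 * (1 - ⟪p, z⟫ ^ 2)⁻¹) * profile k R ⟪p, z⟫)
        hF.smooth_one hF.norm_eq (hF.injective x) (hf.mul hd) (hT x)).trans ?_
      -- In the radial direction the two terms of the derivative of the factor cancel. What remains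
      -- is the factor times the divergence of the profile field, which is `1`.
      have h2 : ⟪p, p - ⟪p, F x⟫ • F x⟫ = 1 - ⟪p, F x⟫ ^ 2 := by
        rw [inner_sub_right, real_inner_smul_right, real_inner_self_eq_norm_sq, hF.norm_p]; ring
      have h3 : ⟪a, p - ⟪p, F x⟫ • F x⟫ = -(⟪p, F x⟫ * ⟪a, F x⟫) := by
        rw [inner_sub_right, real_inner_smul_right, hap]; ring
      have h4 := deriv_profile (k := k) (R := R) hu
      simp only [add_apply, smul_apply,
        innerSL_apply_apply, h2, h3, smul_eq_mul]
      generalize ⟪p, F x⟫ = u at *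
      field_simp
      linear_combination (⟪a, F x⟫ ^ 2) * h4)
  by_cases hx : F x = p
  · rw [hx, hap]
  · have h2 := (mul_eq_zero.mp (hzero x hx)).resolve_right
      (inv_ne_zero (sub_pos.mpr (inner_sq_lt_one hF hc hball hx)).ne')
    exact pow_eq_zero_iff two_ne_zero |>.mp h2

end RadialFields

end SphereBall

end

noncomputable section

namespace SphereBall

/-! ### Local homeomorphisms from a compact space over a convex set -/

section Topology

open Filter

variable {M V : Type*} [TopologicalSpace M] [T2Space M] [CompactSpace M]
  [NormedAddCommGroup V] [NormedSpace ℝ V] {g : M → V} {D : Set V}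

lemma isOpen_image_inter (ho : ∀ x, g x ∈ D → 𝓝 (g x) ≤ map g (𝓝 x)) (hg : Continuous g)
    (hD : IsOpen D) {U : Set M} (hU : IsOpen U) : IsOpen (g '' (U ∩ g ⁻¹' D)) := by
  rw [isOpen_iff_mem_nhds]
  rintro _ ⟨x, hx, rfl⟩
  refine ho x hx.2 ?_
  rw [mem_map]
  exact mem_of_superset ((hU.inter (hD.preimage hg)).mem_nhds hx) (Set.subset_preimage_image g _)

/-- A local homeomorphism over a preconnected set, from a compact space, covers this set. -/
lemma subset_range_of_local_homeo (hg : Continuous g) (hD : IsOpen D) (hDc : IsPreconnected D)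
    (ho : ∀ x, g x ∈ D → 𝓝 (g x) ≤ map g (𝓝 x)) (hne : ∃ x, g x ∈ D) : D ⊆ Set.range g := by
  have h1 : IsOpen (g '' (Set.univ ∩ g ⁻¹' D)) := isOpen_image_inter ho hg hD isOpen_univ
  have h2 : IsOpen (Set.range g)ᶜ := (isCompact_range hg).isClosed.isOpen_compl
  -- The image over `D` is open and the range is closed, so a missed point would disconnect `D`.
  by_contra hcon
  obtain ⟨w, hw, hwr⟩ := Set.not_subset.mp hcon
  obtain ⟨x, hx⟩ := hne
  obtain ⟨w', -, ⟨x', -, rfl⟩, hw'⟩ := hDc _ _ h1 h2 (fun w hw => by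
    by_cases h : w ∈ Set.range g
    · obtain ⟨x, rfl⟩ := h
      exact Or.inl ⟨x, ⟨trivial, hw⟩, rfl⟩
    · exact Or.inr h) ⟨g x, hx, x, ⟨trivial, hx⟩, rfl⟩ ⟨w, hw, hwr⟩
  exact hw' ⟨x', rfl⟩

/-- A local homeomorphism over a preconnected set, from a compact space, is injective over this set
as soon as one of its fibers over the set is a singleton. -/
lemma injOn_of_local_homeo (hg : Continuous g) (hD : IsOpen D) (hDc : IsPreconnected D)
    (ho : ∀ x, g x ∈ D → 𝓝 (g x) ≤ map g (𝓝 x))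
    (hinj : ∀ x, g x ∈ D → ∃ U ∈ 𝓝 x, Set.InjOn g U) {w₀ : V} (hw₀ : w₀ ∈ D)
    (huniq : ∀ x x', g x = w₀ → g x' = w₀ → x = x') : Set.InjOn g (g ⁻¹' D) := by
  choose! U hU hUinj using hinj
  -- `W` is a neighborhood of the part of the diagonal over `D` without distinct pairs of equal
  -- image. Its removal turns the double points over `D` into part of a compact set, so that the
  -- values taken only once form an open set.
  set W : Set (M × M) := ⋃ x ∈ g ⁻¹' D, interior (U x) ×ˢ interior (U x)
  have hW : IsOpen W := isOpen_biUnion fun x _ => isOpen_interior.prod isOpen_interior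
  set C : Set (M × M) := {P | g P.1 = g P.2} ∩ Wᶜ
  have hC : IsCompact C := ((isClosed_eq (hg.comp continuous_fst) (hg.comp continuous_snd)).inter
    hW.isClosed_compl).isCompact
  have hCc : IsOpen ((g ∘ Prod.fst) '' C)ᶜ :=
    (hC.image (hg.comp continuous_fst)).isClosed.isOpen_compl
  have hCiff : ∀ x x', g x ∈ D → g x = g x' → x ≠ x' → (x, x') ∈ C := by
    intro x x' _ heq hne
    refine ⟨heq, fun hmem => ?_⟩
    obtain ⟨y, hy, h1, h2⟩ := Set.mem_iUnion₂.mp hmem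
    exact hne (hUinj y hy (interior_subset h1) (interior_subset h2) heq)
  have hCne : ∀ P ∈ C, g P.1 ∈ D → P.1 ≠ P.2 := by
    rintro ⟨x, x'⟩ ⟨_, hnW⟩ hxD (h : x = x')
    subst h
    exact hnW (Set.mem_iUnion₂.mpr ⟨x, hxD, mem_interior_iff_mem_nhds.mpr (hU x hxD),
      mem_interior_iff_mem_nhds.mpr (hU x hxD)⟩)
  set E : Set V := {w | w ∈ D ∧ ∃ x x', x ≠ x' ∧ g x = w ∧ g x' = w}
  have hE : IsOpen E := by
    rw [isOpen_iff_mem_nhds]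
    rintro w ⟨hw, x, x', hne, hx, hx'⟩
    obtain ⟨A, B, hA, hB, hxA, hxB, hAB⟩ := t2_separation hne
    have h1 := (isOpen_image_inter ho hg hD hA).mem_nhds
      ⟨x, ⟨hxA, by rwa [Set.mem_preimage, hx]⟩, hx⟩
    have h2 := (isOpen_image_inter ho hg hD hB).mem_nhds
      ⟨x', ⟨hxB, by rwa [Set.mem_preimage, hx']⟩, hx'⟩
    filter_upwards [h1, h2, hD.mem_nhds hw]
    rintro v ⟨a, ha, hav⟩ ⟨b, hb, hbv⟩ hv
    exact ⟨hv, a, b, fun hab => Set.disjoint_left.mp hAB ha.1 (hab ▸ hb.1), hav, hbv⟩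
  -- The values in `D` taken at least twice form the open set `E`, and those outside the image of
  -- `C` are open too. As `w₀` is taken at most once, connectedness of `D` excludes any double
  -- value.
  intro x hx x' hx' heq
  by_contra hne
  obtain ⟨w, hwD, ⟨_, y, y', hyne, hy, hy'⟩, hwC⟩ := hDc _ _ hE hCc (fun w hw => by
    by_cases h : w ∈ (g ∘ Prod.fst) '' C
    · obtain ⟨P, hP, rfl⟩ := h
      exact Or.inl ⟨hw, P.1, P.2, hCne P hP hw, rfl, hP.1.symm⟩
    · exact Or.inr h) ⟨g x, hx, hx, x, x', hne, rfl, heq.symm⟩ ⟨w₀, hw₀, by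
      rintro ⟨P, hP, hPw⟩
      have hPw : g P.1 = w₀ := hPw
      exact hCne P hP (by rw [hPw]; exact hw₀)
        (huniq _ _ hPw (by rw [← hPw]; exact hP.1.symm))⟩
  exact hwC ⟨(y, y'), hCiff y y' (by rw [hy]; exact hwD) (hy.trans hy'.symm) hyne, hy⟩

/-- A map of a compact space to the closure of an open convex set `D` that is a local homeomorphism
over `D`, with a singleton fiber over a point of `D`, with finite fibers and with the preimage of
`D` dense, is bijective. -/
lemma injective_of_local_homeo (hg : Continuous g) (hD : IsOpen D) (hDc : Convex ℝ D)
    (ho : ∀ x, g x ∈ D → 𝓝 (g x) ≤ map g (𝓝 x))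
    (hinj : ∀ x, g x ∈ D → ∃ U ∈ 𝓝 x, Set.InjOn g U) {w₀ : V} (hw₀ : w₀ ∈ D)
    (huniq : ∀ x x', g x = w₀ → g x' = w₀ → x = x')
    (hfin : ∀ w, (g ⁻¹' {w}).Finite) (hdense : Dense (g ⁻¹' D)) : Function.Injective g := by
  have hinjOn := injOn_of_local_homeo hg hD hDc.isPreconnected ho hinj hw₀ huniq
  intro x x' heq
  by_contra hne
  have hsep : SeparatedNhds ({x} : Set M) (g ⁻¹' {g x} \ {x}) :=
    SeparatedNhds.of_isCompact_isCompact isCompact_singleton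
      ((hfin (g x)).subset Set.sdiff_subset).isCompact (by simp)
  obtain ⟨A, B, hA, hB, hxA, hxB, hAB⟩ := hsep
  have hxA : x ∈ A := hxA rfl
  have hx'B : x' ∈ B := hxB ⟨heq.symm, fun h => hne h.symm⟩
  -- `A` and `B` together contain the fiber, so by compactness they contain the preimage of a small
  -- ball.
  have hδ : ∃ δ > 0, ∀ y, ‖g y - g x‖ < δ → y ∈ A ∪ B := by
    obtain ⟨δ, hδ, h⟩ := (hA.union hB).isClosed_compl.isCompact.exists_forall_le'
      (f := fun y => ‖g y - g x‖) (a := 0) (hg.sub continuous_const).norm.continuousOn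
      fun y hy => by
        refine norm_pos_iff.mpr (sub_ne_zero.mpr fun hyx => hy ?_)
        by_cases hyx' : y = x
        · exact Or.inl (hyx' ▸ hxA)
        · exact Or.inr (hxB ⟨hyx, hyx'⟩)
    exact ⟨δ, hδ, fun y hy => by
      by_contra hcon
      exact absurd (h y hcon) (not_le.mpr hy)⟩
  obtain ⟨δ, hδ, hcov⟩ := hδ
  have hmeet : ∀ (O : Set M) (y : M), IsOpen O → y ∈ O → g y = g x →
      ((D ∩ Metric.ball (g x) δ) ∩ g '' (O ∩ g ⁻¹' D)).Nonempty := by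
    intro O y hO hy hyx
    have h1 : IsOpen (O ∩ g ⁻¹' Metric.ball (g x) δ) := hO.inter (Metric.isOpen_ball.preimage hg)
    obtain ⟨z, hz, hzD⟩ := hdense.inter_open_nonempty _ h1
      ⟨y, hy, by rw [Set.mem_preimage, hyx]; exact Metric.mem_ball_self hδ⟩
    exact ⟨g z, ⟨hzD, hz.2⟩, z, ⟨hz.1, hzD⟩, rfl⟩
  have hrange := subset_range_of_local_homeo hg hD hDc.isPreconnected ho
    (hdense.nonempty_iff.mpr ⟨x⟩)
  -- Convexity makes the part of `D` in the ball connected. The open images of `A` and `B` cover it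
  -- and both meet it, by density, so they overlap; this contradicts injectivity over `D`.
  obtain ⟨w, -, ⟨a, ha, haw⟩, b, hb, hbw⟩ := (hDc.inter (convex_ball (g x) δ)).isPreconnected _ _
    (isOpen_image_inter ho hg hD hA) (isOpen_image_inter ho hg hD hB) (by
      rintro w ⟨hwD, hwb⟩
      obtain ⟨y, rfl⟩ := hrange hwD
      rcases hcov y (by rwa [mem_ball_iff_norm] at hwb) with hy | hy
      · exact Or.inl ⟨y, ⟨hy, hwD⟩, rfl⟩
      · exact Or.inr ⟨y, ⟨hy, hwD⟩, rfl⟩)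
    (hmeet A x hA hxA rfl) (hmeet B x' hB hx'B heq.symm)
  exact Set.disjoint_left.mp hAB ha.1 (hinjOn ha.2 hb.2 (haw.trans hbw.symm) ▸ hb.1)

end Topology

end SphereBall

end

noncomputable section

namespace SphereBall

/-! ### Identification of the surface with a totally geodesic ball -/

section Rigidity

open Filter MeasureTheory

variable {n k : ℕ} [NeZero k] {M : Type*} [TopologicalSpace M]
  [ChartedSpace (EuclideanHalfSpace k) M] [IsManifold (𝓡∂ k) ∞ M]
  {F : M → Amb n} {p : Amb n} {c R : ℝ}

/-- The inverse function theorem at an interior point of the manifold. -/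
lemma local_homeo_of_injective (hF : ContMDiff (𝓡∂ k) 𝓘(ℝ, Amb n) 1 F) (B : Amb n →L[ℝ] Dom k)
    {x : M} (hx : x ∉ (𝓡∂ k).boundary M)
    (hi : Function.Injective (B.comp (surfDer (k := k) F x))) :
    𝓝 (B (F x)) ≤ map (fun y => B (F y)) (𝓝 x) ∧
      ∃ U ∈ 𝓝 x, Set.InjOn (fun y => B (F y)) U := by
  set z₀ : Dom k := extChartAt (𝓡∂ k) x x
  have hz₀ : halfSp k ∈ 𝓝 z₀ := by
    have h0 : z₀ 0 ≠ 0 := fun h => by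
      have := boundary_of_mem_target (chart_mem_atlas (EuclideanHalfSpace k) x)
        (mem_extChartAt_target (I := 𝓡∂ k) x) h
      exact hx (by rwa [show ((chartAt (EuclideanHalfSpace k) x).extend (𝓡∂ k)).symm
        (extChartAt (𝓡∂ k) x x) = x from extChartAt_to_inv x] at this)
    rw [← mem_interior_iff_mem_nhds, interior_halfSp]
    exact lt_of_le_of_ne (mem_halfSp.mp ⟨_, rfl⟩) h0.symm
  have hBF : ContMDiff (𝓡∂ k) 𝓘(ℝ, Dom k) 1 (B ∘ F) := B.contDiff.contMDiff.comp hF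
  set Φ : Dom k → Dom k := (B ∘ F) ∘ (extChartAt (𝓡∂ k) x).symm
  have hΦ : ContDiffAt ℝ 1 Φ z₀ :=
    (contDiffWithinAt_comp_extChartAt_symm (by exact_mod_cast le_top) (hBF x)).contDiffAt hz₀
  have hder : fderiv ℝ Φ z₀ = B.comp (surfDer (k := k) F x) := by
    rw [← surfDer_comp hF B.hasFDerivAt, surfDer_eq (hBF x)]
    exact (fderivWithin_of_mem_nhds hz₀).symm
  set E : Dom k ≃L[ℝ] Dom k :=
    (LinearEquiv.ofInjectiveEndo (B.comp (surfDer (k := k) F x)).toLinearMap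
      hi).toContinuousLinearEquiv
  have hE : (E : Dom k →L[ℝ] Dom k) = B.comp (surfDer (k := k) F x) := by
    ext v : 1; rfl
  have hstrict : HasStrictFDerivAt Φ (E : Dom k →L[ℝ] Dom k) z₀ := by
    rw [hE, ← hder]; exact hΦ.hasStrictFDerivAt one_ne_zero
  have hΦe : ∀ y ∈ (extChartAt (𝓡∂ k) x).source, Φ (extChartAt (𝓡∂ k) x y) = B (F y) :=
    fun y hy => by
      simp only [Φ, Function.comp_apply]
      rw [(extChartAt (𝓡∂ k) x).left_inv hy]
  have hmap : map (extChartAt (𝓡∂ k) x) (𝓝 x) = 𝓝 z₀ := by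
    rw [map_extChartAt_nhds, nhdsWithin_eq_nhds.mpr hz₀]
  have hsrc := extChartAt_source_mem_nhds (I := 𝓡∂ k) x
  constructor
  · have h1 : map (fun y => B (F y)) (𝓝 x) = map (Φ ∘ extChartAt (𝓡∂ k) x) (𝓝 x) :=
      map_congr (mem_of_superset hsrc fun y hy => (hΦe y hy).symm)
    rw [h1, ← map_map, hmap, hstrict.map_nhds_eq_of_equiv, hΦe x (mem_extChartAt_source x)]
  · set S := (hstrict.toOpenPartialHomeomorph Φ).source
    have hS : S ∈ 𝓝 z₀ := (hstrict.toOpenPartialHomeomorph Φ).open_source.mem_nhds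
      hstrict.mem_toOpenPartialHomeomorph_source
    refine ⟨(extChartAt (𝓡∂ k) x).source ∩ extChartAt (𝓡∂ k) x ⁻¹' S,
      inter_mem hsrc ((continuousAt_extChartAt x) hS), ?_⟩
    intro y hy y' hy' heq
    have h1 : Φ (extChartAt (𝓡∂ k) x y) = Φ (extChartAt (𝓡∂ k) x y') := by
      rw [hΦe y hy.1, hΦe y' hy'.1]; exact heq
    exact (extChartAt (𝓡∂ k) x).injOn hy.1 hy'.1
      ((hstrict.toOpenPartialHomeomorph Φ).injOn hy.2 hy'.2 h1)

/-- The coordinates of the orthogonal projection to the range of `A`, as a linear map. -/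
def tanCoordL (A : Dom k →L[ℝ] Amb n) : Amb n →L[ℝ] Dom k :=
  LinearMap.toContinuousLinearMap
    { toFun := tanCoord A
      map_add' := fun b b' => by
        ext i
        simp [tanCoord_apply, inner_add_left, mul_add, Finset.sum_add_distrib]
      map_smul' := fun t b => by
        ext i
        simp [tanCoord_apply, real_inner_smul_left, Finset.mul_sum, mul_left_comm] }

lemma tanCoordL_apply (A : Dom k →L[ℝ] Amb n) (b : Amb n) : tanCoordL A b = tanCoord A b := rfl

variable [T2Space M] [CompactSpace M] [MeasurableSpace M] [BorelSpace M]

/-- The surface lies in the span `L` of `p` and the tangent plane at `x₀`. Since `⟪p, F⟫ ≥ 0`, a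
point of it is determined by its projection to that plane, so it is enough to study this projection,
a map between spaces of dimension `k`. -/
theorem injective_and_range_eq (hR0 : 0 < R) (hR : R ≤ Real.pi / 2)
    (hF : IsMinimalOrthogonal k p (Real.cos R) F) (hball : ∀ x, Real.cos R ≤ ⟪p, F x⟫)
    (hT : ∀ x, p - ⟪p, F x⟫ • F x ∈ tangentPlane (k := k) F x) {x₀ : M} (hp : F x₀ = p)
    (hx₀ : ∀ x, F x = p → x = x₀) :
    Function.Injective F ∧ ∃ L : Submodule ℝ (Amb n), Module.finrank ℝ L = k + 1 ∧ p ∈ L ∧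
      Set.range F = (L : Set (Amb n)) ∩ geodBall p R := by
  have hc : 0 ≤ Real.cos R := Real.cos_nonneg_of_mem_Icc ⟨by linarith, hR⟩
  have hr : 0 < Real.sin R := Real.sin_pos_of_pos_of_lt_pi hR0 (by linarith)
  have hrc := Real.sin_sq_add_cos_sq R
  set A : Dom k →L[ℝ] Amb n := surfDer F x₀
  have hA : Function.Injective A := hF.injective x₀
  have hpA : ∀ v, ⟪p, A v⟫ = 0 := fun v => by
    rw [← hp]; exact inner_surfDer_self hF.smooth_one hF.norm_eq x₀ v
  have hpp : ⟪p, p⟫ = 1 := by rw [real_inner_self_eq_norm_sq, hF.norm_p, one_pow]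
  set B := tanCoordL A
  have hBA : ∀ v, B (A v) = v := fun v => tanCoord_map A hA v
  have hBp : B p = 0 := by
    ext i
    rw [tanCoordL_apply, tanCoord_apply]
    simp [hpA]
  set L : Submodule ℝ (Amb n) := Submodule.span ℝ {p} ⊔ A.toLinearMap.range
  have hpL : p ∈ L := Submodule.mem_sup_left (Submodule.mem_span_singleton_self p)
  have hdecomp : ∀ z ∈ L, z = ⟪p, z⟫ • p + A (B z) := by
    intro z hz
    obtain ⟨y, hy, w, ⟨v, rfl⟩, rfl⟩ := Submodule.mem_sup.mp hz
    obtain ⟨t, rfl⟩ := Submodule.mem_span_singleton.mp hy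
    change t • p + A v = ⟪p, t • p + A v⟫ • p + A (B (t • p + A v))
    rw [inner_add_right, real_inner_smul_right, hpp, hpA, map_add, map_smul, hBp, hBA]
    simp
  have hnorm : ∀ z ∈ L, ‖z‖ ^ 2 = ⟪p, z⟫ ^ 2 + ‖A (B z)‖ ^ 2 := by
    intro z hz
    have h1 := hdecomp z hz
    have h2 : ‖⟪p, z⟫ • p + A (B z)‖ ^ 2 = ⟪p, z⟫ ^ 2 + ‖A (B z)‖ ^ 2 := by
      rw [norm_add_sq_real, real_inner_smul_left, hpA, norm_smul, hF.norm_p, mul_one,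
        Real.norm_eq_abs, sq_abs]
      ring
    rwa [← h1] at h2
  have hLperp : ∀ z, (∀ a, ⟪a, p⟫ = 0 → (∀ v, ⟪a, A v⟫ = 0) → ⟪a, z⟫ = 0) → z ∈ L := by
    intro z hz
    rw [← Submodule.orthogonal_orthogonal L, Submodule.mem_orthogonal]
    intro a ha
    rw [Submodule.mem_orthogonal] at ha
    refine hz a ?_ fun v => ?_
    · rw [real_inner_comm]; exact ha p hpL
    · rw [real_inner_comm]; exact ha _ (Submodule.mem_sup_right ⟨v, rfl⟩)
  have hFa : ∀ a, ⟪a, p⟫ = 0 → (∀ v, ⟪a, A v⟫ = 0) → ∀ x, ⟪a, F x⟫ = 0 := fun a hap ha x =>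
    inner_eq_zero_of_orthogonal hR0 hR hF hball hT hx₀ hap ha x
  have hFL : ∀ x, F x ∈ L := fun x => hLperp _ fun a hap ha => hFa a hap ha x
  have hdL : ∀ x v, surfDer (k := k) F x v ∈ L := fun x v => hLperp _ fun a hap ha => by
    have h1 := surfDer_comp (k := k) hF.smooth_one (innerSL ℝ a).hasFDerivAt (x := x)
    have h2 : (innerSL ℝ a) ∘ F = fun _ => 0 := funext fun x => hFa a hap ha x
    have h3 : surfDer (k := k) (fun _ : M => (0 : ℝ)) x = 0 := by
      rw [surfDer, mfderiv_const]; rfl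
    rw [h2, h3] at h1
    exact (congrArg (fun T : Dom k →L[ℝ] ℝ => T v) h1).symm
  have heq : ∀ z ∈ L, ∀ z' ∈ L, ‖z‖ = 1 → ‖z'‖ = 1 → 0 ≤ ⟪p, z⟫ → 0 ≤ ⟪p, z'⟫ → B z = B z' →
      z = z' := by
    intro z hz z' hz' h1 h1' h0 h0' hB
    have h2 := hnorm z hz
    have h3 := hnorm z' hz'
    rw [h1, hB] at h2
    rw [h1'] at h3
    have h4 : ⟪p, z⟫ = ⟪p, z'⟫ := (sq_eq_sq₀ h0 h0').mp (by linarith)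
    rw [hdecomp z hz, hdecomp z' hz', hB, h4]
  set g : M → Dom k := fun x => B (F x)
  have hgF : ∀ x x', g x = g x' → F x = F x' := fun x x' h =>
    heq _ (hFL x) _ (hFL x') (hF.norm_eq x) (hF.norm_eq x') (hc.trans (hball x))
      (hc.trans (hball x')) h
  -- For unit vectors `z` of `L` with `⟪p, z⟫ ≥ 0`, the squares of `⟪p, z⟫` and `‖A (B z)‖` add up
  -- to `1`; hence `D` corresponds to the open geodesic ball `cos R < ⟪p, z⟫`.
  set D : Set (Dom k) := A ⁻¹' Metric.ball 0 (Real.sin R)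
  have hD : IsOpen D := Metric.isOpen_ball.preimage A.continuous
  have hDc : Convex ℝ D := (convex_ball 0 _).linear_preimage A.toLinearMap
  have hgD : ∀ x, g x ∈ D ↔ Real.cos R < ⟪p, F x⟫ := fun x => by
    have h1 := hnorm _ (hFL x)
    rw [hF.norm_eq x] at h1
    rw [Set.mem_preimage, mem_ball_zero_iff, ← sq_lt_sq₀ (norm_nonneg _) hr.le,
      ← sq_lt_sq₀ hc (hc.trans (hball x))]
    constructor <;> intro h <;> linarith
  have hg : Continuous g := B.continuous.comp hF.smooth.continuous
  have hlocal : ∀ x, g x ∈ D → 𝓝 (g x) ≤ map g (𝓝 x) ∧ ∃ U ∈ 𝓝 x, Set.InjOn g U := by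
    intro x hx
    have hu := (hgD x).mp hx
    refine local_homeo_of_injective hF.smooth_one B
      (fun hb => hu.ne' (hF.boundary_inner x hb)) ?_
    -- A tangent vector in the kernel is a multiple of `p`. It is also orthogonal to `F x`, whose
    -- product with `p` is positive, so it is zero.
    refine (injective_iff_map_eq_zero _).mpr fun v hv => ?_
    have hv : B (surfDer (k := k) F x v) = 0 := hv
    have h1 := hdecomp _ (hdL x v)
    rw [hv, map_zero, add_zero] at h1
    have h2 : ⟪F x, surfDer (k := k) F x v⟫ = 0 :=
      inner_surfDer_self hF.smooth_one hF.norm_eq x v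
    rw [h1, real_inner_smul_right, real_inner_comm p (F x)] at h2
    have h3 := (mul_eq_zero.mp h2).resolve_right (hc.trans_lt hu).ne'
    rw [h3, zero_smul] at h1
    exact hF.injective x (h1.trans (map_zero _).symm)
  have h0D : (0 : Dom k) ∈ D := by
    rw [Set.mem_preimage, map_zero]; exact Metric.mem_ball_self hr
  have hg0 : ∀ x, g x = 0 → x = x₀ := fun x hx => hx₀ x (by
    rw [← hp]; exact hgF x x₀ (hx.trans (by simp only [g]; rw [hp, hBp])))
  -- On an open set mapped into the level `cos R` the differential of `⟪p, F⟫` would vanish, whereas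
  -- its value on the tangential radial vector is `sin² R > 0`.
  have hdense : Dense (g ⁻¹' D) := by
    rw [dense_iff_inter_open]
    rintro O hO ⟨x, hx⟩
    by_contra hcon
    have h1 : ∀ y ∈ O, ⟪p, F y⟫ = Real.cos R := fun y hy => by
      by_contra hne
      exact hcon ⟨y, hy, (hgD y).mpr (lt_of_le_of_ne (hball y) (Ne.symm hne))⟩
    have h2 := surfDer_comp (k := k) hF.smooth_one (innerSL ℝ p).hasFDerivAt (x := x)
    have h3 : surfDer (k := k) ((innerSL ℝ p) ∘ F) x = 0 := by
      have h4 : ((innerSL ℝ p) ∘ F) =ᶠ[𝓝 x] fun _ => Real.cos R :=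
        mem_of_superset (hO.mem_nhds hx) fun y hy => h1 y hy
      rw [surfDer, h4.mfderiv_eq, mfderiv_const]; rfl
    obtain ⟨v, hv⟩ := (mem_tangentPlane_iff F x _).mp (hT x)
    have h5 : ⟪p, surfDer (k := k) F x v⟫ = 0 := by
      rw [h3] at h2
      exact (congrArg (fun T : Dom k →L[ℝ] ℝ => T v) h2).symm
    rw [hv, inner_sub_right, real_inner_smul_right, hpp, h1 x hx] at h5
    nlinarith
  have hfin : ∀ w, (g ⁻¹' {w}).Finite := fun w => by
    rcases (g ⁻¹' {w}).eq_empty_or_nonempty with h | ⟨x, hx⟩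
    · rw [h]; exact Set.finite_empty
    · refine (finite_fiber hF.smooth_one hF.injective (F x)).subset fun y hy => ?_
      exact hgF y x (Eq.trans hy (Eq.symm hx))
  have hginj : Function.Injective g := injective_of_local_homeo hg hD hDc
    (fun x hx => (hlocal x hx).1) (fun x hx => (hlocal x hx).2) h0D
    (fun x x' h h' => (hg0 x h).trans (hg0 x' h').symm) hfin hdense
  have hrange := subset_range_of_local_homeo hg hD hDc.isPreconnected
    (fun x hx => (hlocal x hx).1) ⟨x₀, (hgD x₀).mpr (by rw [hp, hpp]; nlinarith)⟩
  refine ⟨fun x x' h => hginj (congrArg B h), L, ?_, hpL, ?_⟩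
  · have h1 := Submodule.finrank_sup_add_finrank_inf_eq (Submodule.span ℝ {p}) A.toLinearMap.range
    have h2 : Submodule.span ℝ {p} ⊓ A.toLinearMap.range = ⊥ := by
      rw [eq_bot_iff]
      rintro z ⟨hz, v, rfl⟩
      obtain ⟨t, ht⟩ := Submodule.mem_span_singleton.mp hz
      have ht : t • p = A v := ht
      have h3 := hpA v
      rw [← ht, real_inner_smul_right, hpp, mul_one] at h3
      rw [h3, zero_smul] at ht
      exact ht.symm
    have hp0 : p ≠ 0 := by
      rintro rfl
      have := hF.norm_p
      simp at this
    rw [h2, finrank_bot, finrank_span_singleton hp0, LinearMap.finrank_range_of_inj hA,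
      finrank_euclideanSpace_fin] at h1
    exact h1.trans (add_comm 1 k)
  · ext z
    constructor
    · rintro ⟨x, rfl⟩
      exact ⟨hFL x, (mem_geodBall_iff hF.norm_p hR0.le (by linarith)).mpr
        ⟨hF.norm_eq x, hball x⟩⟩
    · rintro ⟨hzL, hzB⟩
      obtain ⟨hz1, hzc⟩ := (mem_geodBall_iff hF.norm_p hR0.le (by linarith)).mp hzB
      have h1 := hnorm z hzL
      rw [hz1] at h1
      have h2 : ‖A (B z)‖ ≤ Real.sin R := by
        rw [← sq_le_sq₀ (norm_nonneg _) hr.le]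
        nlinarith
      -- A point of the closed ellipsoid is the limit of its multiples by factors `t < 1`. The range
      -- of `g` is closed and contains `D`, hence also its closure.
      have h3 : B z ∈ closure D := by
        have h4 : Tendsto (fun t : ℝ => t • B z) (𝓝[<] 1) (𝓝 (B z)) := by
          have : Tendsto (fun t : ℝ => t • B z) (𝓝 1) (𝓝 ((1 : ℝ) • B z)) :=
            Continuous.tendsto (by fun_prop) 1
          rw [one_smul] at this
          exact this.mono_left nhdsWithin_le_nhds
        refine mem_closure_of_tendsto h4 ?_
        filter_upwards [Ioo_mem_nhdsLT (zero_lt_one' ℝ)] with t ht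
        rw [Set.mem_preimage, mem_ball_zero_iff, map_smul, norm_smul,
          Real.norm_of_nonneg ht.1.le]
        calc t * ‖A (B z)‖ ≤ t * Real.sin R := mul_le_mul_of_nonneg_left h2 ht.1.le
          _ < Real.sin R := by nlinarith [ht.2]
      obtain ⟨x, hx⟩ := (isCompact_range hg).isClosed.closure_subset_iff.mpr hrange h3
      exact ⟨x, heq _ (hFL x) _ hzL (hF.norm_eq x) hz1 (hc.trans (hball x)) (hc.trans hzc) hx⟩

end Rigidity

end SphereBall

end

noncomputable section

namespace SphereBall

/-! ### From the free boundary condition to its linear form -/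

section FreeBoundary

variable {n k : ℕ} [NeZero k] {M : Type*} [TopologicalSpace M]
  [ChartedSpace (EuclideanHalfSpace k) M] [IsManifold (𝓡∂ k) ∞ M]
  {F : M → Amb n} {p : Amb n} {R : ℝ}

lemma radialInt_pos (hR0 : 0 < R) (hR : R ≤ Real.pi / 2) : 0 < radialInt k R := by
  refine intervalIntegral.intervalIntegral_pos_of_pos_on
    ((by fun_prop : Continuous fun s => Real.sin s ^ (k - 1)).intervalIntegrable _ _) ?_ hR0
  intro s hs
  exact pow_pos (Real.sin_pos_of_pos_of_lt_pi hs.1 (by linarith [hs.2, Real.pi_pos])) _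

lemma cos_sq_lt_one (hR0 : 0 < R) (hR : R ≤ Real.pi / 2) : Real.cos R ^ 2 < 1 := by
  have h1 := Real.sin_pos_of_pos_of_lt_pi hR0 (by linarith [Real.pi_pos])
  have h2 := Real.sin_sq_add_cos_sq R
  nlinarith

lemma IsFreeBoundaryMinimal.isMinimalOrthogonal (hR0 : 0 < R) (hR : R ≤ Real.pi / 2)
    (hp : ‖p‖ = 1) (hF : IsFreeBoundaryMinimal k p R F) :
    IsMinimalOrthogonal k p (Real.cos R) F := by
  have hb : ∀ x ∈ (𝓡∂ k).boundary M, ⟪p, F x⟫ = Real.cos R := fun x hx =>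
    ((mem_geodSphere_iff hp hR0.le (by linarith [Real.pi_pos])).mp (hF.boundary_mem x hx)).2
  refine ⟨hF.smooth, hF.immersion, fun x => (hF.mem_ball x).1, hF.minimal, hb, fun x hx => ?_, hp,
    cos_sq_lt_one hR0 hR⟩
  rw [← smul_gradDist_eq hp (hF.mem_ball x).1 (by rw [hb x hx]; exact cos_sq_lt_one hR0 hR)]
  exact Submodule.smul_mem _ _ (hF.orthogonal x hx)

lemma contMDiffAt_comp_of_contDiffOn {W : Amb n → Amb n} {s : Set (Amb n)} {U : Set M} {x : M}
    (hW : ContDiffOn ℝ 1 W s) (hF : ContMDiff (𝓡∂ k) 𝓘(ℝ, Amb n) 1 F) (hU : IsOpen U)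
    (hUs : Set.MapsTo F U s) (hx : x ∈ U) :
    ContMDiffAt (𝓡∂ k) 𝓘(ℝ, Amb n) 1 (W ∘ F) x := by
  have h1 : ContMDiffWithinAt 𝓘(ℝ, Amb n) 𝓘(ℝ, Amb n) 1 W s (F x) :=
    (hW (F x) (hUs hx)).contMDiffWithinAt
  exact (h1.comp x (hF x).contMDiffWithinAt hUs).contMDiffAt (hU.mem_nhds hx)

end FreeBoundary

end SphereBall

end

/-! ### The area bound and the equality case -/

theorem proposition2p3 {n k : ℕ} [NeZero k] {R : ℝ} (hR₀ : 0 < R) (hR : R ≤ Real.pi / 2)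
    (p : SphereBall.Amb n) (hp : ‖p‖ = 1)
    (hW : ∀ y ∈ SphereBall.geodSphere p R, ∃ W : SphereBall.Amb n → SphereBall.Amb n,
      -- `W` is a vector field on `B_R ∖ {y}`, continuously differentiable up to the boundary
      ContDiffOn ℝ 1 W (SphereBall.geodBall p R \ {y}) ∧
      (∀ x ∈ SphereBall.geodBall p R \ {y}, ⟪W x, x⟫ = 0) ∧
      -- (i) the singularity at `y`
      (fun x => W x - (-2 * SphereBall.radialInt k R *
          SphereBall.geodDist y x ^ (1 - (k : ℤ))) • SphereBall.gradDist y x)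
        =o[𝓝[SphereBall.geodBall p R \ {y}] y]
          (fun x => SphereBall.geodDist y x ^ (1 - (k : ℤ))) ∧
      -- (ii) tangency to `∂B_R`
      (∀ x ∈ SphereBall.geodSphere p R \ {y}, ⟪W x, SphereBall.gradDist p x⟫ = 0) ∧
      -- (iii) the divergence on minimal surfaces, with the equality case
      (∀ (N : Type u) [TopologicalSpace N] [T2Space N] [SecondCountableTopology N]
        [ChartedSpace (EuclideanHalfSpace k) N] [IsManifold (𝓡∂ k) ∞ N]
        (G : N → SphereBall.Amb n), SphereBall.IsMinimalSurfaceIn k p R G →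
          (∀ x, G x ≠ y → SphereBall.surfDiv (k := k) G (W ∘ G) x ≤ 1) ∧
          ((∀ x, G x ≠ y → SphereBall.surfDiv (k := k) G (W ∘ G) x = 1) →
            ∀ x, G x ≠ y → G x ≠ p →
              SphereBall.surfGradDist (k := k) p G x = SphereBall.gradDist p (G x))))
    (M : Type u) [TopologicalSpace M] [T2Space M] [CompactSpace M] [Nonempty M]
    [ChartedSpace (EuclideanHalfSpace k) M] [IsManifold (𝓡∂ k) ∞ M]
    [MeasurableSpace M] [BorelSpace M]
    (F : M → SphereBall.Amb n) (hF : SphereBall.IsFreeBoundaryMinimal k p R F) :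
    SphereBall.ballVolume k R ≤ SphereBall.area k F ∧
      (SphereBall.area k F = SphereBall.ballVolume k R →
        Function.Injective F ∧
        ∃ L : Submodule ℝ (SphereBall.Amb n), Module.finrank ℝ L = k + 1 ∧ p ∈ L ∧
          Set.range F = (L : Set (SphereBall.Amb n)) ∩ SphereBall.geodBall p R) := by
  have hπ : R ≤ Real.pi := by linarith [Real.pi_pos]
  have hmin := hF.isMinimalOrthogonal hR₀ hR hp
  have hball : ∀ x, Real.cos R ≤ ⟪p, F x⟫ := fun x =>
    ((SphereBall.mem_geodBall_iff hp hR₀.le hπ).mp (hF.mem_ball x)).2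
  have hc : 0 ≤ Real.cos R := Real.cos_nonneg_of_mem_Icc ⟨by linarith, hR⟩
  have hc1 := SphereBall.cos_sq_lt_one hR₀ hR
  have hI := SphereBall.radialInt_pos (k := k) hR₀ hR
  have hS := SphereBall.sphereArea_pos (k := k)
  have hfinite := SphereBall.isFiniteMeasure_areaMeasure hF.smooth
  have harea : SphereBall.area k F ≠ ⊤ := MeasureTheory.measure_ne_top _ _
  obtain ⟨x₁, hx₁⟩ := SphereBall.exists_inner_eq hmin hc hball
  set y := F x₁
  have hy1 : ‖y‖ = 1 := hmin.norm_eq x₁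
  have hy : y ∈ SphereBall.geodSphere p R :=
    (SphereBall.mem_geodSphere_iff hp hR₀.le hπ).mpr ⟨hy1, hx₁⟩
  obtain ⟨W, hW1, hWt, hWi, hWb, hWd⟩ := hW y hy
  -- The divergence hypothesis is about second countable manifolds; here compactness provides this.
  have : SecondCountableTopology (EuclideanHalfSpace k) :=
    TopologicalSpace.Subtype.secondCountableTopology _
  have hsc : SecondCountableTopology M :=
    ChartedSpace.secondCountable_of_sigmaCompact (EuclideanHalfSpace k) M
  obtain ⟨hdiv, hdiveq⟩ := hWd M F hF.toIsMinimalSurfaceIn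
  have hmaps : ∀ x, F x ≠ y → F x ∈ SphereBall.geodBall p R \ {y} := fun x hx =>
    ⟨hF.mem_ball x, hx⟩
  have key := SphereBall.le_area_of_surfDiv_le_one (X := W ∘ F) hmin hI.le ⟨x₁, rfl⟩
    (fun x hx => SphereBall.contMDiffAt_comp_of_contDiffOn (U := {x | F x ≠ y}) hW1 hmin.smooth_one
      (isOpen_ne.preimage hF.smooth.continuous) (fun x hx => hmaps x hx) hx)
    (fun x hx => hWt _ (hmaps x hx))
    (fun x hb hx => by
      -- On `∂B_R` the vector `p` is a combination of `∇ d_p` and the position vector, and `W` is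
      -- orthogonal to both.
      have h1 := hWb (F x) ⟨hF.boundary_mem x hb, hx⟩
      have h2 := hWt _ (hmaps x hx)
      have h3 := SphereBall.smul_gradDist_eq hp (hmin.norm_eq x)
        (by rw [hmin.boundary_inner x hb]; exact hc1)
      have h4 : ⟪W (F x), p - ⟪p, F x⟫ • F x⟫ = 0 := by
        rw [← h3, real_inner_smul_right, h1, mul_zero]
      rw [inner_sub_right, real_inner_smul_right, h2, mul_zero, sub_zero] at h4
      exact h4)
    (fun x₀ hx₀ => by
      have ht := SphereBall.tendsto_nhdsNE_of_injective hmin.smooth_one (hmin.injective x₀) hx₀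
      refine SphereBall.isLittleO_of_geodDist hy1 ht
        (Filter.Eventually.of_forall hmin.norm_eq) ?_
      have ht' : Filter.Tendsto F (𝓝[≠] x₀) (𝓝[SphereBall.geodBall p R \ {y}] y) := by
        obtain ⟨h1, h2⟩ := tendsto_nhdsWithin_iff.mp ht
        exact tendsto_nhdsWithin_iff.mpr ⟨h1, h2.mono fun x hx => hmaps x hx⟩
      have h1 := hWi.comp_tendsto ht'
      simpa only [neg_mul, Function.comp_def] using h1)
    hdiv
  rw [SphereBall.ballVolume_eq hR₀ hR]
  refine ⟨(ENNReal.ofReal_le_iff_le_toReal harea).mpr key.1, fun heq => ?_⟩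
  have heq' : (SphereBall.area k F).toReal =
      SphereBall.sphereArea k * SphereBall.radialInt k R := by
    rw [heq, ENNReal.toReal_ofReal (by positivity)]
  have hgrad := hdiveq (key.2 heq')
  -- Over `p` the radial vector is zero, so tangency is trivial there. Elsewhere it is a multiple of
  -- `∇ d_p`, which the projection fixes.
  have hT := SphereBall.mem_tangentPlane_of_ne (y := y) hmin fun x hx => by
    by_cases hxp : F x = p
    · rw [hxp, real_inner_self_eq_norm_sq, hp]
      simp
    · rw [← SphereBall.smul_gradDist_eq hp (hmin.norm_eq x)
        (SphereBall.inner_sq_lt_one hmin hc hball hxp)]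
      exact Submodule.smul_mem _ _
        (Submodule.starProjection_eq_self_iff.mp (hgrad x hx hxp))
  have hcard := SphereBall.area_eq_card_mul hR₀ hR hmin hball hT
  rw [heq', mul_comm] at hcard
  -- The area is both `σ I(R)` and `σ I(R)` times the number of points over `p`, and `σ I(R)` is
  -- positive.
  have hone : (SphereBall.finite_fiber hmin.smooth_one hmin.injective p).toFinset.card = 1 := by
    have h1 := (mul_right_eq_self₀.mp hcard.symm).resolve_right (by positivity)
    exact_mod_cast h1
  obtain ⟨x₀, hx₀⟩ := Finset.card_eq_one.mp hone
  have hmem : ∀ x, F x = p ↔ x = x₀ := fun x => by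
    have h1 := Finset.mem_singleton (a := x₀) (b := x)
    rw [← hx₀] at h1
    simpa using h1
  exact SphereBall.injective_and_range_eq hR₀ hR hmin hball hT ((hmem x₀).mpr rfl)
    fun x hx => (hmem x).mp hx
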